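/- Write $(a)!:=\Gamma(a+1)$, let $\alpha,\beta>-1$ with $|\alpha-\beta|<4$, and put $b_1=\alpha$, $b_2=\beta$, $\nu_j=(b_j-1)/2$. **The recurrence.** Let $\mathbf T$ be the $n\times n$ upper shift (ones on the first superdiagonal) and $$\mathbf C_1=\mathbf I-\mathrm{diag}\Big(\tfrac{2k(k+\beta)}{(2k+\alpha+\beta)(2k+\alpha+\beta+1)}\Big)_{k=1}^n\mathbf T,\qquad \mathbf C_2=\mathbf I+\mathrm{diag}\Big(\tfrac{2k(k+\alpha+1)}{(2k+\alpha+\beta+1)(2k+\alpha+\beta+2)}\Big)_{k=1}^n\mathbf T,$$ $$d_k=\frac{2^{2k}k!\,(k+\alpha)!\,(k+\beta)!\,(k+\alpha+\beta)!}{(2k+\alpha+\beta)!\,(2k+\alpha+\beta+1)!}\quad(k\ge1),\qquad d_0=\frac{\alpha!\,\beta!}{(\alpha+\beta+1)!},$$ $$\mathbf N=\mathrm{diag}(1,\dots,n),\quad \mathbf D=\mathrm{diag}(d_0,\dots,d_{n-1}),\quad \mathbf D^+=\mathrm{diag}(d_1,\dots,d_n),\quad \mathbf A=\mathbf C_1^{T}\mathbf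 C_2^{T}\mathbf N^{-1}\mathbf D^+\mathbf N^{-1}\mathbf C_2\mathbf C_1 .$$ For $k=0,1,2,\dots$ the equation $[(\mathbf A-\lambda\mathbf D)\vec v]_k=0$, taken with any $n>k+2$ (row $k$ does not depend on such $n$), becomes after the substitution $v_s=x_s\,\frac{(2s+\alpha+\beta+1)!}{2^{s}(s+\alpha)!(s+\beta)!}$ a five-term recurrence connecting $x_{k-2},\dots,x_{k+2}$ (with $x_{-2}=x_{-1}=0$), which determines $x_{k+2}$. Let $\mathbf M_2(k,\lambda)$ be the $4\times4$ matrix of two consecutive steps of it: $\vec X_{k+2}=\mathbf M_2(k,\lambda)\vec X_k$, $\vec X_k=(x_{k-2},x_{k-1},x_k,x_{k+1})^{T}$ (the coefficients at entries of negative index, which occur only for $k=0$, are taken to be $0$). Put $$\mathbf U_k=\begin{pmatrix}1&1&0&0\\1&-1&0&0\\-\kappa&-\kappa&\kappa&\kappa\\-\kappa&\kappa&\kappa&-\kappa\end{pmatrix},\quad \kappa=\max(k,1),\qquad \widehat{\mathbf M}_2(k,\lambda)=\mathbf U_{k+2}\mathbf M_2(k,\lambda)\mathbf U_k^{-1}.$$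 **The particular solutions.** Let $x^{(1)}_k=\frac{(k+\alpha)!}{k!}$, $x^{(2)}_k=(-1)^k\frac{(k+\beta)!}{k!}$ for $k\ge0$, $x_k^{(j)}=0$ for $k<0$, and $\vec X^{(j)}_k=(x^{(j)}_{k-2},x^{(j)}_{k-1},x^{(j)}_k,x^{(j)}_{k+1})^T$. For $j=1,2$, $\lambda\in\mathbb C$ and even $k\ge0$ let $\vec Y^{(j)}_k(\lambda)\in\mathbb C^4$ be defined by $$\vec Y^{(j)}_{k+2}(\lambda)=\widehat{\mathbf M}_2(k,\lambda)\,\vec Y^{(j)}_k(\lambda)\quad(k=0,2,4,\dots),\qquad \vec Y^{(j)}_0(\lambda)=\mathbf U_0\vec X^{(j)}_0 .$$ **The limit functions.** For $t>0$, $l\in\mathbb C$ let $$y_j(t,l)=\frac{2^{b_j}\,\nu_j!}{l^{\nu_j/2}}\;t\,J_{\nu_j}\Big(\frac{\sqrt l\,t^2}{2}\Big)$$ (an entire function of $l$, with value $2t^{b_j}$ at $l=0$), and $\vec y^{(1)}=(y_1,0,2t\,\partial_ty_1,0)^T$, $\vec y^{(2)}=(0,y_2,0,2t\,\partial_ty_2)^T$.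 **Claim.** For $j=1,2$: 1. $\vec Y^{(j)}_k(0)=\mathbf U_k\vec X^{(j)}_k$ for all even $k\ge0$. 2. For every $l\in\mathbb C$, $\vec y^{(j)}(\cdot,l)$ solves on $(0,\infty)$ the system $$\frac{d}{dt}\vec y=\frac1t\begin{pmatrix}0&0&\frac12&0\\0&0&0&\frac12\\-2lt^4+2\alpha(\alpha-2)&0&2&0\\0&-2lt^4+2\beta(\beta-2)&0&2\end{pmatrix}\vec y$$ and satisfies the matching condition $\vec y^{(j)}(t,l)=t^{b_j}\big(\vec C_0^{(j)}+o(1)\big)$ as $t\to0^+$, where $\vec C^{(1)}_0=(2,0,4\alpha,0)^T$ and $\vec C^{(2)}_0=(0,2,0,4\beta)^T$. 3. For all compact sets $K\subset(0,1]$ and $\widetilde K\subset\mathbb C$, as $n\to\infty$ and $k/n\to t$ with $k$ even, $$\vec Y^{(j)}_k\Big(\frac{l}{n^4}\Big)=n^{b_j}\Big(\vec y^{(j)}(t,l)+o(t^{b_j})\Big)\quad\text{uniformly for } l\in\widetilde K,\ t\in K;$$ that is, for every $\varepsilon>0$ there are $\delta>0$ and $n_0$ such that $\big|\vec Y^{(j)}_k(l/n^4)-n^{b_j}\vec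 y^{(j)}(t,l)\big|\le\varepsilon\,n^{b_j}t^{b_j}$ whenever $n\ge n_0$, $k$ is even, $t\in K$, $|k/n-t|<\delta$ and $l\in\widetilde K$. -/

import Mathlib

open scoped Matrix

namespace MarkovJacobi

noncomputable section

/-! ### The matrix pencil `A - lam * D` in the basis of monic Jacobi polynomials

All rows and columns are indexed from `0`.  The `n × n` matrices `C₁`, `C₂` are upper bidiagonal,
so `C₂ C₁` is upper triangular with two superdiagonals, and for `k + 2 < n` the `k`-th row of
`A = C₁ᵀ C₂ᵀ N⁻¹ D⁺ N⁻¹ C₂ C₁` does not depend on `n`.  The entries below are those common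
entries. -/

/-- Entries of `C₁ = I - diag(2k(k+β) / ((2k+α+β)(2k+α+β+1)))_{k=1,2,…} T`, with `T` the upper
shift (the `k`-th diagonal element stands in row `k - 1`). -/
def C₁ (α β : ℝ) (i j : ℕ) : ℝ :=
  if j = i then 1
  else if j = i + 1 then
    -(2 * (j : ℝ) * (j + β) / ((2 * j + α + β) * (2 * j + α + β + 1)))
  else 0

/-- Entries of `C₂ = I + diag(2k(k+α+1) / ((2k+α+β+1)(2k+α+β+2)))_{k=1,2,…} T`. -/
def C₂ (α β : ℝ) (i j : ℕ) : ℝ :=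
  if j = i then 1
  else if j = i + 1 then
    2 * (j : ℝ) * (j + α + 1) / ((2 * j + α + β + 1) * (2 * j + α + β + 2))
  else 0

/-- Entries of the upper triangular matrix `C₂ C₁`. -/
def C₂C₁ (α β : ℝ) (i j : ℕ) : ℝ :=
  ∑ m ∈ Finset.range (j + 1), C₂ α β i m * C₁ α β m j

/-- The squared norm `d_k` of the monic Jacobi polynomial of degree `k`, up to a factor that does
not depend on `k`:
`d_k = 2^(2k) k! (k+α)! (k+β)! (k+α+β)! / ((2k+α+β)! (2k+α+β+1)!)`, with `(a)! = Γ(a+1)`.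
For `k = 0` the factors `(k+α+β)!` and `(2k+α+β)!` coincide and are cancelled, since both have a
pole if `α + β = -1`. -/
def d (α β : ℝ) (k : ℕ) : ℝ :=
  if k = 0 then
    Real.Gamma (α + 1) * Real.Gamma (β + 1) / Real.Gamma (α + β + 2)
  else
    2 ^ (2 * k) * (k.factorial : ℝ) * Real.Gamma (k + α + 1) * Real.Gamma (k + β + 1) *
        Real.Gamma (k + α + β + 1) /
      (Real.Gamma (2 * k + α + β + 1) * Real.Gamma (2 * k + α + β + 2))

/-- Entries of `A = (C₂ C₁)ᵀ N⁻¹ D⁺ N⁻¹ (C₂ C₁)`, where `N = diag(1, 2, …)` and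
`D⁺ = diag(d_1, d_2, …)`; the sum stops at `i = k` because `C₂ C₁` is upper triangular. -/
def A (α β : ℝ) (k s : ℕ) : ℝ :=
  ∑ i ∈ Finset.range (k + 1),
    C₂C₁ α β i k * (d α β (i + 1) / ((i : ℝ) + 1) ^ 2) * C₂C₁ α β i s

/-! ### The five-term recurrence and its matrix form -/

/-- The factor in the change of variables `v_k = g_k x_k`,
`g_k = (2k+α+β+1)! / (2^k (k+α)! (k+β)!)`. -/
def g (α β : ℝ) (k : ℕ) : ℝ :=
  Real.Gamma (2 * k + α + β + 2) /
    (2 ^ k * Real.Gamma (k + α + 1) * Real.Gamma (k + β + 1))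

/-- The coefficient of `x_s` in the `k`-th coordinate of `(A - lam D) v`, with `v_s = g_s x_s` and
`D = diag(d_0, d_1, …)`. -/
def pencilCoeff (α β : ℝ) (lam : ℂ) (k s : ℕ) : ℂ :=
  ((A α β k s : ℂ) - (if s = k then lam * (d α β k : ℂ) else 0)) * (g α β s : ℂ)

/-- The five-term recurrence `∑_{s=k-2}^{k+2} pencilCoeff k s * x_s = 0`, solved for `x_{k+2}`:
`x_{k+2} = ∑_{i=0}^{3} recCoeff k i * x_{k-2+i}`, where the terms with a negative index `k - 2 + i`
are absent (`x_{-2} = x_{-1} = 0`). -/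
def recCoeff (α β : ℝ) (lam : ℂ) (k i : ℕ) : ℂ :=
  if 2 ≤ k + i then
    -(pencilCoeff α β lam k (k + i - 2) / pencilCoeff α β lam k (k + 2))
  else 0

/-- The one-step matrix of the recurrence: it takes
`X_k = (x_{k-2}, x_{k-1}, x_k, x_{k+1})` to `X_{k+1}`. -/
def M₁ (α β : ℝ) (k : ℕ) (lam : ℂ) : Matrix (Fin 4) (Fin 4) ℂ :=
  !![0, 1, 0, 0;
     0, 0, 1, 0;
     0, 0, 0, 1;
     recCoeff α β lam k 0, recCoeff α β lam k 1, recCoeff α β lam k 2, recCoeff α β lam k 3]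

/-- The matrix of the recurrence `X_{k+2} = M₂(k, lam) X_k`. -/
def M₂ (α β : ℝ) (k : ℕ) (lam : ℂ) : Matrix (Fin 4) (Fin 4) ℂ :=
  M₁ α β (k + 1) lam * M₁ α β k lam

/-- The auxiliary number `k` for `k > 0`, and `1` for `k = 0`. -/
def kk (k : ℕ) : ℂ := if k = 0 then 1 else (k : ℂ)

/-- The matrix `U_k` of the change of variables `Y_k = U_k X_k`. -/
def U (k : ℕ) : Matrix (Fin 4) (Fin 4) ℂ :=
  !![1, 1, 0, 0;
     1, -1, 0, 0;
     -kk k, -kk k, kk k, kk k;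
     -kk k, kk k, kk k, -kk k]

/-- The matrix of the recurrence `Y_{k+2} = Mhat₂(k, lam) Y_k`. -/
def Mhat₂ (α β : ℝ) (k : ℕ) (lam : ℂ) : Matrix (Fin 4) (Fin 4) ℂ :=
  U (k + 2) * M₂ α β k lam * (U k)⁻¹

/-! ### The two explicit solutions for `lam = 0`

The index `j = 1, 2` is `0, 1 : Fin 2`. -/

/-- The exponents `b_1 = α`, `b_2 = β`. -/
def b (α β : ℝ) (j : Fin 2) : ℝ := ![α, β] j

/-- `x_k^{(1)}(0) = (k+α)! / k!` and `x_k^{(2)}(0) = (k+β)! / ((-1)^k k!)` for `k ≥ 0`,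
and `0` for `k < 0`. -/
def xZero (α β : ℝ) (j : Fin 2) (k : ℤ) : ℝ :=
  if k < 0 then 0
  else ![1, (-1) ^ k] j * Real.Gamma (k + b α β j + 1) / (k.toNat.factorial : ℝ)

/-- `X_k^{(j)}(0)`. -/
def XZero (α β : ℝ) (j : Fin 2) (k : ℕ) : Fin 4 → ℂ :=
  ![(xZero α β j ((k : ℤ) - 2) : ℂ), (xZero α β j ((k : ℤ) - 1) : ℂ),
    (xZero α β j (k : ℤ) : ℂ), (xZero α β j ((k : ℤ) + 1) : ℂ)]

/-- `Y_k^{(j)}(0) = U_k X_k^{(j)}(0)`. -/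
def YZero (α β : ℝ) (j : Fin 2) (k : ℕ) : Fin 4 → ℂ := U k *ᵥ XZero α β j k

/-! ### The limiting system of differential equations -/

/-- The Bessel function of the first kind `J_ν(z)` (principal branch of `(z/2)^ν`). -/
def besselJ (ν : ℝ) (z : ℂ) : ℂ :=
  (z / 2) ^ (ν : ℂ) *
    ∑' m : ℕ, (-1 : ℂ) ^ m / ((m.factorial : ℂ) * Complex.Gamma ((m : ℂ) + ν + 1)) *
      (z / 2) ^ (2 * m)

/-- `ν(b) = (b - 1) / 2`. -/
def nu (b : ℝ) : ℝ := (b - 1) / 2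

/-- `y(t, l) = 2^b ν! l^(-ν/2) t J_ν(√l t² / 2)` with `ν = ν(b)`; this is an entire function of `l`
with value `2 t^b` at the removable singularity `l = 0`. -/
def yScalar (b t : ℝ) (l : ℂ) : ℂ :=
  if l = 0 then ((2 * t ^ b : ℝ) : ℂ)
  else
    (((2 : ℝ) ^ b * Real.Gamma (nu b + 1) : ℝ) : ℂ) / l ^ ((nu b / 2 : ℝ) : ℂ) * (t : ℂ) *
      besselJ (nu b) (l ^ (1 / 2 : ℂ) * (t : ℂ) ^ 2 / 2)

/-- `2 t (d/dt) y(t, l)`. -/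
def zScalar (b t : ℝ) (l : ℂ) : ℂ := 2 * (t : ℂ) * deriv (fun s : ℝ => yScalar b s l) t

/-- The vectors `y^{(1)} = (y_1, 0, 2 t y_1', 0)` and `y^{(2)} = (0, y_2, 0, 2 t y_2')`. -/
def yVec (α β : ℝ) (j : Fin 2) (t : ℝ) (l : ℂ) : Fin 4 → ℂ :=
  ![![yScalar α t l, 0, zScalar α t l, 0],
    ![0, yScalar β t l, 0, zScalar β t l]] j

/-- The matrix of the limiting system `dy/dt = (1/t) Mtilde₃(t, l) y`. -/
def Mtilde₃ (α β t : ℝ) (l : ℂ) : Matrix (Fin 4) (Fin 4) ℂ :=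
  !![0, 0, 1 / 2, 0;
     0, 0, 0, 1 / 2;
     -2 * l * (t : ℂ) ^ 4 + 2 * α * (α - 2), 0, 2, 0;
     0, -2 * l * (t : ℂ) ^ 4 + 2 * β * (β - 2), 0, 2]

/-- The leading coefficients `(2, 0, 4α, 0)` and `(0, 2, 0, 4β)` in the matching condition. -/
def C₀ (α β : ℝ) (j : Fin 2) : Fin 4 → ℂ :=
  ![![2, 0, 4 * (α : ℂ), 0], ![0, 2, 0, 4 * (β : ℂ)]] j

end

end MarkovJacobi

/-! In the variables `x` the pencil factors. With `L` (`secondOrder`) the operator `g⁻¹ C₂ C₁ g`,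
the recurrence multiplied by `g` reads `Lᵀ η L x = lam ρ x`, where `η` and `ρ` are positive diagonal
weights (`eta`, `rho`). The three-term operator `L` annihilates `φ_k = phi α k` and `(-1)^k ψ_k`
with `ψ_k = phi β k`, so `Lᵀ η L` can be inverted explicitly.

The first particular solution is sought as a power series in `lam` whose coefficients satisfy `Lᵀ η
L x⁽⁰⁾ = 0` and `Lᵀ η L x⁽ᵐ⁺¹⁾ = ρ x⁽ᵐ⁾`. Variation of constants writes `x⁽ᵐ⁾ = A_m φ + (-1)^k B_m
ψ`, where the amplitudes of each order are partial sums of explicit expressions in the previous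
order (`stepA`, `stepB`; the identities are `secondOrder_xCoeff_succ` and
`secondOrderAdjoint_xCoeff_succ`). Positive orders do not change the entries 0 and 1, so the series
has the prescribed initial vector, and it is the solution propagated by the recurrence matrices.

Each order raises the growth by four powers of `k`: `A_m ~ limCoeff m * k^(4m)`. The leading part of
the increments of `B_m` alternates in sign, and cancellation gives `B_m = o(k^(4m+α-β))`
(`amp_asymp`). Summation needs `4 + α - β > 0`, and the second solution needs the same with `α` and
`β` exchanged; this is the condition `|α-β| < 4`. Bounds of the form `M^m / m!` (`amp_bound`) make
the series converge and justify passing to the limit term by term after `lam = l / n^4`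
(`exists_scaled_bound`).

The matrix `U_k` forms sums and differences of neighbours, and `k` times their increments over two
steps. For the first solution the sums survive in the limit and the differences vanish. The limiting
power series in `l t^4` is the Bessel function of the statement, and its recursion for the
coefficients is the limiting differential equation. The second solution is obtained from the first
by `x_k ↦ (-1)^k x_k`, which exchanges `α` with `β` and sums with differences. -/

namespace MarkovJacobi

noncomputable section

open Filter Topology

/-! ### Sequences with a power asymptotics -/

/-- The sequence `u` satisfies `u k = (k + 1) ^ γ * (c + o(1))`. -/
def PowAsymp (u : ℕ → ℝ) (γ c : ℝ) : Prop :=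
  Tendsto (fun k : ℕ => u k / ((k : ℝ) + 1) ^ γ) atTop (𝓝 c)

theorem rpow_cast_succ_pos (k : ℕ) (γ : ℝ) : 0 < ((k : ℝ) + 1) ^ γ :=
  Real.rpow_pos_of_pos (by positivity) _

namespace PowAsymp

variable {u v : ℕ → ℝ} {γ δ c e : ℝ}

theorem congr (h : PowAsymp u γ c) (huv : ∀ k, u k = v k) (hγ : γ = δ) (hc : c = e) :
    PowAsymp v δ e := by
  subst hγ hc
  exact h.congr fun k => by rw [huv]

theorem add (h : PowAsymp u γ c) (h' : PowAsymp v γ e) :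
    PowAsymp (fun k => u k + v k) γ (c + e) := by
  refine (Tendsto.add h h').congr fun k => ?_
  rw [add_div]

theorem sub (h : PowAsymp u γ c) (h' : PowAsymp v γ e) :
    PowAsymp (fun k => u k - v k) γ (c - e) := by
  refine (Tendsto.sub h h').congr fun k => ?_
  rw [sub_div]

theorem neg (h : PowAsymp u γ c) : PowAsymp (fun k => -u k) γ (-c) := by
  refine (Tendsto.neg h).congr fun k => ?_
  rw [neg_div]

theorem mul (h : PowAsymp u γ c) (h' : PowAsymp v δ e) :
    PowAsymp (fun k => u k * v k) (γ + δ) (c * e) := by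
  refine (Tendsto.mul h h').congr fun k => ?_
  rw [Real.rpow_add (by positivity), div_mul_div_comm]

theorem inv (h : PowAsymp u γ c) (hc : c ≠ 0) : PowAsymp (fun k => (u k)⁻¹) (-γ) c⁻¹ := by
  refine (Tendsto.inv₀ h hc).congr fun k => ?_
  rw [Real.rpow_neg (by positivity), inv_div, div_inv_eq_mul, div_eq_mul_inv, mul_comm]

theorem const (c : ℝ) : PowAsymp (fun _ => c) 0 c := by
  simp [PowAsymp]

theorem const_mul (a : ℝ) (h : PowAsymp u γ c) : PowAsymp (fun k => a * u k) γ (a * c) := by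
  refine (Tendsto.const_mul a h).congr fun k => ?_
  rw [mul_div_assoc]

theorem tendsto_shift (γ : ℝ) (m : ℕ) :
    Tendsto (fun k : ℕ => (((k + m : ℕ) : ℝ) + 1) ^ γ / ((k : ℝ) + 1) ^ γ) atTop (𝓝 1) := by
  have h1 : Tendsto (fun k : ℕ => 1 + (m : ℝ) * ((k : ℝ) + 1)⁻¹) atTop (𝓝 (1 + (m : ℝ) * 0)) :=
    ((tendsto_inv_atTop_zero.comp
      (tendsto_atTop_add_const_right _ 1 tendsto_natCast_atTop_atTop)).const_mul _).const_add _
  have h2 := h1.rpow_const (p := γ) (Or.inl (by simp))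
  simp only [mul_zero, add_zero, Real.one_rpow] at h2
  refine h2.congr fun k => ?_
  rw [← Real.div_rpow (by positivity) (by positivity)]
  congr 1
  push_cast
  field_simp
  ring

theorem shift (m : ℕ) (h : PowAsymp u γ c) : PowAsymp (fun k => u (k + m)) γ c := by
  have h1 := (Tendsto.comp h (tendsto_add_atTop_nat m)).mul (tendsto_shift γ m)
  rw [mul_one] at h1
  refine Tendsto.congr (fun k => ?_) h1
  have := (rpow_cast_succ_pos (k + m) γ).ne'
  simp only [Function.comp]
  field_simp

theorem of_succ (h : PowAsymp (fun k => u (k + 1)) γ c) : PowAsymp u γ c := by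
  have h1 := Tendsto.mul h ((tendsto_shift γ 1).inv₀ one_ne_zero)
  rw [inv_one, mul_one] at h1
  refine (tendsto_add_atTop_iff_nat 1).1 (h1.congr fun k => ?_)
  have := (rpow_cast_succ_pos k γ).ne'
  field_simp

theorem alternate (h : PowAsymp u γ 0) : PowAsymp (fun k => (-1) ^ k * u k) γ 0 := by
  unfold PowAsymp at h ⊢
  rw [tendsto_zero_iff_norm_tendsto_zero] at h ⊢
  refine h.congr fun k => ?_
  simp

/-- The index itself. -/
theorem linear (a : ℝ) {b : ℝ} : PowAsymp (fun k => a * (k : ℝ) + b) 1 a := by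
  have h1 : Tendsto (fun k : ℕ => a + (b - a) * ((k : ℝ) + 1)⁻¹) atTop (𝓝 (a + (b - a) * 0)) :=
    ((tendsto_inv_atTop_zero.comp
      (tendsto_atTop_add_const_right _ 1 tendsto_natCast_atTop_atTop)).const_mul _).const_add _
  rw [mul_zero, add_zero] at h1
  refine h1.congr fun k => ?_
  rw [Real.rpow_one]
  field_simp
  ring

theorem bounded (h : PowAsymp u γ c) :
    ∃ C : ℝ, 0 ≤ C ∧ ∀ k : ℕ, |u k| ≤ C * ((k : ℝ) + 1) ^ γ := by
  obtain ⟨C, hC⟩ := (Metric.isBounded_range_of_tendsto _ h).exists_norm_le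
  have hC' : ∀ k : ℕ, |u k| ≤ C * ((k : ℝ) + 1) ^ γ := fun k => by
    have := hC _ ⟨k, rfl⟩
    rwa [Real.norm_eq_abs, abs_div, abs_of_pos (rpow_cast_succ_pos k γ),
      div_le_iff₀ (rpow_cast_succ_pos k γ)] at this
  refine ⟨C, ?_, hC'⟩
  have := (abs_nonneg _).trans (hC' 0)
  simpa using this

/-- After division by `(k+1)^(γ-1)` the difference is the slope of `x^γ` at `1` with increment
`-1/(k+1)`, so its limit is the derivative at `1`. -/
theorem power_difference (γ : ℝ) :
    PowAsymp (fun k => ((k : ℝ) + 1) ^ γ - (k : ℝ) ^ γ) (γ - 1) γ := by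
  have hd : HasDerivAt (fun x : ℝ => x ^ γ) γ 1 := by
    simpa using Real.hasDerivAt_rpow_const (x := 1) (p := γ) (Or.inl one_ne_zero)
  have hs := hd.tendsto_slope_zero
  have ht : Tendsto (fun k : ℕ => -((k : ℝ) + 1)⁻¹) atTop (𝓝[≠] 0) := by
    rw [tendsto_nhdsWithin_iff]
    constructor
    · simpa using (tendsto_inv_atTop_zero.comp
        (tendsto_atTop_add_const_right _ (1 : ℝ) tendsto_natCast_atTop_atTop)).neg
    · exact Eventually.of_forall fun k => by
        simp only [Set.mem_compl_iff, Set.mem_singleton_iff, neg_eq_zero, inv_eq_zero]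
        positivity
  refine (hs.comp ht).congr fun k => ?_
  have hk : (0 : ℝ) < (k : ℝ) + 1 := by positivity
  have e : 1 + -((k : ℝ) + 1)⁻¹ = (k : ℝ) / ((k : ℝ) + 1) := by field_simp; ring
  simp only [Function.comp, smul_eq_mul]
  rw [e, Real.div_rpow (by positivity) hk.le, Real.one_rpow, Real.rpow_sub_one hk.ne']
  have := (Real.rpow_pos_of_pos hk γ).ne'
  field_simp
  ring

/-- Summation raises the exponent by one. -/
theorem sum (hγ : 0 < γ) (h : PowAsymp u (γ - 1) c) :
    PowAsymp (fun k => ∑ i ∈ Finset.range k, u i) γ (c / γ) := by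
  -- The comparison sequence `f` telescopes to `k^γ`. Since `γ > 0` these sums diverge, so the
  -- partial sums of `u - (c/γ) f = o(f)` are `o(k^γ)`.
  set f : ℕ → ℝ := fun k => ((k : ℝ) + 1) ^ γ - (k : ℝ) ^ γ with hf
  have hfpos : ∀ k, 0 < f k := fun k =>
    sub_pos.2 (Real.rpow_lt_rpow (by positivity) (by linarith) hγ)
  have hfsum : ∀ k, ∑ i ∈ Finset.range k, f i = (k : ℝ) ^ γ := fun k => by
    have := Finset.sum_range_sub (fun i : ℕ => (i : ℝ) ^ γ) k
    simp only [Nat.cast_add, Nat.cast_one, Nat.cast_zero, Real.zero_rpow hγ.ne', sub_zero] at this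
    exact this
  have hratio : Tendsto (fun k => (u k - c / γ * f k) / f k) atTop (𝓝 0) := by
    have := ((Tendsto.div h (power_difference γ) hγ.ne').sub_const (c / γ))
    rw [sub_self] at this
    refine this.congr fun k => ?_
    have h1 := (hfpos k).ne'
    have h2 := (rpow_cast_succ_pos k (γ - 1)).ne'
    simp only [Pi.div_apply]
    change u k / _ / (f k / _) - _ = _
    field_simp
  have ho : (fun k => u k - c / γ * f k) =o[atTop] f :=
    (Asymptotics.isLittleO_iff_tendsto fun k hk => absurd hk (hfpos k).ne').2 hratio
  have hlim : Tendsto (fun k : ℕ => (k : ℝ) ^ γ) atTop atTop :=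
    (tendsto_rpow_atTop hγ).comp tendsto_natCast_atTop_atTop
  have hs := ho.sum_range (fun k => (hfpos k).le) (by simpa only [hfsum] using hlim)
  simp only [hfsum, Finset.sum_sub_distrib, ← Finset.mul_sum] at hs
  have hs' := hs.tendsto_div_nhds_zero
  have hq : Tendsto (fun k : ℕ => (k : ℝ) ^ γ / ((k : ℝ) + 1) ^ γ) atTop (𝓝 1) := by
    have h1 : Tendsto (fun k : ℕ => 1 - ((k : ℝ) + 1)⁻¹) atTop (𝓝 (1 - 0)) :=
      (tendsto_inv_atTop_zero.comp
        (tendsto_atTop_add_const_right _ 1 tendsto_natCast_atTop_atTop)).const_sub _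
    have h2 := h1.rpow_const (p := γ) (Or.inl (by simp))
    simp only [sub_zero, Real.one_rpow] at h2
    refine h2.congr fun k => ?_
    rw [← Real.div_rpow (by positivity) (by positivity)]
    congr 1
    field_simp
    ring
  have := (hs'.add_const (c / γ)).mul hq
  rw [zero_add, mul_one] at this
  refine this.congr' ?_
  filter_upwards [eventually_gt_atTop 0] with k hk
  have h1 : (k : ℝ) ^ γ ≠ 0 := (Real.rpow_pos_of_pos (by exact_mod_cast hk) γ).ne'
  have h2 := (rpow_cast_succ_pos k γ).ne'
  field_simp
  ring

theorem sum_succ (hγ : 0 < γ) (h : PowAsymp u (γ - 1) c) :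
    PowAsymp (fun k => ∑ i ∈ Finset.range (k + 1), u i) γ (c / γ) :=
  (h.sum hγ).shift 1

theorem of_even_odd {u : ℕ → ℝ} {c : ℝ} (h0 : Tendsto (fun k => u (2 * k)) atTop (𝓝 c))
    (h1 : Tendsto (fun k => u (2 * k + 1)) atTop (𝓝 c)) : Tendsto u atTop (𝓝 c) := by
  rw [Metric.tendsto_atTop] at h0 h1 ⊢
  intro ε hε
  obtain ⟨N0, h0⟩ := h0 ε hε
  obtain ⟨N1, h1⟩ := h1 ε hε
  refine ⟨2 * (N0 + N1) + 1, fun n hn => ?_⟩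
  obtain ⟨m, rfl | rfl⟩ := n.even_or_odd'
  · exact h0 m (by omega)
  · exact h1 m (by omega)

/-- An alternating sum is of smaller order than the corresponding sum. -/
theorem sum_alternate (hγ : 0 < γ) (h : PowAsymp u (γ - 1) c) :
    PowAsymp (fun k => ∑ i ∈ Finset.range k, (-1) ^ i * u i) γ 0 := by
  set S : ℕ → ℝ := fun k => ∑ i ∈ Finset.range k, (-1) ^ i * u i with hS
  have h2 : Tendsto (fun k : ℕ => 2 * k) atTop atTop :=
    tendsto_id.const_mul_atTop' (by norm_num)
  have hpow : ∀ δ : ℝ, Tendsto (fun k : ℕ => (((2 * k : ℕ) : ℝ) + 1) ^ δ / ((k : ℝ) + 1) ^ δ)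
      atTop (𝓝 (2 ^ δ)) := fun δ => by
    have h1 : Tendsto (fun k : ℕ => 2 - ((k : ℝ) + 1)⁻¹) atTop (𝓝 (2 - 0)) :=
      (tendsto_inv_atTop_zero.comp
        (tendsto_atTop_add_const_right _ 1 tendsto_natCast_atTop_atTop)).const_sub _
    have h2 := h1.rpow_const (p := δ) (Or.inl (by simp))
    rw [sub_zero] at h2
    refine h2.congr fun k => ?_
    rw [← Real.div_rpow (by positivity) (by positivity)]
    congr 1
    push_cast
    field_simp
    ring
  -- Terms are paired: consecutive values of `u` have the same leading part, so each pair is of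
  -- smaller order than `k^(γ-1)`.
  have hd : PowAsymp (fun k => u (2 * k) - u (2 * k + 1)) (γ - 1) 0 := by
    have h3 : PowAsymp (fun k => u k - u (k + 1)) (γ - 1) 0 :=
      (h.sub (h.shift 1)).congr (fun _ => rfl) rfl (sub_self c)
    have := (Tendsto.comp h3 h2).mul (hpow (γ - 1))
    rw [zero_mul] at this
    refine Tendsto.congr (fun k => ?_) this
    have := (rpow_cast_succ_pos (2 * k) (γ - 1)).ne'
    simp only [Function.comp]
    field_simp
  have heven : ∀ k, S (2 * k) = ∑ i ∈ Finset.range k, (u (2 * i) - u (2 * i + 1)) := fun k => by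
    induction k with
    | zero => simp [hS]
    | succ k ih =>
      rw [Finset.sum_range_succ, ← ih, hS]
      simp only [show 2 * (k + 1) = 2 * k + 1 + 1 by ring, Finset.sum_range_succ]
      simp [pow_succ, pow_mul]
      ring
  have hodd : ∀ k, S (2 * k + 1) = S (2 * k) + u (2 * k) := fun k => by
    simp only [hS, Finset.sum_range_succ]
    simp [pow_mul]
  have he : Tendsto (fun k => S (2 * k) / (((2 * k : ℕ) : ℝ) + 1) ^ γ) atTop (𝓝 0) := by
    have h3 := (Tendsto.div (hd.sum hγ) (hpow γ) (Real.rpow_pos_of_pos two_pos γ).ne')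
    rw [zero_div, zero_div] at h3
    refine h3.congr fun k => ?_
    have := (rpow_cast_succ_pos k γ).ne'
    rw [heven]
    simp only [Pi.div_apply]
    field_simp
  -- An odd partial sum has one unpaired term, which is of order `γ - 1` only.
  have hu : Tendsto (fun k => u (2 * k) / (((2 * k : ℕ) : ℝ) + 1) ^ γ) atTop (𝓝 0) := by
    have h4 := (Tendsto.comp (Tendsto.mul h (tendsto_inv_atTop_zero.comp
        (tendsto_atTop_add_const_right _ (1 : ℝ) tendsto_natCast_atTop_atTop))) h2)
    rw [mul_zero] at h4
    refine h4.congr fun k => ?_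
    have hk : (0 : ℝ) < ((2 * k : ℕ) : ℝ) + 1 := by positivity
    simp only [Function.comp]
    rw [Real.rpow_sub_one hk.ne']
    have := (Real.rpow_pos_of_pos hk γ).ne'
    field_simp
  refine of_even_odd he ?_
  have h6 : Tendsto (fun k => (S (2 * k) / (((2 * k : ℕ) : ℝ) + 1) ^ γ +
      u (2 * k) / (((2 * k : ℕ) : ℝ) + 1) ^ γ) *
      ((((2 * k + 1 : ℕ) : ℝ) + 1) ^ γ / (((2 * k : ℕ) : ℝ) + 1) ^ γ)⁻¹) atTop (𝓝 0) := by
    simpa using (he.add hu).mul ((tendsto_shift γ 1 |>.comp h2).inv₀ one_ne_zero)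
  refine h6.congr fun k => ?_
  rw [hodd]
  have := (rpow_cast_succ_pos (2 * k) γ).ne'
  have := (rpow_cast_succ_pos (2 * k + 1) γ).ne'
  field_simp

end PowAsymp

/-- A discrete form of `∫₀ˣ t ^ (γ - 1) = x ^ γ / γ`. -/
theorem sum_rpow_le {γ : ℝ} (hγ : 0 < γ) (k : ℕ) :
    ∑ i ∈ Finset.range k, ((i : ℝ) + 1) ^ (γ - 1) ≤ ((k : ℝ) + 1) ^ γ / γ := by
  -- Both cases are inductions by a Bernoulli inequality: for `γ ≥ 1` expanding `(k+2)^γ` around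
  -- `k+1`, for `γ ≤ 1` expanding `k^γ` around `k+1`, which gives the stronger bound `k^γ / γ`.
  rcases le_total 1 γ with h1 | h1
  · induction k with
    | zero => simp [hγ.le]
    | succ k ih =>
      rw [Finset.sum_range_succ]
      have hk : (0 : ℝ) < (k : ℝ) + 1 := by positivity
      have hb := one_add_mul_self_le_rpow_one_add (s := ((k : ℝ) + 1)⁻¹)
        ((by norm_num : (-1 : ℝ) ≤ 0).trans (by positivity)) h1
      have e : (((k + 1 : ℕ) : ℝ) + 1) ^ γ = ((k : ℝ) + 1) ^ γ * (1 + ((k : ℝ) + 1)⁻¹) ^ γ := by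
        rw [← Real.mul_rpow hk.le (by positivity)]
        congr 1
        push_cast
        field_simp
      have hp := Real.rpow_pos_of_pos hk γ
      have := mul_le_mul_of_nonneg_left hb hp.le
      rw [e, Real.rpow_sub_one hk.ne']
      rw [le_div_iff₀ hγ] at ih ⊢
      have e2 : ((k : ℝ) + 1) ^ γ * (1 + γ * ((k : ℝ) + 1)⁻¹) =
        ((k : ℝ) + 1) ^ γ + ((k : ℝ) + 1) ^ γ / ((k : ℝ) + 1) * γ := by field_simp
      linarith
  · have hmain : ∑ i ∈ Finset.range k, ((i : ℝ) + 1) ^ (γ - 1) ≤ (k : ℝ) ^ γ / γ := by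
      induction k with
      | zero => simp [Real.zero_rpow hγ.ne']
      | succ k ih =>
        rw [Finset.sum_range_succ]
        have hk : (0 : ℝ) < (k : ℝ) + 1 := by positivity
        have hi : ((k : ℝ) + 1)⁻¹ ≤ 1 := inv_le_one_of_one_le₀ (by linarith [k.cast_nonneg (α := ℝ)])
        have hb := rpow_one_add_le_one_add_mul_self (s := -((k : ℝ) + 1)⁻¹)
          (by linarith) hγ.le h1
        have e : (k : ℝ) ^ γ = ((k : ℝ) + 1) ^ γ * (1 + -((k : ℝ) + 1)⁻¹) ^ γ := by
          rw [← Real.mul_rpow hk.le (by linarith)]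
          congr 1
          field_simp
          ring
        have hp := Real.rpow_pos_of_pos hk γ
        have := mul_le_mul_of_nonneg_left hb hp.le
        rw [← e] at this
        push_cast
        rw [Real.rpow_sub_one hk.ne']
        rw [le_div_iff₀ hγ] at ih ⊢
        have e2 : ((k : ℝ) + 1) ^ γ * (1 + γ * -((k : ℝ) + 1)⁻¹) =
          ((k : ℝ) + 1) ^ γ - ((k : ℝ) + 1) ^ γ / ((k : ℝ) + 1) * γ := by field_simp; ring
        linarith
    refine hmain.trans (div_le_div_of_nonneg_right ?_ hγ.le)
    exact Real.rpow_le_rpow (by positivity) (by linarith) hγ.le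

/-- The explicit divisor `γ` is the point: in the iteration `γ` grows like `4m`, and the product of
these divisors produces the factor `1 / m!`. -/
theorem abs_sum_le_of_le_rpow {u : ℕ → ℝ} {γ C : ℝ} (hγ : 0 < γ)
    (h : ∀ k : ℕ, |u k| ≤ C * ((k : ℝ) + 1) ^ (γ - 1)) (k : ℕ) :
    |∑ i ∈ Finset.range k, u i| ≤ C / γ * ((k : ℝ) + 1) ^ γ := by
  have hC : 0 ≤ C := by simpa using (abs_nonneg _).trans (h 0)
  calc |∑ i ∈ Finset.range k, u i| ≤ ∑ i ∈ Finset.range k, |u i| := Finset.abs_sum_le_sum_abs _ _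
    _ ≤ ∑ i ∈ Finset.range k, C * ((i : ℝ) + 1) ^ (γ - 1) := Finset.sum_le_sum fun i _ => h i
    _ = C * ∑ i ∈ Finset.range k, ((i : ℝ) + 1) ^ (γ - 1) := (Finset.mul_sum ..).symm
    _ ≤ C * (((k : ℝ) + 1) ^ γ / γ) := mul_le_mul_of_nonneg_left (sum_rpow_le hγ k) hC
    _ = _ := by ring

theorem abs_sum_succ_le_of_le_rpow {u : ℕ → ℝ} {γ C : ℝ} (hγ : 0 < γ)
    (h : ∀ k : ℕ, |u k| ≤ C * ((k : ℝ) + 1) ^ (γ - 1)) (k : ℕ) :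
    |∑ i ∈ Finset.range (k + 1), u i| ≤ C * (1 + 1 / γ) * ((k : ℝ) + 1) ^ γ := by
  have hC : 0 ≤ C := by simpa using (abs_nonneg _).trans (h 0)
  rw [Finset.sum_range_succ]
  have hk : (1 : ℝ) ≤ (k : ℝ) + 1 := by linarith [k.cast_nonneg (α := ℝ)]
  have h1 : ((k : ℝ) + 1) ^ (γ - 1) ≤ ((k : ℝ) + 1) ^ γ :=
    Real.rpow_le_rpow_of_exponent_le hk (by linarith)
  calc _ ≤ |∑ i ∈ Finset.range k, u i| + |u k| := abs_add_le _ _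
    _ ≤ C / γ * ((k : ℝ) + 1) ^ γ + C * ((k : ℝ) + 1) ^ γ :=
      add_le_add (abs_sum_le_of_le_rpow hγ h k) ((h k).trans (mul_le_mul_of_nonneg_left h1 hC))
    _ = _ := by ring

section

/-! ### The coefficient sequences -/

/-- `(k + a)! / k!`. -/
def phi (a : ℝ) (k : ℕ) : ℝ := Real.Gamma (k + a + 1) / (k.factorial : ℝ)

/-- The absolute value of the Casoratian of `phi α` and `(-1) ^ k * phi β`. -/
def casoratian (α β : ℝ) (k : ℕ) : ℝ :=
  phi α k * phi β k * (2 * k + α + β + 2) / (k + 1)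

/-- The coefficients `d_k g_k ^ 2`. -/
def rho (α β : ℝ) (k : ℕ) : ℝ := d α β k * g α β k ^ 2

/-- The coefficients `g_k ^ 2 d_(k+1) / (k + 1) ^ 2`. -/
def eta (α β : ℝ) (k : ℕ) : ℝ := g α β k ^ 2 * (d α β (k + 1) / ((k : ℝ) + 1) ^ 2)

/-- The coefficient of the variation of constants formula. -/
def kappa (α β : ℝ) (k : ℕ) : ℝ := (eta α β k * casoratian α β k ^ 2)⁻¹

variable {α β a : ℝ}

theorem phi_pos (ha : -1 < a) (k : ℕ) : 0 < phi a k :=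
  div_pos (Real.Gamma_pos_of_pos (by linarith [k.cast_nonneg (α := ℝ)])) (by positivity)

theorem phi_succ (ha : -1 < a) (k : ℕ) :
    phi a (k + 1) = phi a k * ((k + 1 + a) / (k + 1)) := by
  have h : ((k + 1 : ℕ) : ℝ) + a + 1 = (k + a + 1) + 1 := by push_cast; ring
  unfold phi
  rw [h, Real.Gamma_add_one (by linarith [k.cast_nonneg (α := ℝ)]), Nat.factorial_succ]
  have : (k.factorial : ℝ) ≠ 0 := by positivity
  push_cast
  field_simp
  ring

theorem tendsto_add_div_add (b c : ℝ) :
    Tendsto (fun k : ℕ => ((k : ℝ) + b) / ((k : ℝ) + c)) atTop (𝓝 1) := by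
  have h (b : ℝ) : Tendsto (fun k : ℕ => (1 * (k : ℝ) + b) / ((k : ℝ) + 1) ^ (1 : ℝ)) atTop (𝓝 1) :=
    PowAsymp.linear 1
  have := (h b).div (h c) one_ne_zero
  rw [div_one] at this
  refine this.congr fun k => ?_
  have : (k : ℝ) + 1 ≠ 0 := by positivity
  simp only [Real.rpow_one, one_mul, Pi.div_apply]
  exact div_div_div_cancel_right₀ this _ _

theorem Gamma_add_nat_succ {s : ℝ} (hs : 0 < s) (n : ℕ) :
    Real.Gamma (n + s + 1) = (∏ j ∈ Finset.range (n + 1), (s + j)) * Real.Gamma s := by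
  induction n with
  | zero => simp [Real.Gamma_add_one hs.ne']
  | succ n ih =>
    rw [Finset.prod_range_succ, Real.Gamma_add_one (by positivity)]
    have : ((n + 1 : ℕ) : ℝ) + s = n + s + 1 := by push_cast; ring
    rw [this, ih]
    push_cast
    ring

/-- This is Euler's limit formula for the Gamma function. -/
theorem phi_asymp (ha : -1 < a) : PowAsymp (phi a) a 1 := by
  have hs : 0 < a + 1 := by linarith
  have hG := Real.Gamma_pos_of_pos hs
  have h1 := (Real.GammaSeq_tendsto_Gamma (a + 1)).inv₀ hG.ne'
  have h2 : Tendsto (fun k : ℕ => (k : ℝ) ^ (a + 1) / ((k : ℝ) + 1) ^ (a + 1)) atTop (𝓝 1) := by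
    have := (tendsto_add_div_add 0 1).rpow_const (p := a + 1) (Or.inl one_ne_zero)
    rw [Real.one_rpow] at this
    refine this.congr fun k => ?_
    rw [add_zero, Real.div_rpow (by positivity) (by positivity)]
  have h3 := ((h1.const_mul (Real.Gamma (a + 1))).mul h2).mul (tendsto_add_div_add 1 (1 + a))
  rw [mul_inv_cancel₀ hG.ne', mul_one, mul_one] at h3
  refine h3.congr' ?_
  filter_upwards [eventually_gt_atTop 0] with n hn
  have hn' : (0 : ℝ) < n := by exact_mod_cast hn
  have hp : (0 : ℝ) < ∏ j ∈ Finset.range (n + 1), (a + 1 + j) :=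
    Finset.prod_pos fun j _ => by positivity
  have hphi : phi a n =
      (∏ j ∈ Finset.range (n + 1), (a + 1 + j)) * Real.Gamma (a + 1) / (n + 1 + a) / n.factorial := by
    rw [← Gamma_add_nat_succ hs, phi]
    have e : (n : ℝ) + (a + 1) + 1 = (n + a + 1) + 1 := by ring
    have h0 : (0 : ℝ) < n + a + 1 := by linarith
    rw [e, Real.Gamma_add_one h0.ne', show (n : ℝ) + 1 + a = n + a + 1 by ring]
    congr 1
    field_simp
  have hpw := (Real.rpow_pos_of_pos hn' (a + 1)).ne'
  have hpw2 := (rpow_cast_succ_pos n a).ne'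
  have h0 : (n : ℝ) + (1 + a) ≠ 0 := by linarith
  have hf : (n.factorial : ℝ) ≠ 0 := by positivity
  rw [hphi, Real.GammaSeq, Real.rpow_add_one (x := (n : ℝ) + 1) (by positivity), add_assoc (n : ℝ)]
  field_simp

theorem g_pos (hα : -1 < α) (hβ : -1 < β) (k : ℕ) : 0 < g α β k := by
  have hk := k.cast_nonneg (α := ℝ)
  exact div_pos (Real.Gamma_pos_of_pos (by linarith)) (mul_pos (mul_pos (by positivity)
    (Real.Gamma_pos_of_pos (by linarith))) (Real.Gamma_pos_of_pos (by linarith)))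

theorem g_succ (hα : -1 < α) (hβ : -1 < β) (k : ℕ) :
    g α β (k + 1) = g α β k *
      ((2 * k + α + β + 3) * (2 * k + α + β + 2) / (2 * (k + 1 + α) * (k + 1 + β))) := by
  have hk := k.cast_nonneg (α := ℝ)
  have h1 : 2 * ((k + 1 : ℕ) : ℝ) + α + β + 2 = 2 * k + α + β + 2 + 1 + 1 := by push_cast; ring
  have h2 (c : ℝ) : ((k + 1 : ℕ) : ℝ) + c + 1 = (k + c + 1) + 1 := by push_cast; ring
  have p1 : 0 < k + α + 1 := by linarith
  have p2 : 0 < k + β + 1 := by linarith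
  have p3 : 0 < 2 * k + α + β + 2 := by linarith
  have := (Real.Gamma_pos_of_pos p1).ne'
  have := (Real.Gamma_pos_of_pos p2).ne'
  unfold g
  rw [h1, h2, h2, Real.Gamma_add_one p1.ne', Real.Gamma_add_one p2.ne',
    Real.Gamma_add_one (by linarith), Real.Gamma_add_one p3.ne', pow_succ,
    show (k : ℝ) + 1 + α = k + α + 1 by ring, show (k : ℝ) + 1 + β = k + β + 1 by ring]
  field_simp
  ring

theorem d_pos (hα : -1 < α) (hβ : -1 < β) (k : ℕ) : 0 < d α β k := by
  have hk := k.cast_nonneg (α := ℝ)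
  unfold d
  split_ifs with h
  · exact div_pos (mul_pos (Real.Gamma_pos_of_pos (by linarith))
      (Real.Gamma_pos_of_pos (by linarith))) (Real.Gamma_pos_of_pos (by linarith))
  · have hk1 : (1 : ℝ) ≤ k := by exact_mod_cast Nat.one_le_iff_ne_zero.2 h
    have := Real.Gamma_pos_of_pos (s := k + α + 1) (by linarith)
    have := Real.Gamma_pos_of_pos (s := k + β + 1) (by linarith)
    have := Real.Gamma_pos_of_pos (s := k + α + β + 1) (by linarith)
    have := Real.Gamma_pos_of_pos (s := 2 * k + α + β + 1) (by linarith)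
    have := Real.Gamma_pos_of_pos (s := 2 * k + α + β + 2) (by linarith)
    positivity

theorem eta_pos (hα : -1 < α) (hβ : -1 < β) (k : ℕ) : 0 < eta α β k :=
  mul_pos (pow_pos (g_pos hα hβ k) 2) (div_pos (d_pos hα hβ _) (by positivity))

theorem casoratian_pos (hα : -1 < α) (hβ : -1 < β) (k : ℕ) : 0 < casoratian α β k :=
  div_pos (mul_pos (mul_pos (phi_pos hα k) (phi_pos hβ k))
    (by linarith [k.cast_nonneg (α := ℝ)])) (by positivity)

theorem d_comm (k : ℕ) : d α β k = d β α k := by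
  have h1 (x : ℝ) : x + α + β = x + β + α := by ring
  unfold d
  split_ifs
  · rw [mul_comm (Real.Gamma (α + 1)), add_comm α β]
  · rw [h1, h1]; ring

theorem g_comm (k : ℕ) : g α β k = g β α k := by
  have h1 (x : ℝ) : x + α + β = x + β + α := by ring
  unfold g
  rw [h1, mul_right_comm]

theorem rho_comm (k : ℕ) : rho α β k = rho β α k := by
  rw [rho, d_comm, g_comm, rho]

theorem eta_comm (k : ℕ) : eta α β k = eta β α k := by
  rw [eta, d_comm, g_comm, eta]

/-- The powers of two and the Gamma functions of argument near `2k` cancel up to a linear factor.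
The parameter `α + β + 2` is positive, unlike possibly `α + β`, so `phi_asymp` applies to it. Index
`0` is left out because `d` has a separate formula there. -/
theorem rho_succ_eq (hα : -1 < α) (hβ : -1 < β) (k : ℕ) :
    rho α β (k + 1) = (2 * k + (α + β + 3)) * phi (α + β + 2) k * (1 * k + (α + β + 2))⁻¹ *
      (1 * k + 1 : ℝ)⁻¹ * (phi α (k + 1))⁻¹ * (phi β (k + 1))⁻¹ := by
  have hk := k.cast_nonneg (α := ℝ)
  have p1 := Real.Gamma_pos_of_pos (s := ((k + 1 : ℕ) : ℝ) + α + 1) (by push_cast; linarith)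
  have p2 := Real.Gamma_pos_of_pos (s := ((k + 1 : ℕ) : ℝ) + β + 1) (by push_cast; linarith)
  have q3 : 0 < k + (α + β + 2) := by linarith
  have p3 := Real.Gamma_pos_of_pos q3
  have q4 : 0 < 2 * k + (α + β + 3) := by linarith
  have p4 := Real.Gamma_pos_of_pos q4
  have e3 : ((k + 1 : ℕ) : ℝ) + α + β + 1 = k + (α + β + 2) := by push_cast; ring
  have e4 : 2 * ((k + 1 : ℕ) : ℝ) + α + β + 1 = 2 * k + (α + β + 3) := by push_cast; ring
  have e5 : 2 * ((k + 1 : ℕ) : ℝ) + α + β + 2 = 2 * k + (α + β + 3) + 1 := by push_cast; ring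
  have hf : (k.factorial : ℝ) ≠ 0 := by positivity
  unfold rho d g phi
  rw [if_neg (Nat.succ_ne_zero k), e3, e4, e5, Real.Gamma_add_one q4.ne',
    Real.Gamma_add_one q3.ne', Nat.factorial_succ,
    show (2 : ℝ) ^ (2 * (k + 1)) = (2 ^ (k + 1)) ^ 2 by rw [← pow_mul, mul_comm]]
  generalize Real.Gamma (2 * k + (α + β + 3)) = G4 at *
  generalize Real.Gamma (k + (α + β + 2)) = G3 at *
  generalize Real.Gamma (((k + 1 : ℕ) : ℝ) + α + 1) = G1 at *
  generalize Real.Gamma (((k + 1 : ℕ) : ℝ) + β + 1) = G2 at *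
  generalize 2 * k + (α + β + 3) = L4 at *
  rw [one_mul]
  generalize k + (α + β + 2) = L3 at *
  push_cast
  field_simp

theorem rho_asymp (hα : -1 < α) (hβ : -1 < β) : PowAsymp (rho α β) 1 2 := by
  have h := ((((PowAsymp.linear 2 (b := α + β + 3)).mul
    (phi_asymp (a := α + β + 2) (by linarith))).mul
    ((PowAsymp.linear 1 (b := α + β + 2)).inv one_ne_zero)).mul
    ((PowAsymp.linear 1 (b := 1)).inv one_ne_zero)).mul
    (((phi_asymp hα).shift 1).inv one_ne_zero) |>.mul (((phi_asymp hβ).shift 1).inv one_ne_zero)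
  refine PowAsymp.of_succ (h.congr (fun k => (rho_succ_eq hα hβ k).symm) (by ring) (by norm_num))

/-- The repeated factor is `g_k / ((k+1) g_(k+1))`, a rational function of `k`. -/
theorem eta_eq (hα : -1 < α) (hβ : -1 < β) (k : ℕ) :
    eta α β k = rho α β (k + 1) * (2 * ((1 * k + (1 + α)) * (1 * k + (1 + β)) *
      ((2 * k + (α + β + 3))⁻¹ * (2 * k + (α + β + 2))⁻¹ * (1 * k + 1 : ℝ)⁻¹))) *
      (2 * ((1 * k + (1 + α)) * (1 * k + (1 + β)) *
      ((2 * k + (α + β + 3))⁻¹ * (2 * k + (α + β + 2))⁻¹ * (1 * k + 1 : ℝ)⁻¹))) := by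
  have hk := k.cast_nonneg (α := ℝ)
  have h1 : k * 2 + α + β + 3 ≠ 0 := by linarith
  have h2 : k * 2 + α + β + 2 ≠ 0 := by linarith
  have h3 : k + 1 + α ≠ 0 := by linarith
  have h4 : k + 1 + β ≠ 0 := by linarith
  rw [eta, rho, g_succ hα hβ]
  simp only [one_mul, ← add_assoc]
  field_simp

theorem eta_asymp (hα : -1 < α) (hβ : -1 < β) : PowAsymp (eta α β) (-1) (1 / 2) := by
  have h := (((PowAsymp.linear 1 (b := 1 + α)).mul (PowAsymp.linear 1 (b := 1 + β))).mul
    ((((PowAsymp.linear 2 (b := α + β + 3)).inv two_ne_zero).mul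
    ((PowAsymp.linear 2 (b := α + β + 2)).inv two_ne_zero)).mul
    ((PowAsymp.linear 1 (b := 1)).inv one_ne_zero))).const_mul 2
  exact ((((rho_asymp hα hβ).shift 1).mul h).mul h).congr (fun k => (eta_eq hα hβ k).symm)
    (by ring) (by norm_num)

theorem casoratian_asymp (hα : -1 < α) (hβ : -1 < β) :
    PowAsymp (casoratian α β) (α + β) 2 := by
  refine ((((phi_asymp hα).mul (phi_asymp hβ)).mul (PowAsymp.linear 2 (b := α + β + 2))).mul
    ((PowAsymp.linear 1 (b := 1)).inv one_ne_zero)).congr (fun k => ?_) (by ring) (by norm_num)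
  rw [casoratian, one_mul]
  ring

theorem kappa_asymp (hα : -1 < α) (hβ : -1 < β) :
    PowAsymp (kappa α β) (1 - 2 * α - 2 * β) (1 / 2) :=
  (((eta_asymp hα hβ).mul ((casoratian_asymp hα hβ).mul (casoratian_asymp hα hβ))).inv
    (by norm_num)).congr (fun k => by rw [kappa, pow_two]) (by ring) (by norm_num)

end

section

/-! ### The second-order factor of the recurrence -/

/-- Normalized entries on the first superdiagonal of `C₂ C₁`. -/
def tau₁ (α β : ℝ) (k : ℕ) : ℝ :=
  (k + 1) * (α - β) * (2 * k + α + β + 3) / ((2 * k + α + β + 4) * (k + 1 + α) * (k + 1 + β))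

/-- Normalized entries on the second superdiagonal of `C₂ C₁`. -/
def tau₂ (α β : ℝ) (k : ℕ) : ℝ :=
  -((k + 1) * (k + 2) * (2 * k + α + β + 2) / ((2 * k + α + β + 4) * (k + 1 + α) * (k + 1 + β)))

/-- The operator `C₂ C₁` in the variables `x`. -/
def secondOrder (α β : ℝ) (x : ℕ → ℝ) (k : ℕ) : ℝ :=
  x k + tau₁ α β k * x (k + 1) + tau₂ α β k * x (k + 2)

/-- A combination of the two solutions `phi α` and `(-1) ^ k * phi β` with variable coefficients. -/
def wave (α β : ℝ) (A B : ℕ → ℝ) (k : ℕ) : ℝ := A k * phi α k + (-1) ^ k * B k * phi β k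

/-- Partial sums against `phi α`. -/
def innerP (α β : ℝ) (x : ℕ → ℝ) (k : ℕ) : ℝ :=
  ∑ i ∈ Finset.range (k + 1), phi α i * rho α β i * x i

/-- Partial sums against `(-1) ^ k * phi β`. -/
def innerQ (α β : ℝ) (x : ℕ → ℝ) (k : ℕ) : ℝ :=
  ∑ i ∈ Finset.range (k + 1), (-1) ^ i * (phi β i * rho α β i * x i)

/-- The increment of the coefficient of `phi α` produced by the right-hand side `x`. -/
def stepA (α β : ℝ) (x : ℕ → ℝ) (k : ℕ) : ℝ :=
  -(kappa α β k * (phi β (k + 1) * phi β (k + 1) * innerP α β x k +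
    (-1) ^ k * (phi α (k + 1) * phi β (k + 1) * innerQ α β x k)))

/-- The increment of the coefficient of `(-1) ^ k * phi β` produced by the right-hand side `x`. -/
def stepB (α β : ℝ) (x : ℕ → ℝ) (k : ℕ) : ℝ :=
  -(kappa α β k * ((-1) ^ k * (phi α (k + 1) * phi β (k + 1) * innerP α β x k) +
    phi α (k + 1) * phi α (k + 1) * innerQ α β x k))

/-- The amplitudes of the coefficient of `lam ^ m` in the particular solution. -/
def amp (α β : ℝ) : ℕ → (ℕ → ℝ) × (ℕ → ℝ)
  | 0 => (fun _ => 1, fun _ => 0)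
  | m + 1 =>
    (fun k => ∑ i ∈ Finset.range k, stepA α β (wave α β (amp α β m).1 (amp α β m).2) i,
      fun k => ∑ i ∈ Finset.range k, stepB α β (wave α β (amp α β m).1 (amp α β m).2) i)

/-- The coefficient of `lam ^ m` in the particular solution. -/
def xCoeff (α β : ℝ) (m : ℕ) : ℕ → ℝ := wave α β (amp α β m).1 (amp α β m).2

variable {α β : ℝ}

theorem amp_succ_fst (m k : ℕ) :
    (amp α β (m + 1)).1 k = ∑ i ∈ Finset.range k, stepA α β (xCoeff α β m) i := rfl

theorem amp_succ_snd (m k : ℕ) :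
    (amp α β (m + 1)).2 k = ∑ i ∈ Finset.range k, stepB α β (xCoeff α β m) i := rfl

theorem xCoeff_zero (k : ℕ) : xCoeff α β 0 k = phi α k := by
  simp [xCoeff, wave, amp]

theorem casoratian_eq (hα : -1 < α) (hβ : -1 < β) (k : ℕ) :
    casoratian α β k = phi α (k + 1) * phi β k + phi α k * phi β (k + 1) := by
  rw [casoratian, phi_succ hα, phi_succ hβ]
  field_simp
  ring

/-- After division by `phi α k` only ratios of neighbours remain, and a rational identity in `k` is
left. -/
theorem secondOrder_phi (hα : -1 < α) (hβ : -1 < β) (k : ℕ) :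
    phi α k + tau₁ α β k * phi α (k + 1) + tau₂ α β k * phi α (k + 2) = 0 := by
  have hk := k.cast_nonneg (α := ℝ)
  have h2 : k * 2 + α + β + 4 ≠ 0 := by linarith
  have h3 : k + 1 + α ≠ 0 := by linarith
  have h4 : k + 1 + β ≠ 0 := by linarith
  rw [phi_succ hα (k + 1), phi_succ hα k, tau₁, tau₂]
  push_cast
  have e : ((k : ℝ) + 1 + 1) ≠ 0 := by positivity
  field_simp
  ring

theorem tau₁_comm (k : ℕ) : tau₁ α β k = -tau₁ β α k := by
  rw [tau₁, tau₁, neg_div', show 2 * (k : ℝ) + α + β = 2 * k + β + α by ring]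
  congr 1 <;> ring

theorem tau₂_comm (k : ℕ) : tau₂ α β k = tau₂ β α k := by
  rw [tau₂, tau₂, show 2 * (k : ℝ) + α + β = 2 * k + β + α by ring]
  congr 2; ring

/-- Exchanging `α` and `β` changes the sign of `tau₁` and preserves `tau₂`, which is the effect of
alternating signs. -/
theorem secondOrder_phi_alternate (hα : -1 < α) (hβ : -1 < β) (k : ℕ) :
    phi β k - tau₁ α β k * phi β (k + 1) + tau₂ α β k * phi β (k + 2) = 0 := by
  have := secondOrder_phi hβ hα k
  rw [tau₁_comm, tau₂_comm]
  linarith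

/-- Abel's identity: the two kernel equations are combined so that the `tau₁` terms cancel. -/
theorem tau₂_mul_casoratian (hα : -1 < α) (hβ : -1 < β) (k : ℕ) :
    tau₂ α β k * casoratian α β (k + 1) = -casoratian α β k := by
  rw [casoratian_eq hα hβ, casoratian_eq hα hβ]
  linear_combination phi β (k + 1) * secondOrder_phi hα hβ k +
    phi α (k + 1) * secondOrder_phi_alternate hα hβ k

/-- The constraint of the method of variation of constants: the increments from `k` to `k + 1` do
not alter the entry with index `k + 1`. -/
theorem step_cancel (x : ℕ → ℝ) (k : ℕ) :
    stepA α β x k * phi α (k + 1) + (-1) ^ (k + 1) * stepB α β x k * phi β (k + 1) = 0 := by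
  have h : ((-1 : ℝ) ^ k) * (-1) ^ k = 1 := by rw [← mul_pow]; simp
  rw [stepA, stepB, pow_succ]
  linear_combination (phi α (k + 1) * kappa α β k * phi β (k + 1) ^ 2 * innerP α β x k) * h

/-- Thus the entries `k` and `k + 1` can be written with the same amplitudes. Sums and differences
of neighbours therefore involve the amplitudes at one index only. -/
theorem wave_succ (m k : ℕ) :
    xCoeff α β m (k + 1) = (amp α β m).1 k * phi α (k + 1) +
      (-1) ^ (k + 1) * (amp α β m).2 k * phi β (k + 1) := by
  cases m with
  | zero => simp [xCoeff, wave, amp]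
  | succ m =>
    rw [xCoeff, wave, amp_succ_fst, amp_succ_snd, Finset.sum_range_succ, Finset.sum_range_succ,
      ← amp_succ_fst, ← amp_succ_snd]
    linear_combination step_cancel (xCoeff α β m) k

theorem secondOrder_xCoeff_zero (hα : -1 < α) (hβ : -1 < β) (k : ℕ) :
    secondOrder α β (xCoeff α β 0) k = 0 := by
  simp only [secondOrder, xCoeff_zero]
  exact secondOrder_phi hα hβ k

/-- With the amplitudes frozen at `k + 1` the operator gives zero. Only the entry `k` deviates from
this form, by the increments; `h1` isolates this deviation and `h2` evaluates it through the
Casoratian. -/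
theorem secondOrder_xCoeff_succ (hα : -1 < α) (hβ : -1 < β) (m k : ℕ) :
    secondOrder α β (xCoeff α β (m + 1)) k = (phi β (k + 1) * innerP α β (xCoeff α β m) k +
      (-1) ^ k * phi α (k + 1) * innerQ α β (xCoeff α β m) k) /
        (eta α β k * casoratian α β k) := by
  have h : ((-1 : ℝ) ^ k) * (-1) ^ k = 1 := by rw [← mul_pow]; simp
  have hW := (casoratian_pos hα hβ k).ne'
  have hη := (eta_pos hα hβ k).ne'
  have h1 : secondOrder α β (xCoeff α β (m + 1)) k = -(stepA α β (xCoeff α β m) k * phi α k +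
      (-1) ^ k * stepB α β (xCoeff α β m) k * phi β k) := by
    rw [secondOrder, wave_succ (m + 1) (k + 1), wave_succ (m + 1) k, amp_succ_fst _ (k + 1),
      amp_succ_snd _ (k + 1), Finset.sum_range_succ, Finset.sum_range_succ, ← amp_succ_fst,
      ← amp_succ_snd, xCoeff, wave, pow_succ (-1 : ℝ) (k + 1), pow_succ (-1 : ℝ) k]
    have hc := step_cancel (α := α) (β := β) (xCoeff α β m) k
    rw [pow_succ] at hc
    linear_combination ((amp α β (m + 1)).1 k + stepA α β (xCoeff α β m) k) *
      secondOrder_phi hα hβ k + (-1) ^ k * ((amp α β (m + 1)).2 k + stepB α β (xCoeff α β m) k) *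
      secondOrder_phi_alternate hα hβ k - tau₁ α β k * hc
  have h2 : stepA α β (xCoeff α β m) k * phi α k +
      (-1) ^ k * stepB α β (xCoeff α β m) k * phi β k = -(kappa α β k * casoratian α β k *
        (phi β (k + 1) * innerP α β (xCoeff α β m) k +
      (-1) ^ k * phi α (k + 1) * innerQ α β (xCoeff α β m) k)) := by
    rw [stepA, stepB, casoratian_eq hα hβ]
    linear_combination (-(kappa α β k * phi β k * phi α (k + 1) * phi β (k + 1) *
      innerP α β (xCoeff α β m) k)) * h
  rw [h1, h2, kappa]
  field_simp

/-- The value of the adjoint operator `(C₂ C₁)ᵀ` in the variables `x`. -/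
def secondOrderAdjoint (α β : ℝ) (z : ℕ → ℝ) : ℕ → ℝ
  | 0 => z 0
  | 1 => z 1 + tau₁ α β 0 * z 0
  | k + 2 => z (k + 2) + tau₁ α β (k + 1) * z (k + 1) + tau₂ α β k * z k

theorem secondOrderAdjoint_xCoeff_zero (hα : -1 < α) (hβ : -1 < β) (k : ℕ) :
    secondOrderAdjoint α β (fun i => eta α β i * secondOrder α β (xCoeff α β 0) i) k = 0 := by
  match k with
  | 0 => simp [secondOrderAdjoint, secondOrder_xCoeff_zero hα hβ]
  | 1 => simp [secondOrderAdjoint, secondOrder_xCoeff_zero hα hβ]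
  | k + 2 => simp [secondOrderAdjoint, secondOrder_xCoeff_zero hα hβ]

/-- The adjoint equation is solved from the initial end by partial sums against the kernel of the
second-order operator. With the partial sums frozen, the kernel equations and Abel's identity make
all contributions cancel; the newly added summand leaves exactly the right-hand side. -/
theorem secondOrderAdjoint_xCoeff_succ (hα : -1 < α) (hβ : -1 < β) (m k : ℕ) :
    secondOrderAdjoint α β (fun i => eta α β i * secondOrder α β (xCoeff α β (m + 1)) i) k =
      rho α β k * xCoeff α β m k := by
  set x := xCoeff α β m
  have hz : (fun i => eta α β i * secondOrder α β (xCoeff α β (m + 1)) i) = fun i =>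
      (phi β (i + 1) * innerP α β x i + (-1) ^ i * phi α (i + 1) * innerQ α β x i) /
        casoratian α β i := by
    funext i
    have hW := (casoratian_pos hα hβ i).ne'
    have hη := (eta_pos hα hβ i).ne'
    rw [secondOrder_xCoeff_succ hα hβ]
    field_simp
    rfl
  have hP (i : ℕ) : innerP α β x (i + 1) =
      innerP α β x i + phi α (i + 1) * rho α β (i + 1) * x (i + 1) := Finset.sum_range_succ _ _
  have hQ (i : ℕ) : innerQ α β x (i + 1) = innerQ α β x i +
      (-1) ^ (i + 1) * (phi β (i + 1) * rho α β (i + 1) * x (i + 1)) := Finset.sum_range_succ _ _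
  have hP0 : innerP α β x 0 = phi α 0 * rho α β 0 * x 0 := by simp [innerP]
  have hQ0 : innerQ α β x 0 = phi β 0 * rho α β 0 * x 0 := by simp [innerQ]
  -- the contribution of the first superdiagonal
  have hτ (i : ℕ) (p q s : ℝ) : tau₁ α β i * ((phi β (i + 1) * p + s * phi α (i + 1) * q) /
      casoratian α β i) = (phi β i * p - s * phi α i * q) / casoratian α β i -
        (phi β (i + 2) * p - s * phi α (i + 2) * q) / casoratian α β (i + 1) := by
    have hW := (casoratian_pos hα hβ (i + 1)).ne'
    have hW' := (casoratian_pos hα hβ i).ne'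
    rw [mul_div_assoc', div_sub_div _ _ hW' hW, div_eq_div_iff hW' (mul_ne_zero hW' hW)]
    have h1 := secondOrder_phi hα hβ i
    have h2 := secondOrder_phi_alternate hα hβ i
    have h3 := tau₂_mul_casoratian hα hβ i
    linear_combination (casoratian α β i * casoratian α β (i + 1)) * (s * q * h1 - p * h2) +
      (p * phi β (i + 2) - s * q * phi α (i + 2)) * casoratian α β i * h3
  rw [hz]
  match k with
  | 0 =>
    have hW := (casoratian_pos hα hβ 0).ne'
    simp only [secondOrderAdjoint, hP0, hQ0]
    rw [div_eq_iff hW, casoratian_eq hα hβ]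
    ring
  | 1 =>
    have hW := (casoratian_pos hα hβ 1).ne'
    simp only [secondOrderAdjoint]
    rw [hτ, hP, hQ, hP0, hQ0]
    have e : phi β 0 * (phi α 0 * rho α β 0 * x 0) -
      (-1) ^ 0 * phi α 0 * (phi β 0 * rho α β 0 * x 0) = 0 := by ring
    rw [e, zero_div, zero_sub, ← sub_eq_add_neg, ← sub_div, div_eq_iff hW, casoratian_eq hα hβ]
    ring
  | k + 2 =>
    have hW := (casoratian_pos hα hβ (k + 2)).ne'
    have hW1 := (casoratian_pos hα hβ (k + 1)).ne'
    have h : ((-1 : ℝ) ^ k) * (-1) ^ k = 1 := by rw [← mul_pow]; simp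
    have hτ2 (w : ℝ) : tau₂ α β k * (w / casoratian α β k) = -(w / casoratian α β (k + 1)) := by
      have hW0 := (casoratian_pos hα hβ k).ne'
      have h3 := tau₂_mul_casoratian hα hβ k
      field_simp
      linear_combination w * h3
    simp only [secondOrderAdjoint]
    rw [hτ, hτ2, hP (k + 1), hQ (k + 1)]
    -- The summand with index `k + 1` drops out of this combination, so the partial sums can be
    -- lowered to `k` and meet the `tau₂` term.
    have e : (phi β (k + 1) * innerP α β x (k + 1) - (-1) ^ (k + 1) * phi α (k + 1) *
        innerQ α β x (k + 1)) / casoratian α β (k + 1) = (phi β (k + 1) * innerP α β x k +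
        (-1) ^ k * phi α (k + 1) * innerQ α β x k) / casoratian α β (k + 1) := by
      rw [hP, hQ]
      congr 1
      rw [pow_succ]
      linear_combination (-(phi α (k + 1) * phi β (k + 1) * rho α β (k + 1) * x (k + 1))) * h
    rw [e]
    -- The two contributions of the summand with index `k + 2` add up to the Casoratian, which
    -- cancels the denominator.
    have e2 : (phi β (k + 2 + 1) * (innerP α β x (k + 1) +
        phi α (k + 1 + 1) * rho α β (k + 1 + 1) * x (k + 1 + 1)) + (-1) ^ (k + 2) *
        phi α (k + 2 + 1) * (innerQ α β x (k + 1) + (-1) ^ (k + 1 + 1) *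
        (phi β (k + 1 + 1) * rho α β (k + 1 + 1) * x (k + 1 + 1)))) / casoratian α β (k + 2) =
        (phi β (k + 1 + 2) * innerP α β x (k + 1) - (-1) ^ (k + 1) * phi α (k + 1 + 2) *
        innerQ α β x (k + 1)) / casoratian α β (k + 1 + 1) + rho α β (k + 2) * x (k + 2) := by
      rw [div_add' _ _ _ hW]
      congr 1
      rw [casoratian_eq hα hβ]
      simp only [pow_succ]
      linear_combination (phi α (k + 3) * phi β (k + 2) * rho α β (k + 2) * x (k + 2)) * h
    rw [e2]
    ring

end

section

/-! ### The factorization of the recurrence -/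

variable {α β : ℝ}

theorem C₂C₁_of_lt {i j : ℕ} (h : j < i) : C₂C₁ α β i j = 0 :=
  Finset.sum_eq_zero fun m hm => by
    have := Finset.mem_range.1 hm
    rw [C₂, if_neg (by omega), if_neg (by omega), zero_mul]

theorem C₂C₁_of_gt {i j : ℕ} (h : i + 2 < j) : C₂C₁ α β i j = 0 :=
  Finset.sum_eq_zero fun m hm => by
    have := Finset.mem_range.1 hm
    by_cases h1 : m ≤ i + 1
    · rw [C₁, if_neg (by omega), if_neg (by omega), mul_zero]
    · rw [C₂, if_neg (by omega), if_neg (by omega), zero_mul]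

theorem sum_C₂_mul_eq_zero (f : ℕ → ℝ) (i : ℕ) :
    ∑ m ∈ Finset.range i, C₂ α β i m * f m = 0 :=
  Finset.sum_eq_zero fun m hm => by
    have := Finset.mem_range.1 hm
    rw [C₂, if_neg (by omega), if_neg (by omega), zero_mul]

theorem C₂C₁_self (i : ℕ) : C₂C₁ α β i i = 1 := by
  rw [C₂C₁, Finset.sum_range_succ, sum_C₂_mul_eq_zero]
  simp [C₁, C₂]

/-- This and the next lemma identify `tau₁` and `tau₂` as the superdiagonals of `C₂ C₁` conjugated
by the diagonal matrix of the `g_k`. -/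
theorem C₂C₁_succ_mul_g (hα : -1 < α) (hβ : -1 < β) (i : ℕ) :
    C₂C₁ α β i (i + 1) * g α β (i + 1) = tau₁ α β i * g α β i := by
  have hk := i.cast_nonneg (α := ℝ)
  have h1 : i + 1 + α ≠ 0 := by linarith
  have h2 : i + 1 + β ≠ 0 := by linarith
  have h3 : 0 < (i + 1 + α) + (i + 1 + β) := by linarith
  rw [C₂C₁, Finset.sum_range_succ, Finset.sum_range_succ, sum_C₂_mul_eq_zero, g_succ hα hβ]
  simp only [C₁, C₂, tau₁, if_true, if_neg (Nat.succ_ne_self i), if_neg (Nat.succ_ne_self i).symm]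
  push_cast
  rw [show (i : ℝ) + 1 + β = i + 1 + β by ring,
    show 2 * ((i : ℝ) + 1) + α + β + 1 = (i + 1 + α) + (i + 1 + β) + 1 by ring,
    show 2 * ((i : ℝ) + 1) + α + β + 2 = (i + 1 + α) + (i + 1 + β) + 2 by ring,
    show 2 * ((i : ℝ) + 1) + α + β = (i + 1 + α) + (i + 1 + β) by ring,
    show 2 * (i : ℝ) + α + β + 3 = (i + 1 + α) + (i + 1 + β) + 1 by ring,
    show 2 * (i : ℝ) + α + β + 2 = (i + 1 + α) + (i + 1 + β) by ring,
    show 2 * (i : ℝ) + α + β + 4 = (i + 1 + α) + (i + 1 + β) + 2 by ring,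
    show α - β = (i + 1 + α) - (i + 1 + β) by ring]
  generalize (i : ℝ) + 1 + α = p at *
  generalize (i : ℝ) + 1 + β = q at *
  have h4 : p + q + 1 ≠ 0 := by linarith
  have h5 : p + q + 2 ≠ 0 := by linarith
  have h6 : p + q ≠ 0 := h3.ne'
  generalize g α β i = G
  field_simp
  ring

theorem C₂C₁_succ_succ_mul_g (hα : -1 < α) (hβ : -1 < β) (i : ℕ) :
    C₂C₁ α β i (i + 2) * g α β (i + 2) = tau₂ α β i * g α β i := by
  have hk := i.cast_nonneg (α := ℝ)
  have h1 : 0 < i + 1 + α := by linarith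
  have h2 : 0 < i + 1 + β := by linarith
  have hC : C₂C₁ α β i (i + 2) = C₂ α β i (i + 1) * C₁ α β (i + 1) (i + 2) := by
    have h3 : C₁ α β i (i + 2) = 0 := by rw [C₁, if_neg (by omega), if_neg (by omega)]
    have h4 : C₂ α β i (i + 2) = 0 := by rw [C₂, if_neg (by omega), if_neg (by omega)]
    rw [C₂C₁, Finset.sum_range_succ, Finset.sum_range_succ, Finset.sum_range_succ,
      sum_C₂_mul_eq_zero, h3, h4]
    ring
  rw [hC, g_succ hα hβ (i + 1), g_succ hα hβ i, C₂, if_neg (by omega), if_pos rfl, C₁,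
    if_neg (by omega), if_pos rfl, tau₂]
  push_cast
  rw [show (i : ℝ) + 2 + β = (i + 1 + β) + 1 by ring,
    show (i : ℝ) + 1 + 1 + β = (i + 1 + β) + 1 by ring,
    show (i : ℝ) + 1 + 1 + α = (i + 1 + α) + 1 by ring,
    show 2 * ((i : ℝ) + 1) + α + β + 1 = (i + 1 + α) + (i + 1 + β) + 1 by ring,
    show 2 * ((i : ℝ) + 1) + α + β + 2 = (i + 1 + α) + (i + 1 + β) + 2 by ring,
    show 2 * ((i : ℝ) + 1) + α + β + 3 = (i + 1 + α) + (i + 1 + β) + 3 by ring,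
    show 2 * ((i : ℝ) + 2) + α + β + 1 = (i + 1 + α) + (i + 1 + β) + 3 by ring,
    show 2 * ((i : ℝ) + 2) + α + β = (i + 1 + α) + (i + 1 + β) + 2 by ring,
    show 2 * (i : ℝ) + α + β + 3 = (i + 1 + α) + (i + 1 + β) + 1 by ring,
    show 2 * (i : ℝ) + α + β + 2 = (i + 1 + α) + (i + 1 + β) by ring,
    show 2 * (i : ℝ) + α + β + 4 = (i + 1 + α) + (i + 1 + β) + 2 by ring]
  generalize (i : ℝ) + 1 + α = p at *
  generalize (i : ℝ) + 1 + β = q at *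
  generalize g α β i = G
  field_simp

theorem sum_C₂C₁ (hα : -1 < α) (hβ : -1 < β) (x : ℕ → ℝ) {i k : ℕ} (hi : i ≤ k) :
    ∑ s ∈ Finset.range (k + 3), C₂C₁ α β i s * g α β s * x s =
      g α β i * secondOrder α β x i := by
  have hsub : Finset.range (i + 3) ⊆ Finset.range (k + 3) :=
    Finset.range_subset_range.2 (by omega)
  rw [← Finset.sum_subset hsub fun s _ hs => by
    rw [C₂C₁_of_gt (by have := Finset.mem_range.not.1 hs; omega), zero_mul, zero_mul],
    Finset.sum_range_succ, Finset.sum_range_succ, Finset.sum_range_succ,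
    Finset.sum_eq_zero fun s hs => by
      rw [C₂C₁_of_lt (Finset.mem_range.1 hs), zero_mul, zero_mul], C₂C₁_self,
    C₂C₁_succ_mul_g hα hβ, C₂C₁_succ_succ_mul_g hα hβ, secondOrder]
  ring

/-- The rows of `A` in the variables `x`, in factorized form. -/
theorem sum_A_mul_g (hα : -1 < α) (hβ : -1 < β) (x : ℕ → ℝ) (k : ℕ) :
    ∑ s ∈ Finset.range (k + 3), A α β k s * g α β s * x s =
      secondOrderAdjoint α β (fun i => eta α β i * secondOrder α β x i) k / g α β k := by
  have h1 : ∑ s ∈ Finset.range (k + 3), A α β k s * g α β s * x s =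
      ∑ i ∈ Finset.range (k + 1),
        C₂C₁ α β i k * (eta α β i * secondOrder α β x i / g α β i) := by
    simp only [A, Finset.sum_mul]
    rw [Finset.sum_comm]
    refine Finset.sum_congr rfl fun i hi => ?_
    have hg := (g_pos hα hβ i).ne'
    have := sum_C₂C₁ hα hβ x (Nat.lt_succ_iff.1 (Finset.mem_range.1 hi))
    calc _ = C₂C₁ α β i k * (d α β (i + 1) / ((i : ℝ) + 1) ^ 2) *
          ∑ s ∈ Finset.range (k + 3), C₂C₁ α β i s * g α β s * x s := by
            rw [Finset.mul_sum]
            exact Finset.sum_congr rfl fun s _ => by ring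
      _ = _ := by
        rw [this, eta]
        field_simp
  have hg (i : ℕ) := (g_pos hα hβ i).ne'
  have hC1 (i : ℕ) : C₂C₁ α β i (i + 1) = tau₁ α β i * g α β i / g α β (i + 1) :=
    eq_div_of_mul_eq (hg _) (C₂C₁_succ_mul_g hα hβ i)
  have hC2 (i : ℕ) : C₂C₁ α β i (i + 2) = tau₂ α β i * g α β i / g α β (i + 2) :=
    eq_div_of_mul_eq (hg _) (C₂C₁_succ_succ_mul_g hα hβ i)
  rw [h1]
  match k with
  | 0 =>
    simp [secondOrderAdjoint, C₂C₁_self]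
  | 1 =>
    have e0 := hg 0
    have e1 := hg 1
    simp only [secondOrderAdjoint, Finset.sum_range_succ, Finset.sum_range_zero, C₂C₁_self, hC1 0]
    field_simp
    ring
  | k + 2 =>
    have e0 := hg k
    have e1 := hg (k + 1)
    have e2 := hg (k + 2)
    rw [Finset.sum_range_succ, Finset.sum_range_succ, Finset.sum_range_succ,
      Finset.sum_eq_zero fun s hs => by
        rw [C₂C₁_of_gt (by have := Finset.mem_range.1 hs; omega), zero_mul]]
    simp only [secondOrderAdjoint, C₂C₁_self, hC1 (k + 1), hC2 k]
    field_simp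
    ring

theorem A_of_lt {k s : ℕ} (h : s + 2 < k) : A α β k s = 0 :=
  Finset.sum_eq_zero fun i _ => by
    rcases lt_or_ge (i + 2) k with h1 | h1
    · rw [C₂C₁_of_gt h1, zero_mul, zero_mul]
    · rw [C₂C₁_of_lt (show s < i by omega), mul_zero]

/-- This makes the division in `recCoeff` legitimate: every row determines `x_(k+2)`. -/
theorem A_succ_succ_mul_g_ne_zero (hα : -1 < α) (hβ : -1 < β) (k : ℕ) :
    A α β k (k + 2) * g α β (k + 2) ≠ 0 := by
  have hk := k.cast_nonneg (α := ℝ)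
  have h1 : 0 < 2 * k + α + β + 4 := by linarith
  have h3 : 0 < 2 * k + α + β + 2 := by linarith
  have h4 : 0 < k + 1 + α := by linarith
  have h5 : 0 < k + 1 + β := by linarith
  have hτ : tau₂ α β k ≠ 0 := by
    rw [tau₂, neg_ne_zero]
    positivity
  have hd := (d_pos hα hβ (k + 1)).ne'
  have hk1 : (k : ℝ) + 1 ≠ 0 := by positivity
  rw [A, Finset.sum_range_succ, Finset.sum_eq_zero fun i hi => by
    rw [C₂C₁_of_gt (show i + 2 < k + 2 by have := Finset.mem_range.1 hi; omega), mul_zero],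
    zero_add, C₂C₁_self, one_mul, mul_assoc, C₂C₁_succ_succ_mul_g hα hβ]
  exact mul_ne_zero (div_ne_zero hd (pow_ne_zero 2 hk1)) (mul_ne_zero hτ (g_pos hα hβ k).ne')

/-! ### Solutions of the recurrence -/

/-- The five-term recurrence for the sequence `x`. -/
def IsSolution (α β : ℝ) (lam : ℂ) (x : ℕ → ℂ) : Prop :=
  ∀ k, ∑ s ∈ Finset.range (k + 3), ((A α β k s * g α β s : ℝ) : ℂ) * x s =
    lam * ((d α β k * g α β k : ℝ) : ℂ) * x k

/-- Four consecutive elements of a sequence extended by zeros to negative indices. -/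
def window (x : ℕ → ℂ) (k : ℕ) : Fin 4 → ℂ :=
  ![if k < 2 then 0 else x (k - 2), if k < 1 then 0 else x (k - 1), x k, x (k + 1)]

theorem IsSolution.M₁_mulVec (hα : -1 < α) (hβ : -1 < β) {lam : ℂ} {x : ℕ → ℂ}
    (h : IsSolution α β lam x) (k : ℕ) : M₁ α β k lam *ᵥ window x k = window x (k + 1) := by
  have hp : pencilCoeff α β lam k (k + 2) = ((A α β k (k + 2) * g α β (k + 2) : ℝ) : ℂ) := by
    simp [pencilCoeff]
  have hp0 : pencilCoeff α β lam k (k + 2) ≠ 0 := by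
    rw [hp]
    exact_mod_cast A_succ_succ_mul_g_ne_zero hα hβ k
  have h1 : ∑ s ∈ Finset.range (k + 3), pencilCoeff α β lam k s * x s = 0 := by
    have e (s : ℕ) : pencilCoeff α β lam k s * x s = ((A α β k s * g α β s : ℝ) : ℂ) * x s -
        if s = k then lam * ((d α β k * g α β k : ℝ) : ℂ) * x k else 0 := by
      rw [pencilCoeff]
      split_ifs with hs
      · subst hs
        push_cast
        ring
      · push_cast
        ring
    simp only [e]
    rw [Finset.sum_sub_distrib, h k, Finset.sum_ite_eq', if_pos (by simp), sub_self]
  have hlow : ∀ s, s + 2 < k → pencilCoeff α β lam k s = 0 := fun s hs => by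
    rw [pencilCoeff, A_of_lt hs, if_neg (by omega)]
    simp
  have key : recCoeff α β lam k 0 * window x k 0 + recCoeff α β lam k 1 * window x k 1 +
      recCoeff α β lam k 2 * x k + recCoeff α β lam k 3 * x (k + 1) = x (k + 2) := by
    refine mul_left_cancel₀ hp0 ?_
    rw [Finset.sum_range_succ] at h1
    -- Rows 0 and 1 are separate, because there the entries of negative index are absent and natural
    -- subtraction truncates.
    match k with
    | 0 =>
      simp only [Finset.sum_range_succ, Finset.sum_range_zero, zero_add] at h1 hp0
      simp [recCoeff, window, -mul_eq_mul_left_iff]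
      field_simp
      linear_combination -h1
    | 1 =>
      simp only [Finset.sum_range_succ, Finset.sum_range_zero, zero_add, Nat.reduceAdd] at h1 hp0
      simp [recCoeff, window, -mul_eq_mul_left_iff]
      field_simp
      linear_combination -h1
    | k + 2 =>
      rw [Finset.sum_range_succ, Finset.sum_range_succ, Finset.sum_range_succ,
        Finset.sum_range_succ, Finset.sum_eq_zero fun s hs => by
          rw [hlow s (by have := Finset.mem_range.1 hs; omega), zero_mul]] at h1
      simp [recCoeff, window, -mul_eq_mul_left_iff]
      field_simp
      linear_combination -h1
  ext i
  fin_cases i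
  · simp [M₁, window, Matrix.mulVec, dotProduct, Fin.sum_univ_four]
  · simp [M₁, window, Matrix.mulVec, dotProduct, Fin.sum_univ_four]
  · simp [M₁, window, Matrix.mulVec, dotProduct, Fin.sum_univ_four]
  · simpa [M₁, window, Matrix.mulVec, dotProduct, Fin.sum_univ_four] using key

theorem kk_ne_zero (k : ℕ) : kk k ≠ 0 := by
  unfold kk
  split_ifs with h
  · exact one_ne_zero
  · exact_mod_cast h

theorem inv_U_mul_U (k : ℕ) : (U k)⁻¹ * U k = 1 := by
  have hk := kk_ne_zero k
  have h : (!![1/2, 1/2, 0, 0; 1/2, -1/2, 0, 0;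
      1/2, 1/2, 1 / (2 * kk k), 1 / (2 * kk k);
      1/2, -1/2, 1 / (2 * kk k), -1 / (2 * kk k)] : Matrix (Fin 4) (Fin 4) ℂ) * U k = 1 := by
    ext i j
    fin_cases i <;> fin_cases j <;>
      simp [U, Matrix.mul_apply, Fin.sum_univ_four] <;> field_simp <;> ring
  rw [Matrix.inv_eq_left_inv h, h]

/-- The vectors `Y_k` are determined by the sequence which solves the recurrence. -/
theorem IsSolution.eq_U_mulVec_window (hα : -1 < α) (hβ : -1 < β) {lam : ℂ} {x : ℕ → ℂ}
    (h : IsSolution α β lam x) {Y : ℕ → Fin 4 → ℂ} (h0 : Y 0 = U 0 *ᵥ window x 0)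
    (hY : ∀ k, Even k → Y (k + 2) = Mhat₂ α β k lam *ᵥ Y k) (k : ℕ) (hk : Even k) :
    Y k = U k *ᵥ window x k := by
  obtain ⟨j, rfl⟩ := hk
  rw [← two_mul]
  induction j with
  | zero => exact h0
  | succ j ih =>
    rw [mul_add, mul_one, hY _ (even_two_mul j), ih, Mhat₂, Matrix.mulVec_mulVec, Matrix.mul_assoc,
      inv_U_mul_U, mul_one, M₂, ← Matrix.mulVec_mulVec, ← Matrix.mulVec_mulVec,
      h.M₁_mulVec hα hβ, h.M₁_mulVec hα hβ]
    rfl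

/-- A power series in `lam` whose coefficients satisfy the recurrence order by order. -/
theorem isSolution_tsum (hα : -1 < α) (hβ : -1 < β) {c : ℕ → ℕ → ℝ} {lam : ℂ}
    (h0 : ∀ k, secondOrderAdjoint α β (fun i => eta α β i * secondOrder α β (c 0) i) k = 0)
    (h1 : ∀ m k, secondOrderAdjoint α β (fun i => eta α β i * secondOrder α β (c (m + 1)) i) k =
      rho α β k * c m k)
    (hs : ∀ k, Summable fun m => lam ^ m * (c m k : ℂ)) :
    IsSolution α β lam fun k => ∑' m, lam ^ m * (c m k : ℂ) := by
  intro k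
  have hg : ((g α β k : ℝ) : ℂ) ≠ 0 := by exact_mod_cast (g_pos hα hβ k).ne'
  have hrow (m : ℕ) : ∑ s ∈ Finset.range (k + 3), ((A α β k s * g α β s : ℝ) : ℂ) *
      (lam ^ m * (c m s : ℂ)) = lam ^ m * ((secondOrderAdjoint α β
        (fun i => eta α β i * secondOrder α β (c m) i) k / g α β k : ℝ) : ℂ) := by
    rw [← sum_A_mul_g hα hβ (c m) k]
    push_cast
    rw [Finset.mul_sum]
    exact Finset.sum_congr rfl fun s _ => by ring
  have hsum : Summable fun m => ∑ s ∈ Finset.range (k + 3),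
      ((A α β k s * g α β s : ℝ) : ℂ) * (lam ^ m * (c m s : ℂ)) :=
    summable_sum fun s _ => (hs s).mul_left _
  simp only [← tsum_mul_left]
  -- The order-zero term is annihilated; in the others the order drops by one, which releases one
  -- factor `lam`.
  rw [← Summable.tsum_finsetSum fun s _ => (hs s).mul_left _, hsum.tsum_eq_zero_add, hrow, h0]
  simp only [zero_div, Complex.ofReal_zero, mul_zero, zero_add]
  refine tsum_congr fun m => ?_
  rw [hrow, h1, rho]
  push_cast
  field_simp
  ring

/-! ### The symmetry exchanging the two parameters -/

theorem secondOrder_alternate (x : ℕ → ℝ) (k : ℕ) :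
    secondOrder α β (fun i => (-1) ^ i * x i) k = (-1) ^ k * secondOrder β α x k := by
  simp only [secondOrder, pow_succ]
  rw [tau₁_comm, tau₂_comm]
  ring

theorem secondOrderAdjoint_alternate (z : ℕ → ℝ) (k : ℕ) :
    secondOrderAdjoint α β (fun i => (-1) ^ i * z i) k =
      (-1) ^ k * secondOrderAdjoint β α z k := by
  match k with
  | 0 => simp [secondOrderAdjoint]
  | 1 =>
    simp only [secondOrderAdjoint]
    rw [tau₁_comm]
    ring
  | k + 2 =>
    simp only [secondOrderAdjoint, pow_succ]
    rw [tau₁_comm, tau₂_comm]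
    ring

/-- Conjugation by `(-1)^k` exchanges `α` and `β` in the whole fourth-order operator, so the second
particular solution needs no separate analysis. -/
theorem secondOrderAdjoint_eta_alternate (x : ℕ → ℝ) (k : ℕ) :
    secondOrderAdjoint α β
        (fun i => eta α β i * secondOrder α β (fun i => (-1) ^ i * x i) i) k =
      (-1) ^ k * secondOrderAdjoint β α (fun i => eta β α i * secondOrder β α x i) k := by
  rw [← secondOrderAdjoint_alternate]
  congr 1
  funext i
  rw [secondOrder_alternate, eta_comm]
  ring

end

section

/-! ### Asymptotics of the amplitudes -/

variable {α β : ℝ}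

section Step

variable {A B : ℕ → ℝ} {γ a : ℝ}

/-- Against `phi α` the first wave gives a sum without sign changes. The second contributes nothing
to leading order, as its amplitude is already of smaller order. -/
theorem innerP_asymp (hα : -1 < α) (hβ : -1 < β) (hγ : 0 ≤ γ) (hA : PowAsymp A γ a)
    (hB : PowAsymp B (γ + (α - β)) 0) :
    PowAsymp (innerP α β (wave α β A B)) (2 * α + 2 + γ) (2 * a / (2 * α + 2 + γ)) := by
  have hφ := phi_asymp hα
  have hψ := phi_asymp hβ
  have hρ := rho_asymp hα hβ
  refine PowAsymp.sum_succ (by linarith) ?_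
  have h1 := ((hφ.mul hρ).mul (hA.mul hφ)).congr (γ := _) (δ := 2 * α + 2 + γ - 1) (e := 2 * a)
    (fun _ => rfl) (by ring) (by ring)
  have h2 := (((hφ.mul hρ).mul (hB.mul hψ)).congr (γ := _) (δ := 2 * α + 2 + γ - 1) (e := 0)
    (fun _ => rfl) (by ring) (by ring)).alternate
  refine (h1.add h2).congr (fun k => ?_) rfl (add_zero _)
  rw [wave]
  ring

/-- Both waves are negligible here, for different reasons: the first becomes an alternating sum, the
second loses its sign but has an amplitude of smaller order. -/
theorem innerQ_asymp (hα : -1 < α) (hβ : -1 < β) (hγ : 0 ≤ γ) (hA : PowAsymp A γ a)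
    (hB : PowAsymp B (γ + (α - β)) 0) :
    PowAsymp (innerQ α β (wave α β A B)) (α + β + 2 + γ) 0 := by
  have hφ := phi_asymp hα
  have hψ := phi_asymp hβ
  have hρ := rho_asymp hα hβ
  have hpos : 0 < α + β + 2 + γ := by linarith
  have h1 := (((hψ.mul hρ).mul (hA.mul hφ)).congr (γ := _) (δ := α + β + 2 + γ - 1) (e := 2 * a)
    (fun _ => rfl) (by ring) (by ring)).sum_alternate hpos |>.shift 1
  have h2 := (((hψ.mul hρ).mul (hB.mul hψ)).congr (γ := _) (δ := α + β + 2 + γ - 1) (e := 0)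
    (fun _ => rfl) (by ring) (by ring)).sum_succ hpos
  refine (h1.add h2).congr (fun k => ?_) rfl (by simp)
  rw [innerQ, ← Finset.sum_add_distrib]
  refine Finset.sum_congr rfl fun i _ => ?_
  have h : ((-1 : ℝ) ^ i) * (-1) ^ i = 1 := by rw [← mul_pow]; simp
  rw [wave]
  linear_combination (-(phi β i * rho α β i * (B i * phi β i))) * h

theorem stepA_asymp (hα : -1 < α) (hβ : -1 < β) (hγ : 0 ≤ γ) (hA : PowAsymp A γ a)
    (hB : PowAsymp B (γ + (α - β)) 0) :
    PowAsymp (stepA α β (wave α β A B)) (γ + 3) (-(a / (2 * α + 2 + γ))) := by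
  have hφ := (phi_asymp hα).shift 1
  have hψ := (phi_asymp hβ).shift 1
  have hκ := kappa_asymp hα hβ
  have h1 := (hκ.mul ((hψ.mul hψ).mul (innerP_asymp hα hβ hγ hA hB))).congr (δ := γ + 3)
    (e := a / (2 * α + 2 + γ)) (fun _ => rfl) (by ring) (by ring)
  have h2 := ((hκ.mul ((hφ.mul hψ).mul (innerQ_asymp hα hβ hγ hA hB))).congr (δ := γ + 3)
    (e := 0) (fun _ => rfl) (by ring) (by ring)).alternate
  refine (h1.add h2).neg.congr (fun k => ?_) rfl (by ring)
  rw [stepA]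
  ring

/-- A single increment can have the full order, but its leading part `(-1)^k u` is lost in summation
by cancellation. -/
theorem stepB_decomposition (hα : -1 < α) (hβ : -1 < β) (hγ : 0 ≤ γ) (hA : PowAsymp A γ a)
    (hB : PowAsymp B (γ + (α - β)) 0) :
    ∃ (u r : ℕ → ℝ) (c : ℝ), PowAsymp u (γ + 3 + (α - β)) c ∧ PowAsymp r (γ + 3 + (α - β)) 0 ∧
      ∀ k, stepB α β (wave α β A B) k = (-1) ^ k * u k + r k := by
  have hφ := (phi_asymp hα).shift 1
  have hψ := (phi_asymp hβ).shift 1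
  have hκ := kappa_asymp hα hβ
  have h1 := (hκ.mul ((hφ.mul hψ).mul (innerP_asymp hα hβ hγ hA hB))).neg.congr
    (δ := γ + 3 + (α - β)) (fun _ => rfl) (by ring) rfl
  have h2 := (hκ.mul ((hφ.mul hφ).mul (innerQ_asymp hα hβ hγ hA hB))).neg.congr
    (δ := γ + 3 + (α - β)) (e := 0) (fun _ => rfl) (by ring) (by ring)
  refine ⟨_, _, _, h1, h2, fun k => ?_⟩
  rw [stepB]
  ring

end Step

/-- The Taylor coefficients of the limit function `y / (2 t ^ α)`. -/
def limCoeff (α : ℝ) : ℕ → ℝ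
  | 0 => 1
  | m + 1 => -(limCoeff α m / ((4 * m + 4) * (2 * α + 2 + 4 * m)))

theorem amp_asymp (hα : -1 < α) (hβ : -1 < β) (h4 : β - α < 4) (m : ℕ) :
    PowAsymp (amp α β m).1 (4 * m) (limCoeff α m) ∧
    PowAsymp (amp α β m).2 (4 * m + (α - β)) 0 := by
  induction m with
  | zero =>
    refine ⟨(PowAsymp.const 1).congr (fun _ => rfl) (by simp) rfl, ?_⟩
    simp [PowAsymp, amp]
  | succ m ih =>
    have hm := m.cast_nonneg (α := ℝ)
    have hγ : (0 : ℝ) ≤ 4 * m := by positivity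
    constructor
    · have h := stepA_asymp hα hβ hγ ih.1 ih.2
      refine ((h.congr (δ := 4 * m + 4 - 1) (fun _ => rfl) (by ring) rfl).sum
        (by positivity)).congr (fun _ => rfl) (by push_cast; ring) ?_
      rw [limCoeff, neg_div, div_div, mul_comm (2 * α + 2 + 4 * (m : ℝ))]
    · obtain ⟨u, r, c, hu, hr, h⟩ := stepB_decomposition hα hβ hγ ih.1 ih.2
      -- The restriction `β - α < 4` enters here; `m = 0` is the critical case.
      have hpos : 0 < 4 * m + 4 + (α - β) := by linarith
      have h1 := (hu.congr (δ := 4 * m + 4 + (α - β) - 1) (fun _ => rfl) (by ring)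
        rfl).sum_alternate hpos
      have h2 := (hr.congr (δ := 4 * m + 4 + (α - β) - 1) (fun _ => rfl) (by ring) rfl).sum hpos
      refine (h1.add h2).congr (fun k => ?_) (by push_cast; ring) (by simp)
      rw [← Finset.sum_add_distrib]
      exact Finset.sum_congr rfl fun i _ => (h i).symm

theorem amp_fst_sub_asymp (hα : -1 < α) (hβ : -1 < β) (h4 : β - α < 4) (m : ℕ) :
    PowAsymp (fun k => (amp α β m).1 (k + 1) - (amp α β m).1 k) (4 * m - 1)
      (4 * m * limCoeff α m) := by
  cases m with
  | zero => simp [PowAsymp, amp]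
  | succ m =>
    have hm := m.cast_nonneg (α := ℝ)
    have ih := amp_asymp hα hβ h4 m
    refine (stepA_asymp hα hβ (by positivity) ih.1 ih.2).congr (fun k => ?_)
      (by push_cast; ring) ?_
    · rw [amp_succ_fst, amp_succ_fst, Finset.sum_range_succ, add_sub_cancel_left]
      rfl
    · rw [limCoeff]
      have : 2 * α + 2 + 4 * (m : ℝ) ≠ 0 := by linarith
      push_cast
      field_simp

/-- Over one step the alternating part of the increment need not be small; over two steps it cancels
to leading order. Hence the limit concerns the two-step recurrence. -/
theorem amp_snd_sub_asymp (hα : -1 < α) (hβ : -1 < β) (h4 : β - α < 4) (m : ℕ) :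
    PowAsymp (fun k => (amp α β m).2 (k + 2) - (amp α β m).2 k) (4 * m - 1 + (α - β)) 0 := by
  cases m with
  | zero => simp [PowAsymp, amp]
  | succ m =>
    have ih := amp_asymp hα hβ h4 m
    obtain ⟨u, r, c, hu, hr, h⟩ := stepB_decomposition hα hβ (by positivity) ih.1 ih.2
    have h1 := ((hu.sub (hu.shift 1)).congr (fun _ => rfl) rfl (sub_self c)).alternate
    refine (h1.add (hr.add (hr.shift 1))).congr (fun k => ?_) (by push_cast; ring) (by simp)
    rw [amp_succ_snd, amp_succ_snd, Finset.sum_range_succ, Finset.sum_range_succ, xCoeff, h, h,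
      pow_succ]
    ring

/-! ### Bounds for the amplitudes -/

/-- A bound for the terms `u m k` of order `(k + 1) ^ (4 * m + γ)` with constants of the form
`C * M ^ m / m!`. -/
def UniformBound (u : ℕ → ℕ → ℝ) (γ : ℝ) : Prop :=
  ∃ C M : ℝ, 0 ≤ C ∧ 1 ≤ M ∧
    ∀ m k : ℕ, |u m k| ≤ C * (M ^ m / m.factorial) * ((k : ℝ) + 1) ^ (4 * (m : ℝ) + γ)

namespace UniformBound

variable {u v : ℕ → ℕ → ℝ} {γ δ : ℝ}

theorem congr (h : UniformBound u γ) (huv : ∀ m k, u m k = v m k) (hγ : γ = δ) :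
    UniformBound v δ := by
  obtain rfl : u = v := by ext m k; exact huv m k
  exact hγ ▸ h

theorem add (h : UniformBound u γ) (h' : UniformBound v γ) :
    UniformBound (fun m k => u m k + v m k) γ := by
  obtain ⟨C, M, hC, hM, h⟩ := h
  obtain ⟨C', M', hC', hM', h'⟩ := h'
  have hM0 : (0 : ℝ) ≤ M := by linarith
  have hM0' : (0 : ℝ) ≤ M' := by linarith
  refine ⟨C + C', M + M', by positivity, by linarith, fun m k => (abs_add_le _ _).trans ?_⟩
  have hp := (rpow_cast_succ_pos k (4 * (m : ℝ) + γ)).le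
  rw [add_mul, add_mul]
  refine add_le_add ((h m k).trans ?_) ((h' m k).trans ?_) <;> gcongr <;> linarith

theorem neg (h : UniformBound u γ) : UniformBound (fun m k => -u m k) γ := by
  simpa only [UniformBound, abs_neg] using h

theorem sub (h : UniformBound u γ) (h' : UniformBound v γ) :
    UniformBound (fun m k => u m k - v m k) γ :=
  (h.add h'.neg).congr (fun _ _ => (sub_eq_add_neg _ _).symm) rfl

theorem mul_asymp {w : ℕ → ℝ} {c : ℝ} (h : UniformBound u γ) (hw : PowAsymp w δ c) :
    UniformBound (fun m k => u m k * w k) (γ + δ) := by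
  obtain ⟨C, M, hC, hM, h⟩ := h
  obtain ⟨D, hD, hw⟩ := hw.bounded
  have hM0 : (0 : ℝ) ≤ M := by linarith
  refine ⟨C * D, M, by positivity, hM, fun m k => ?_⟩
  rw [abs_mul, ← add_assoc, Real.rpow_add (by positivity)]
  calc _ ≤ _ := mul_le_mul (h m k) (hw k) (abs_nonneg _) ((abs_nonneg _).trans (h m k))
    _ = _ := by ring

theorem shift_one (h : UniformBound u γ) : UniformBound (fun m k => u m (k + 1)) γ := by
  obtain ⟨C, M, hC, hM, h⟩ := h
  have hM0 : (0 : ℝ) ≤ M := by linarith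
  -- The ratio `(k+2)/(k+1)` lies between 1 and 2, so its power `4m + γ` is at most `16^m * 2^|γ|`.
  refine ⟨C * 2 ^ |γ|, M * 2 ^ 4, by positivity, by linarith, fun m k => (h m (k + 1)).trans ?_⟩
  have hk := k.cast_nonneg (α := ℝ)
  have hk1 : (0 : ℝ) < k + 1 := by positivity
  have e : (((k + 1 : ℕ) : ℝ) + 1) = ((k : ℝ) + 1) * ((k + 2) / (k + 1)) := by
    push_cast
    field_simp
    ring
  have hr1 : (1 : ℝ) ≤ ((k : ℝ) + 2) / (k + 1) := (one_le_div hk1).2 (by linarith)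
  have hr2 : ((k : ℝ) + 2) / (k + 1) ≤ 2 := (div_le_iff₀ hk1).2 (by linarith)
  have h1 : (((k : ℝ) + 2) / (k + 1)) ^ (4 * (m : ℝ) + γ) ≤ (2 ^ 4) ^ m * 2 ^ |γ| := by
    calc _ ≤ (((k : ℝ) + 2) / (k + 1)) ^ (4 * (m : ℝ) + |γ|) :=
          Real.rpow_le_rpow_of_exponent_le hr1 (by linarith [le_abs_self γ])
      _ ≤ 2 ^ (4 * (m : ℝ) + |γ|) := Real.rpow_le_rpow (by positivity) hr2 (by positivity)
      _ = _ := by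
        rw [Real.rpow_add two_pos, ← pow_mul]
        congr 1
        exact_mod_cast Real.rpow_natCast 2 (4 * m)
  have hp := (rpow_cast_succ_pos k (4 * (m : ℝ) + γ)).le
  rw [e, Real.mul_rpow hk1.le (by positivity)]
  calc _ ≤ C * (M ^ m / m.factorial) * (((k : ℝ) + 1) ^ (4 * (m : ℝ) + γ) *
        ((2 ^ 4) ^ m * 2 ^ |γ|)) := by gcongr
    _ = _ := by rw [mul_pow]; ring

end UniformBound

/-- One step of the iteration for bounds; the constant does not depend on `γ`. -/
theorem exists_step_bound (hα : -1 < α) (hβ : -1 < β) :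
    ∃ L : ℝ, 0 ≤ L ∧ ∀ (γ D : ℝ) (A B : ℕ → ℝ), 0 ≤ γ →
      (∀ k : ℕ, |A k| ≤ D * ((k : ℝ) + 1) ^ γ) →
      (∀ k : ℕ, |B k| ≤ D * ((k : ℝ) + 1) ^ (γ + (α - β))) →
      (∀ k : ℕ, |stepA α β (wave α β A B) k| ≤ L * D * ((k : ℝ) + 1) ^ (γ + 3)) ∧
      ∀ k : ℕ, |stepB α β (wave α β A B) k| ≤ L * D * ((k : ℝ) + 1) ^ (γ + 3 + (α - β)) := by
  obtain ⟨F, hF, hφ⟩ := (phi_asymp hα).bounded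
  obtain ⟨G, hG, hψ⟩ := (phi_asymp hβ).bounded
  obtain ⟨F', hF', hφ'⟩ := ((phi_asymp hα).shift 1).bounded
  obtain ⟨G', hG', hψ'⟩ := ((phi_asymp hβ).shift 1).bounded
  obtain ⟨R, hR, hρ⟩ := (rho_asymp hα hβ).bounded
  obtain ⟨T, hT, hκ⟩ := (kappa_asymp hα hβ).bounded
  -- The divisors produced by the inner sums are `2α+2+γ` and `α+β+2+γ`. Replacing `γ ≥ 0` by zero
  -- in them keeps the constant independent of `γ`.
  set c₁ : ℝ := F * R * (F + G) * (1 + 1 / (2 * α + 2)) with hc₁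
  set c₂ : ℝ := G * R * (F + G) * (1 + 1 / (α + β + 2)) with hc₂
  have hp1 : 0 < 2 * α + 2 := by linarith
  have hp2 : 0 < α + β + 2 := by linarith
  have hc1 : 0 ≤ c₁ := by positivity
  have hc2 : 0 ≤ c₂ := by positivity
  refine ⟨T * (F' + G') * (F' + G') * (c₁ + c₂), by positivity, fun γ D A B hγ hA hB => ?_⟩
  have hD : 0 ≤ D := by simpa using (abs_nonneg _).trans (hA 0)
  have hx : ∀ k : ℕ, |wave α β A B k| ≤ D * (F + G) * ((k : ℝ) + 1) ^ (γ + α) := fun k => by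
    have hK : (0 : ℝ) < k + 1 := by positivity
    calc |wave α β A B k| ≤ |A k| * |phi α k| + |B k| * |phi β k| := by
          refine (abs_add_le _ _).trans (le_of_eq ?_)
          simp [abs_mul]
      _ ≤ (D * ((k : ℝ) + 1) ^ γ) * (F * ((k : ℝ) + 1) ^ α) +
          (D * ((k : ℝ) + 1) ^ (γ + (α - β))) * (G * ((k : ℝ) + 1) ^ β) := by
        gcongr
        exacts [hA k, hφ k, hB k, hψ k]
      _ = D * (F + G) * ((k : ℝ) + 1) ^ (γ + α) := by
        have e1 : ((k : ℝ) + 1) ^ (γ + α) = ((k : ℝ) + 1) ^ γ * ((k : ℝ) + 1) ^ α :=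
          Real.rpow_add hK _ _
        have e2 : ((k : ℝ) + 1) ^ (γ + α) =
            ((k : ℝ) + 1) ^ (γ + (α - β)) * ((k : ℝ) + 1) ^ β := by
          rw [← Real.rpow_add hK]
          congr 1
          ring
        linear_combination (-(D * F)) * e1 - D * G * e2
  have hP : ∀ k : ℕ, |innerP α β (wave α β A B) k| ≤
      c₁ * D * ((k : ℝ) + 1) ^ (2 * α + 2 + γ) := fun k => by
    have h1 : 0 < 2 * α + 2 + γ := by linarith
    have h2 := abs_sum_succ_le_of_le_rpow h1
      (u := fun i => phi α i * rho α β i * wave α β A B i) (C := F * R * (D * (F + G)))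
      (fun i => by
        have hK : (0 : ℝ) < i + 1 := by positivity
        have e : ((i : ℝ) + 1) ^ (2 * α + 2 + γ - 1) =
            ((i : ℝ) + 1) ^ α * ((i : ℝ) + 1) ^ (1 : ℝ) * ((i : ℝ) + 1) ^ (γ + α) := by
          rw [← Real.rpow_add hK, ← Real.rpow_add hK]
          congr 1
          ring
        rw [abs_mul, abs_mul, e]
        calc _ ≤ F * ((i : ℝ) + 1) ^ α * (R * ((i : ℝ) + 1) ^ (1 : ℝ)) *
              (D * (F + G) * ((i : ℝ) + 1) ^ (γ + α)) := by
              gcongr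
              exacts [hφ i, hρ i, hx i]
          _ = _ := by ring) k
    refine h2.trans ?_
    have h3 : 1 / (2 * α + 2 + γ) ≤ 1 / (2 * α + 2) := one_div_le_one_div_of_le hp1 (by linarith)
    have h4 := (rpow_cast_succ_pos k (2 * α + 2 + γ)).le
    calc _ ≤ F * R * (D * (F + G)) * (1 + 1 / (2 * α + 2)) * ((k : ℝ) + 1) ^ (2 * α + 2 + γ) := by
          gcongr
      _ = _ := by rw [hc₁]; ring
  have hQ : ∀ k : ℕ, |innerQ α β (wave α β A B) k| ≤
      c₂ * D * ((k : ℝ) + 1) ^ (α + β + 2 + γ) := fun k => by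
    have h1 : 0 < α + β + 2 + γ := by linarith
    have h2 := abs_sum_succ_le_of_le_rpow h1
      (u := fun i => (-1) ^ i * (phi β i * rho α β i * wave α β A B i))
      (C := G * R * (D * (F + G)))
      (fun i => by
        have hK : (0 : ℝ) < i + 1 := by positivity
        have e : ((i : ℝ) + 1) ^ (α + β + 2 + γ - 1) =
            ((i : ℝ) + 1) ^ β * ((i : ℝ) + 1) ^ (1 : ℝ) * ((i : ℝ) + 1) ^ (γ + α) := by
          rw [← Real.rpow_add hK, ← Real.rpow_add hK]
          congr 1
          ring
        rw [abs_mul, abs_mul, abs_mul, e, abs_pow, abs_neg, abs_one, one_pow, one_mul]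
        calc _ ≤ G * ((i : ℝ) + 1) ^ β * (R * ((i : ℝ) + 1) ^ (1 : ℝ)) *
              (D * (F + G) * ((i : ℝ) + 1) ^ (γ + α)) := by
              gcongr
              exacts [hψ i, hρ i, hx i]
          _ = _ := by ring) k
    refine h2.trans ?_
    have h3 : 1 / (α + β + 2 + γ) ≤ 1 / (α + β + 2) := one_div_le_one_div_of_le hp2 (by linarith)
    have h4 := (rpow_cast_succ_pos k (α + β + 2 + γ)).le
    calc _ ≤ G * R * (D * (F + G)) * (1 + 1 / (α + β + 2)) * ((k : ℝ) + 1) ^ (α + β + 2 + γ) := by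
          gcongr
      _ = _ := by rw [hc₂]; ring
  -- the product of the bounds for all factors
  have hprod : ∀ (k : ℕ) (p q r : ℝ) (f h s : ℝ) (a b c : ℝ), 0 ≤ f → 0 ≤ h →
      |p| ≤ f * ((k : ℝ) + 1) ^ a → |q| ≤ h * ((k : ℝ) + 1) ^ b →
      |r| ≤ s * D * ((k : ℝ) + 1) ^ c →
      |kappa α β k| * (|p| * |q| * |r|) ≤ T * (f * h * s) * D *
        ((k : ℝ) + 1) ^ (1 - 2 * α - 2 * β + a + b + c) := by
    intro k p q r f h s a b c hf hh hp hq hr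
    have hK : (0 : ℝ) < k + 1 := by positivity
    rw [Real.rpow_add hK, Real.rpow_add hK, Real.rpow_add hK]
    calc _ ≤ T * ((k : ℝ) + 1) ^ (1 - 2 * α - 2 * β) * (f * ((k : ℝ) + 1) ^ a *
          (h * ((k : ℝ) + 1) ^ b) * (s * D * ((k : ℝ) + 1) ^ c)) := by
          gcongr
          exact hκ k
      _ = _ := by ring
  constructor
  · intro k
    have h1 := hprod k _ _ _ _ _ _ _ _ _ hG' hG'
      (hψ' k) (hψ' k) (hP k)
    have h2 := hprod k _ _ _ _ _ _ _ _ _ hF' hG'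
      (hφ' k) (hψ' k) (hQ k)
    have e1 : 1 - 2 * α - 2 * β + β + β + (2 * α + 2 + γ) = γ + 3 := by ring
    have e2 : 1 - 2 * α - 2 * β + α + β + (α + β + 2 + γ) = γ + 3 := by ring
    rw [e1] at h1
    rw [e2] at h2
    have hp := (rpow_cast_succ_pos k (γ + 3)).le
    have h3 : G' * G' * c₁ + F' * G' * c₂ ≤ (F' + G') * (F' + G') * (c₁ + c₂) := by
      have : 0 ≤ F' * F' * (c₁ + c₂) + F' * G' * (2 * c₁ + c₂) + G' * G' * c₂ := by positivity
      nlinarith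
    calc |stepA α β (wave α β A B) k| ≤ T * (G' * G' * c₁) * D * ((k : ℝ) + 1) ^ (γ + 3) +
          T * (F' * G' * c₂) * D * ((k : ℝ) + 1) ^ (γ + 3) := by
          rw [stepA, abs_neg, mul_add]
          refine (abs_add_le _ _).trans (add_le_add ?_ ?_)
          · simpa only [abs_mul] using h1
          · simpa only [abs_mul, abs_pow, abs_neg, abs_one, one_pow, one_mul] using h2
      _ = T * (G' * G' * c₁ + F' * G' * c₂) * D * ((k : ℝ) + 1) ^ (γ + 3) := by ring
      _ ≤ T * ((F' + G') * (F' + G') * (c₁ + c₂)) * D * ((k : ℝ) + 1) ^ (γ + 3) := by gcongr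
      _ = _ := by ring
  · intro k
    have h1 := hprod k _ _ _ _ _ _ _ _ _ hF' hG'
      (hφ' k) (hψ' k) (hP k)
    have h2 := hprod k _ _ _ _ _ _ _ _ _ hF' hF'
      (hφ' k) (hφ' k) (hQ k)
    have e1 : 1 - 2 * α - 2 * β + α + β + (2 * α + 2 + γ) = γ + 3 + (α - β) := by ring
    have e2 : 1 - 2 * α - 2 * β + α + α + (α + β + 2 + γ) = γ + 3 + (α - β) := by ring
    rw [e1] at h1
    rw [e2] at h2
    have hp := (rpow_cast_succ_pos k (γ + 3 + (α - β))).le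
    have h3 : F' * G' * c₁ + F' * F' * c₂ ≤ (F' + G') * (F' + G') * (c₁ + c₂) := by
      have : 0 ≤ F' * F' * c₁ + F' * G' * (c₁ + 2 * c₂) + G' * G' * (c₁ + c₂) := by positivity
      nlinarith
    calc |stepB α β (wave α β A B) k| ≤
          T * (F' * G' * c₁) * D * ((k : ℝ) + 1) ^ (γ + 3 + (α - β)) +
          T * (F' * F' * c₂) * D * ((k : ℝ) + 1) ^ (γ + 3 + (α - β)) := by
          rw [stepB, abs_neg, mul_add]
          refine (abs_add_le _ _).trans (add_le_add ?_ ?_)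
          · simpa only [abs_mul, abs_pow, abs_neg, abs_one, one_pow, one_mul] using h1
          · simpa only [abs_mul] using h2
      _ = T * (F' * G' * c₁ + F' * F' * c₂) * D * ((k : ℝ) + 1) ^ (γ + 3 + (α - β)) := by ring
      _ ≤ T * ((F' + G') * (F' + G') * (c₁ + c₂)) * D * ((k : ℝ) + 1) ^ (γ + 3 + (α - β)) := by
        gcongr
      _ = _ := by ring

theorem amp_bound (hα : -1 < α) (hβ : -1 < β) (h4 : β - α < 4) :
    ∃ L M : ℝ, 0 ≤ L ∧ 1 ≤ M ∧ ∀ m k : ℕ,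
      (|(amp α β m).1 k| ≤ M ^ m / m.factorial * ((k : ℝ) + 1) ^ (4 * (m : ℝ)) ∧
      |(amp α β m).2 k| ≤ M ^ m / m.factorial * ((k : ℝ) + 1) ^ (4 * (m : ℝ) + (α - β))) ∧
      |stepA α β (xCoeff α β m) k| ≤
        L * (M ^ m / m.factorial) * ((k : ℝ) + 1) ^ (4 * (m : ℝ) + 3) ∧
      |stepB α β (xCoeff α β m) k| ≤
        L * (M ^ m / m.factorial) * ((k : ℝ) + 1) ^ (4 * (m : ℝ) + 3 + (α - β)) := by
  obtain ⟨L, hL, hstep⟩ := exists_step_bound hα hβ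
  -- Both exponents `4m+4` and `4m+4+(α-β)` of the outer sums are at least `c (m+1)`, so one
  -- iteration costs a factor at most `(L/c)/(m+1)`; this gives `M^m / m!`.
  set c : ℝ := min 4 (4 + (α - β)) with hc
  have hc0 : 0 < c := lt_min (by norm_num) (by linarith)
  have hc1 : c ≤ 4 := min_le_left _ _
  have hc2 : c ≤ 4 + (α - β) := min_le_right _ _
  set M : ℝ := L / c + 1 with hM
  have hM1 : 1 ≤ M := by
    have : 0 ≤ L / c := by positivity
    linarith
  have hM0 : 0 < M := by linarith
  refine ⟨L, M, hL, hM1, ?_⟩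
  suffices h : ∀ m, (∀ k : ℕ, |(amp α β m).1 k| ≤
        M ^ m / m.factorial * ((k : ℝ) + 1) ^ (4 * (m : ℝ))) ∧
      ∀ k : ℕ, |(amp α β m).2 k| ≤
        M ^ m / m.factorial * ((k : ℝ) + 1) ^ (4 * (m : ℝ) + (α - β)) by
    intro m k
    have := hstep (4 * m) (M ^ m / m.factorial) _ _ (by positivity) (h m).1 (h m).2
    exact ⟨⟨(h m).1 k, (h m).2 k⟩, this.1 k, this.2 k⟩
  intro m
  induction m with
  | zero =>
    refine ⟨fun k => by simp [amp], fun k => ?_⟩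
    have := (rpow_cast_succ_pos k (α - β)).le
    simpa [amp] using this
  | succ m ih =>
    obtain ⟨hA, hB⟩ := hstep (4 * m) (M ^ m / m.factorial) _ _ (by positivity) ih.1 ih.2
    set D : ℝ := M ^ m / m.factorial with hD
    have hD0 : 0 ≤ D := by positivity
    have hfin : ∀ e : ℝ, c * (m + 1) ≤ e → 0 < e →
        L * D / e ≤ M ^ (m + 1) / ((m + 1).factorial : ℝ) := fun e he he0 => by
      have hcm : 0 < c * (m + 1) := by positivity
      calc L * D / e ≤ L * D / (c * (m + 1)) := by gcongr
        _ = L / c * (D / (m + 1)) := by field_simp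
        _ ≤ M * (D / (m + 1)) := by
          gcongr
          linarith
        _ = _ := by
          rw [hD, Nat.factorial_succ, pow_succ]
          push_cast
          field_simp
    constructor
    · intro k
      have he : (0 : ℝ) < 4 * m + 4 := by positivity
      have h1 := abs_sum_le_of_le_rpow he (C := L * D) (fun i => (hA i).trans_eq (by ring_nf)) k
      rw [amp_succ_fst, show 4 * ((m + 1 : ℕ) : ℝ) = 4 * m + 4 by push_cast; ring]
      exact h1.trans (mul_le_mul_of_nonneg_right (hfin _ (by nlinarith [m.cast_nonneg (α := ℝ)]) he)
        (rpow_cast_succ_pos k _).le)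
    · intro k
      have hm := m.cast_nonneg (α := ℝ)
      have he : (0 : ℝ) < 4 * m + 4 + (α - β) := by linarith
      have h1 := abs_sum_le_of_le_rpow he (C := L * D) (fun i => (hB i).trans_eq (by ring_nf)) k
      rw [amp_succ_snd, show 4 * ((m + 1 : ℕ) : ℝ) + (α - β) = 4 * m + 4 + (α - β) by
        push_cast; ring]
      exact h1.trans (mul_le_mul_of_nonneg_right (hfin _ (by nlinarith) he)
        (rpow_cast_succ_pos k _).le)

/-- Increments of order `m + 1` are bounded through order `m`. The missing divisor `m + 1` is
absorbed by `2^(m+1)`, at the price of doubling `M`. -/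
theorem UniformBound.of_succ {u : ℕ → ℕ → ℝ} {γ L M : ℝ} (hL : 0 ≤ L) (hM : 1 ≤ M)
    (h0 : ∀ k, u 0 k = 0) (h : ∀ m k : ℕ, |u (m + 1) k| ≤
      L * (M ^ m / m.factorial) * ((k : ℝ) + 1) ^ (4 * (m : ℝ) + 4 + γ)) : UniformBound u γ := by
  have hM0 : 0 < M := by linarith
  refine ⟨L, 2 * M, hL, by linarith, fun m k => ?_⟩
  have hp := (rpow_cast_succ_pos k (4 * (m : ℝ) + γ)).le
  cases m with
  | zero =>
    rw [h0, abs_zero]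
    positivity
  | succ m =>
    refine (h m k).trans ?_
    rw [show 4 * ((m + 1 : ℕ) : ℝ) + γ = 4 * m + 4 + γ by push_cast; ring] at hp ⊢
    have h1 : M ^ m / (m.factorial : ℝ) ≤ (2 * M) ^ (m + 1) / ((m + 1).factorial : ℝ) := by
      rw [Nat.factorial_succ, mul_comm (m + 1), Nat.cast_mul, ← div_div, div_right_comm]
      refine div_le_div_of_nonneg_right ?_ (by positivity)
      rw [le_div_iff₀ (by positivity)]
      have h2 : ((m + 1 : ℕ) : ℝ) ≤ 2 ^ (m + 1) := by
        exact_mod_cast (Nat.lt_two_pow_self (n := m + 1)).le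
      have h3 : M ^ m ≤ M ^ (m + 1) := pow_le_pow_right₀ hM (Nat.le_succ m)
      rw [mul_pow, mul_comm]
      exact mul_le_mul h2 h3 (by positivity) (by positivity)
    gcongr

theorem amp_uniformBound (hα : -1 < α) (hβ : -1 < β) (h4 : β - α < 4) :
    UniformBound (fun m => (amp α β m).1) 0 ∧ UniformBound (fun m => (amp α β m).2) (α - β) ∧
    UniformBound (fun m k => (amp α β m).1 (k + 1) - (amp α β m).1 k) (-1) ∧
    UniformBound (fun m k => (amp α β m).2 (k + 1) - (amp α β m).2 k) (-1 + (α - β)) := by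
  obtain ⟨L, M, hL, hM, h⟩ := amp_bound hα hβ h4
  refine ⟨⟨1, M, zero_le_one, hM, fun m k => ?_⟩, ⟨1, M, zero_le_one, hM, fun m k => ?_⟩,
    .of_succ hL hM (by simp [amp]) fun m k => ?_, .of_succ hL hM (by simp [amp]) fun m k => ?_⟩
  · rw [one_mul, add_zero]
    exact (h m k).1.1
  · rw [one_mul]
    exact (h m k).1.2
  · rw [amp_succ_fst, amp_succ_fst, Finset.sum_range_succ, add_sub_cancel_left]
    exact (h m k).2.1.trans_eq (by ring_nf)
  · rw [amp_succ_snd, amp_succ_snd, Finset.sum_range_succ, add_sub_cancel_left]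
    exact (h m k).2.2.trans_eq (by ring_nf)

end

section

/-! ### The components of the vectors `Y_k` -/

variable {α β : ℝ}

theorem PowAsymp.of_lt {u : ℕ → ℝ} {γ δ c : ℝ} (h : PowAsymp u γ c) (hγ : γ < δ) :
    PowAsymp u δ 0 := by
  have h1 : Tendsto (fun k : ℕ => ((k : ℝ) + 1) ^ (-(δ - γ))) atTop (𝓝 0) :=
    (tendsto_rpow_neg_atTop (sub_pos.2 hγ)).comp
      (tendsto_atTop_add_const_right _ 1 tendsto_natCast_atTop_atTop)
  have h2 := Tendsto.mul h h1
  rw [mul_zero] at h2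
  refine h2.congr fun k => ?_
  have hK : (0 : ℝ) < k + 1 := by positivity
  rw [div_mul_eq_mul_div, div_eq_div_iff (rpow_cast_succ_pos k _).ne' (rpow_cast_succ_pos k _).ne',
    mul_assoc, ← Real.rpow_add hK]
  congr 2
  ring

theorem UniformBound.mono {u : ℕ → ℕ → ℝ} {γ δ : ℝ} (h : UniformBound u γ) (hγ : γ ≤ δ) :
    UniformBound u δ := by
  obtain ⟨C, M, hC, hM, h⟩ := h
  have hM0 : (0 : ℝ) ≤ M := by linarith
  refine ⟨C, M, hC, hM, fun m k => (h m k).trans ?_⟩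
  gcongr
  linarith [k.cast_nonneg (α := ℝ)]

/-- Sums of neighbours. -/
def phiSum (a : ℝ) (k : ℕ) : ℝ := phi a k + phi a (k + 1)

/-- Differences of neighbours. -/
def phiDiff (a : ℝ) (k : ℕ) : ℝ := phi a k - phi a (k + 1)

theorem phiSum_asymp {a : ℝ} (ha : -1 < a) : PowAsymp (phiSum a) a 2 :=
  ((phi_asymp ha).add ((phi_asymp ha).shift 1)).congr (fun _ => rfl) rfl (by norm_num)

/-- The difference equals `-a * phi a k / (k+1)` exactly, so it gains a full power of `k`. -/
theorem phiDiff_asymp {a : ℝ} (ha : -1 < a) : PowAsymp (phiDiff a) (a - 1) (-a) := by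
  refine (((phi_asymp ha).mul ((PowAsymp.linear 1 (b := 1)).inv one_ne_zero)).const_mul
    (-a)).congr (fun k => ?_) (by ring) (by norm_num)
  rw [phiDiff, phi_succ ha]
  field_simp
  ring

theorem phiSum_sub_asymp {a : ℝ} (ha : -1 < a) :
    PowAsymp (fun k => phiSum a (k + 2) - phiSum a k) (a - 1) (4 * a) := by
  have h := phiDiff_asymp ha
  refine ((h.add ((h.shift 1).const_mul 2)).add (h.shift 2)).neg.congr (fun k => ?_) rfl (by ring)
  simp only [phiDiff, phiSum]
  ring

theorem phiDiff_sub_asymp {a : ℝ} (ha : -1 < a) :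
    PowAsymp (fun k => phiDiff a (k + 2) - phiDiff a k) (a - 1) 0 :=
  (((phiDiff_asymp ha).shift 2).sub (phiDiff_asymp ha)).congr (fun _ => rfl) rfl (sub_self _)

/-- The sum of two neighbours of the sequence `xCoeff α β m`, starting at an even index. -/
def evenSum (α β : ℝ) (m k : ℕ) : ℝ :=
  (amp α β m).1 k * phiSum α k + (amp α β m).2 k * phiDiff β k

/-- The difference of two neighbours of the sequence `xCoeff α β m`, starting at an even index. -/
def evenDiff (α β : ℝ) (m k : ℕ) : ℝ :=
  (amp α β m).1 k * phiDiff α k + (amp α β m).2 k * phiSum β k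

/-- The coefficient of `lam ^ m` in the components of `Y_(k+2)`, for even `k`. -/
def yCoeff (α β : ℝ) (i : Fin 4) (m k : ℕ) : ℝ :=
  ![evenSum α β m k, evenDiff α β m k, (k + 2) * (evenSum α β m (k + 2) - evenSum α β m k),
    (k + 2) * (evenDiff α β m (k + 2) - evenDiff α β m k)] i

/-- The coefficients of `l ^ m t ^ (4 m + α)` in the components of the limit vector. -/
def yLim (α : ℝ) (i : Fin 4) (m : ℕ) : ℝ :=
  ![2 * limCoeff α m, 0, (16 * m + 4 * α) * limCoeff α m, 0] i

/-- A discrete product rule for the first wave. The second needs none, since `phiDiff β` is already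
one order smaller. -/
theorem evenSum_sub (m k : ℕ) : evenSum α β m (k + 2) - evenSum α β m k =
    (((amp α β m).1 (k + 2) - (amp α β m).1 (k + 1)) +
      ((amp α β m).1 (k + 1) - (amp α β m).1 k)) * phiSum α (k + 2) +
    (amp α β m).1 k * (phiSum α (k + 2) - phiSum α k) +
    ((amp α β m).2 (k + 2) * phiDiff β (k + 2) - (amp α β m).2 k * phiDiff β k) := by
  simp only [evenSum]
  ring

/-- Here the product rule is needed for the second wave too, since `phiSum β` brings no gain of
order. -/
theorem evenDiff_sub (m k : ℕ) : evenDiff α β m (k + 2) - evenDiff α β m k =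
    (((amp α β m).1 (k + 2) - (amp α β m).1 (k + 1)) +
      ((amp α β m).1 (k + 1) - (amp α β m).1 k)) * phiDiff α (k + 2) +
    (amp α β m).1 k * (phiDiff α (k + 2) - phiDiff α k) +
    (((amp α β m).2 (k + 2) - (amp α β m).2 k) * phiSum β (k + 2) +
      (amp α β m).2 k * (phiSum β (k + 2) - phiSum β k)) := by
  simp only [evenDiff]
  ring

/-- In the third component `16 m` comes from the growth of the amplitude and `4 α` from that of
`phiSum α`, both over two steps. All contributions of the second wave disappear. -/
theorem yCoeff_asymp (hα : -1 < α) (hβ : -1 < β) (h4 : β - α < 4) (i : Fin 4) (m : ℕ) :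
    PowAsymp (yCoeff α β i m) (4 * m + α) (yLim α i m) := by
  obtain ⟨hA, hB⟩ := amp_asymp hα hβ h4 m
  have hdA := amp_fst_sub_asymp hα hβ h4 m
  have hdA2 := (hdA.shift 1).add hdA
  have hdB := amp_snd_sub_asymp hα hβ h4 m
  have hlin : PowAsymp (fun k : ℕ => (k : ℝ) + 2) 1 1 :=
    (PowAsymp.linear 1 (b := 2)).congr (fun k => by rw [one_mul]) rfl rfl
  fin_cases i
  · refine ((hA.mul (phiSum_asymp hα)).add (((hB.mul (phiDiff_asymp hβ)).of_lt
      (δ := 4 * m + α) (by linarith)))).congr (fun k => rfl) rfl ?_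
    simp [yLim, mul_comm]
  · refine (((hA.mul (phiDiff_asymp hα)).of_lt (δ := 4 * m + α) (by linarith)).add
      ((hB.mul (phiSum_asymp hβ)).congr (fun _ => rfl) (by ring) rfl)).congr (fun k => rfl) rfl ?_
    simp [yLim]
  · have h1 := (hdA2.mul ((phiSum_asymp hα).shift 2)).congr (δ := 4 * m + α - 1) (fun _ => rfl)
      (by ring) rfl
    have h2 := (hA.mul (phiSum_sub_asymp hα)).congr (δ := 4 * m + α - 1) (fun _ => rfl)
      (by ring) rfl
    have h3 := (hB.mul (phiDiff_asymp hβ)).congr (δ := 4 * m + α - 1) (e := 0) (fun _ => rfl)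
      (by ring) (by ring)
    have h5 := (h1.add h2).add ((h3.shift 2).sub h3)
    refine (hlin.mul h5).congr (fun k => ?_) (by ring) ?_
    · simp only [yCoeff, evenSum_sub]
      rfl
    · simp [yLim]
      ring
  · have h1 := (hdA2.mul ((phiDiff_asymp hα).shift 2)).of_lt (δ := 4 * m + α - 1) (by linarith)
    have h2 := (hA.mul (phiDiff_sub_asymp hα)).congr (δ := 4 * m + α - 1) (fun _ => rfl)
      (by ring) rfl
    have h3 := (hdB.mul ((phiSum_asymp hβ).shift 2)).congr (δ := 4 * m + α - 1) (fun _ => rfl)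
      (by ring) rfl
    have h5 := (hB.mul (phiSum_sub_asymp hβ)).congr (δ := 4 * m + α - 1) (fun _ => rfl)
      (by ring) rfl
    refine (hlin.mul ((h1.add h2).add (h3.add h5))).congr (fun k => ?_) (by ring) ?_
    · simp only [yCoeff, evenDiff_sub]
      rfl
    · simp [yLim]

theorem yCoeff_uniformBound (hα : -1 < α) (hβ : -1 < β) (h4 : β - α < 4) (i : Fin 4) :
    UniformBound (yCoeff α β i) α := by
  obtain ⟨hA, hB, hdA, hdB⟩ := amp_uniformBound hα hβ h4
  have hdA2 := hdA.shift_one.add hdA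
  have hdB2 := hdB.shift_one.add hdB
  have hlin : PowAsymp (fun k : ℕ => (k : ℝ) + 2) 1 1 :=
    (PowAsymp.linear 1 (b := 2)).congr (fun k => by rw [one_mul]) rfl rfl
  fin_cases i
  · exact ((hA.mul_asymp (phiSum_asymp hα)).mono (δ := α) (by linarith)).add
      ((hB.mul_asymp (phiDiff_asymp hβ)).mono (by linarith))
  · exact ((hA.mul_asymp (phiDiff_asymp hα)).mono (δ := α) (by linarith)).add
      ((hB.mul_asymp (phiSum_asymp hβ)).mono (by linarith))
  · have h1 := (hdA2.mul_asymp ((phiSum_asymp hα).shift 2)).mono (δ := α - 1) (by linarith)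
    have h2 := (hA.mul_asymp (phiSum_sub_asymp hα)).mono (δ := α - 1) (by linarith)
    have h3 := (hB.mul_asymp (phiDiff_asymp hβ)).mono (δ := α - 1) (by linarith)
    refine (((h1.add h2).add (h3.shift_one.shift_one.sub h3)).mul_asymp hlin).congr
      (fun m k => ?_) (by ring)
    change _ * ((k : ℝ) + 2) = ((k : ℝ) + 2) * _
    rw [evenSum_sub, mul_comm]
  · have h1 := (hdA2.mul_asymp ((phiDiff_asymp hα).shift 2)).mono (δ := α - 1) (by linarith)
    have h2 := (hA.mul_asymp (phiDiff_sub_asymp hα)).mono (δ := α - 1) (by linarith)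
    have h3 := (hdB2.mul_asymp ((phiSum_asymp hβ).shift 2)).mono (δ := α - 1) (by linarith)
    have h5 := (hB.mul_asymp (phiSum_sub_asymp hβ)).mono (δ := α - 1) (by linarith)
    refine (((h1.add h2).add (h3.add h5)).mul_asymp hlin).congr (fun m k => ?_) (by ring)
    change _ * ((k : ℝ) + 2) = ((k : ℝ) + 2) * _
    rw [evenDiff_sub, mul_comm,
      ← sub_add_sub_cancel ((amp α β m).2 (k + 2)) ((amp α β m).2 (k + 1)) ((amp α β m).2 k)]

theorem summable_exp_bound (C M : ℝ) :
    Summable fun m : ℕ => C * (M ^ m / (m.factorial : ℝ)) :=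
  (Real.summable_pow_div_factorial M).mul_left C

theorem UniformBound.summable {u : ℕ → ℕ → ℝ} {γ : ℝ} (h : UniformBound u γ) (lam : ℂ) (k : ℕ) :
    Summable fun m => lam ^ m * (u m k : ℂ) := by
  obtain ⟨C, M, hC, hM, h⟩ := h
  refine Summable.of_norm_bounded (summable_exp_bound (C * ((k : ℝ) + 1) ^ γ)
    (‖lam‖ * M * ((k : ℝ) + 1) ^ 4)) fun m => ?_
  rw [norm_mul, norm_pow, Complex.norm_real, Real.norm_eq_abs]
  refine (mul_le_mul_of_nonneg_left (h m k) (by positivity)).trans_eq ?_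
  have e : ((k : ℝ) + 1) ^ (4 * (m : ℝ)) = (((k : ℝ) + 1) ^ 4) ^ m := by
    rw [← pow_mul]
    exact_mod_cast Real.rpow_natCast ((k : ℝ) + 1) (4 * m)
  rw [Real.rpow_add (by positivity), e, mul_pow, mul_pow]
  ring

/-! ### The particular solutions -/

/-- The particular solution with the initial values of `phi α`. -/
def xSol (α β : ℝ) (lam : ℂ) (k : ℕ) : ℂ := ∑' m, lam ^ m * (xCoeff α β m k : ℂ)

theorem summable_amp (hα : -1 < α) (hβ : -1 < β) (h4 : β - α < 4) (lam : ℂ) (k : ℕ) :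
    (Summable fun m => lam ^ m * ((amp α β m).1 k : ℂ)) ∧
    Summable fun m => lam ^ m * ((amp α β m).2 k : ℂ) :=
  ⟨(amp_uniformBound hα hβ h4).1.summable lam k, (amp_uniformBound hα hβ h4).2.1.summable lam k⟩

theorem summable_xCoeff (hα : -1 < α) (hβ : -1 < β) (h4 : β - α < 4) (lam : ℂ) (k : ℕ) :
    Summable fun m => lam ^ m * (xCoeff α β m k : ℂ) := by
  obtain ⟨hA, hB⟩ := summable_amp hα hβ h4 lam k
  refine ((hA.mul_right (phi α k : ℂ)).add (hB.mul_right ((-1) ^ k * phi β k : ℂ))).congr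
    fun m => ?_
  rw [xCoeff, wave]
  push_cast
  ring

theorem xSol_isSolution (hα : -1 < α) (hβ : -1 < β) (h4 : β - α < 4) (lam : ℂ) :
    IsSolution α β lam (xSol α β lam) :=
  isSolution_tsum hα hβ (secondOrderAdjoint_xCoeff_zero hα hβ)
    (secondOrderAdjoint_xCoeff_succ hα hβ) (summable_xCoeff hα hβ h4 lam)

theorem xSol_alternate_isSolution (hα : -1 < α) (hβ : -1 < β) (h4 : α - β < 4) (lam : ℂ) :
    IsSolution α β lam fun k => (-1) ^ k * xSol β α lam k := by
  have h := isSolution_tsum hα hβ (c := fun m k => (-1) ^ k * xCoeff β α m k) (lam := lam)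
    (fun k => by
      rw [secondOrderAdjoint_eta_alternate, secondOrderAdjoint_xCoeff_zero hβ hα, mul_zero])
    (fun m k => by
      rw [secondOrderAdjoint_eta_alternate, secondOrderAdjoint_xCoeff_succ hβ hα, rho_comm]
      ring)
    (fun k => ((summable_xCoeff hβ hα h4 lam k).mul_left ((-1) ^ k)).congr fun m => by
      push_cast
      ring)
  convert! h using 2 with k
  rw [xSol, ← tsum_mul_left]
  refine tsum_congr fun m => ?_
  push_cast
  ring

theorem xSol_zero (lam : ℂ) : xSol α β lam 0 = phi α 0 := by
  rw [xSol, tsum_eq_single 0 fun m hm => ?_]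
  · simp [xCoeff_zero]
  · obtain ⟨m, rfl⟩ := Nat.exists_eq_succ_of_ne_zero hm
    simp [xCoeff, wave, amp]

/-- The entry 1 can be written with the amplitudes at 0, which are empty sums in positive orders.
Together with `xSol_zero` this makes the initial vector independent of `lam`. -/
theorem xSol_one (lam : ℂ) : xSol α β lam 1 = phi α 1 := by
  rw [xSol, tsum_eq_single 0 fun m hm => ?_]
  · simp [xCoeff_zero]
  · obtain ⟨m, rfl⟩ := Nat.exists_eq_succ_of_ne_zero hm
    rw [wave_succ m.succ 0]
    simp [amp]

theorem xSol_lam_zero (k : ℕ) : xSol α β 0 k = phi α k := by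
  rw [xSol, tsum_eq_single 0 fun m hm => by rw [zero_pow hm, zero_mul], pow_zero, one_mul,
    xCoeff_zero]

theorem evenSum_eq (m : ℕ) {k : ℕ} (hk : Even k) :
    evenSum α β m k = xCoeff α β m k + xCoeff α β m (k + 1) := by
  rw [wave_succ, xCoeff, wave, pow_succ, hk.neg_one_pow, evenSum, phiSum, phiDiff]
  ring

theorem evenDiff_eq (m : ℕ) {k : ℕ} (hk : Even k) :
    evenDiff α β m k = xCoeff α β m k - xCoeff α β m (k + 1) := by
  rw [wave_succ, xCoeff, wave, pow_succ, hk.neg_one_pow, evenDiff, phiSum, phiDiff]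
  ring

theorem tsum_yCoeff (hα : -1 < α) (hβ : -1 < β) (h4 : β - α < 4) (lam : ℂ) {k : ℕ}
    (hk : Even k) (i : Fin 4) :
    ∑' m, lam ^ m * (yCoeff α β i m k : ℂ) = (U (k + 2) *ᵥ window (xSol α β lam) (k + 2)) i := by
  have hx (k : ℕ) : HasSum (fun m => lam ^ m * (xCoeff α β m k : ℂ)) (xSol α β lam k) :=
    (summable_xCoeff hα hβ h4 lam k).hasSum
  have hk2 : Even (k + 2) := hk.add even_two
  have h0 (k : ℕ) (hk : Even k) : HasSum (fun m => lam ^ m * (evenSum α β m k : ℂ))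
      (xSol α β lam k + xSol α β lam (k + 1)) := by
    convert! (hx k).add (hx (k + 1)) using 2 with m
    rw [evenSum_eq _ hk]
    push_cast
    ring
  have h1 (k : ℕ) (hk : Even k) : HasSum (fun m => lam ^ m * (evenDiff α β m k : ℂ))
      (xSol α β lam k - xSol α β lam (k + 1)) := by
    convert! (hx k).sub (hx (k + 1)) using 2 with m
    rw [evenDiff_eq _ hk]
    push_cast
    ring
  have hlin {f g : ℕ → ℝ} {a b : ℂ} (hf : HasSum (fun m => lam ^ m * (f m : ℂ)) a)
      (hg : HasSum (fun m => lam ^ m * (g m : ℂ)) b) :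
      HasSum (fun m => lam ^ m * ((((k : ℝ) + 2) * (f m - g m) : ℝ) : ℂ))
        (((k : ℂ) + 2) * (a - b)) := by
    convert! (hf.sub hg).mul_left ((k : ℂ) + 2) using 2 with m
    push_cast
    ring
  have hkk : kk (k + 2) = (k : ℂ) + 2 := by simp [kk]
  fin_cases i
  · refine (h0 k hk).tsum_eq.trans ?_
    simp [U, window, Matrix.mulVec, dotProduct, Fin.sum_univ_four]
  · refine (h1 k hk).tsum_eq.trans ?_
    simp [U, window, Matrix.mulVec, dotProduct, Fin.sum_univ_four]
    ring
  · refine (hlin (h0 _ hk2) (h0 k hk)).tsum_eq.trans ?_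
    simp [U, window, Matrix.mulVec, dotProduct, Fin.sum_univ_four, hkk]
    ring
  · refine (hlin (h1 _ hk2) (h1 k hk)).tsum_eq.trans ?_
    simp [U, window, Matrix.mulVec, dotProduct, Fin.sum_univ_four, hkk]
    ring

/-- The exchange of components caused by `x k ↦ (-1) ^ k * x k`. -/
def swap : Fin 4 → Fin 4 := ![1, 0, 3, 2]

/-- At an even index, alternating the signs turns the sum of a pair of neighbours into its
difference and conversely. -/
theorem U_mulVec_window_alternate (x : ℕ → ℂ) {k : ℕ} (hk : Even k) (i : Fin 4) :
    (U k *ᵥ window (fun k => (-1) ^ k * x k) k) i = (U k *ᵥ window x k) (swap i) := by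
  obtain ⟨j, rfl⟩ := hk
  rcases j with - | j
  · fin_cases i <;> simp [U, window, Matrix.mulVec, dotProduct, Fin.sum_univ_four, swap]
  · have e1 : j + 1 + (j + 1) - 2 = 2 * j := by omega
    have e2 : j + 1 + (j + 1) - 1 = 2 * j + 1 := by omega
    have e3 : j + 1 + (j + 1) = 2 * j + 2 := by omega
    rw [e3] at *
    fin_cases i <;> simp [U, window, Matrix.mulVec, dotProduct, Fin.sum_univ_four, swap, pow_succ,
      pow_mul]

theorem xZero_natCast (j : Fin 2) (k : ℕ) :
    xZero α β j (k : ℤ) = ![1, (-1) ^ k] j * phi (b α β j) k := by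
  rw [xZero, if_neg (by omega), phi, mul_div_assoc]
  simp

theorem XZero_eq (j : Fin 2) (k : ℕ) :
    XZero α β j k = window (fun k => ((![1, (-1) ^ k] j * phi (b α β j) k : ℝ) : ℂ)) k := by
  have h1 : (xZero α β j ((k : ℤ) + 1)) = ![1, (-1) ^ (k + 1)] j * phi (b α β j) (k + 1) := by
    rw [← xZero_natCast]
    push_cast
    rfl
  have h2 (i : ℕ) (hi : k < i) : xZero α β j ((k : ℤ) - i) = 0 := by
    rw [xZero, if_pos (by omega)]
  have h3 (i : ℕ) (hi : i ≤ k) :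
      xZero α β j ((k : ℤ) - i) = ![1, (-1) ^ (k - i)] j * phi (b α β j) (k - i) := by
    rw [← xZero_natCast, Nat.cast_sub hi]
  ext i
  fin_cases i
  · change ((xZero α β j ((k : ℤ) - (2 : ℕ)) : ℝ) : ℂ) = if k < 2 then 0 else _
    split_ifs with h
    · rw [h2 2 h, Complex.ofReal_zero]
    · rw [h3 2 (not_lt.1 h)]
  · change ((xZero α β j ((k : ℤ) - (1 : ℕ)) : ℝ) : ℂ) = if k < 1 then 0 else _
    split_ifs with h
    · rw [h2 1 h, Complex.ofReal_zero]
    · rw [h3 1 (not_lt.1 h)]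
  · exact congrArg (fun x : ℝ => (x : ℂ)) (xZero_natCast j k)
  · exact congrArg (fun x : ℝ => (x : ℂ)) h1

/-- The sequences which define the vectors `Y_k`. -/
def xPart (α β : ℝ) (lam : ℂ) (j : Fin 2) : ℕ → ℂ :=
  ![xSol α β lam, fun k => (-1) ^ k * xSol β α lam k] j

theorem xPart_isSolution (hα : -1 < α) (hβ : -1 < β) (h4 : |α - β| < 4) (lam : ℂ) (j : Fin 2) :
    IsSolution α β lam (xPart α β lam j) := by
  have := abs_lt.1 h4
  fin_cases j
  · exact xSol_isSolution hα hβ (by linarith) lam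
  · exact xSol_alternate_isSolution hα hβ (by linarith) lam

theorem window_xPart_lam_zero (j : Fin 2) (k : ℕ) :
    window (xPart α β 0 j) k = XZero α β j k := by
  rw [XZero_eq]
  congr 1
  funext k
  fin_cases j <;> simp [xPart, xSol_lam_zero, b]

theorem window_xPart_zero (lam : ℂ) (j : Fin 2) : window (xPart α β lam j) 0 = XZero α β j 0 := by
  rw [← window_xPart_lam_zero]
  have h0 : xPart α β lam j 0 = xPart α β 0 j 0 := by fin_cases j <;> simp [xPart, xSol_zero]
  have h1 : xPart α β lam j 1 = xPart α β 0 j 1 := by fin_cases j <;> simp [xPart, xSol_one]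
  simp [window, h0, h1]

theorem Y_eq {Y : Fin 2 → ℕ → ℂ → Fin 4 → ℂ} (hα : -1 < α) (hβ : -1 < β) (h4 : |α - β| < 4)
    (hY₀ : ∀ (j : Fin 2) (lam : ℂ), Y j 0 lam = YZero α β j 0)
    (hY : ∀ (j : Fin 2) (lam : ℂ) (k : ℕ), Even k →
      Y j (k + 2) lam = (Mhat₂ α β k lam).mulVec (Y j k lam))
    (j : Fin 2) (lam : ℂ) {k : ℕ} (hk : Even k) :
    Y j k lam = U k *ᵥ window (xPart α β lam j) k :=
  (xPart_isSolution hα hβ h4 lam j).eq_U_mulVec_window hα hβ (Y := fun k => Y j k lam)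
    (by rw [hY₀, YZero, window_xPart_zero]) (hY j lam) k hk

end

section

/-! ### The limit functions -/

/-- Coefficients of a power series of exponential type. -/
def ExpBound (c : ℕ → ℝ) : Prop :=
  ∃ C M : ℝ, 0 ≤ C ∧ 1 ≤ M ∧ ∀ m : ℕ, |c m| ≤ C * (M ^ m / (m.factorial : ℝ))

/-- The sum of a power series with real coefficients. -/
def powerSum (c : ℕ → ℝ) (z : ℂ) : ℂ := ∑' m, (c m : ℂ) * z ^ m

namespace ExpBound

variable {c e : ℕ → ℝ}

theorem add (hc : ExpBound c) (he : ExpBound e) : ExpBound fun m => c m + e m := by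
  obtain ⟨C, M, hC, hM, h⟩ := hc
  obtain ⟨C', M', hC', hM', h'⟩ := he
  have hM0 : (0 : ℝ) ≤ M := by linarith
  have hM0' : (0 : ℝ) ≤ M' := by linarith
  refine ⟨C + C', M + M', by positivity, by linarith, fun m => (abs_add_le _ _).trans ?_⟩
  rw [add_mul]
  refine add_le_add ((h m).trans ?_) ((h' m).trans ?_) <;> gcongr <;> linarith

theorem const_mul (a : ℝ) (hc : ExpBound c) : ExpBound fun m => a * c m := by
  obtain ⟨C, M, hC, hM, h⟩ := hc
  refine ⟨|a| * C, M, by positivity, hM, fun m => ?_⟩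
  rw [abs_mul, mul_assoc]
  exact mul_le_mul_of_nonneg_left (h m) (abs_nonneg a)

theorem index_mul (hc : ExpBound c) : ExpBound fun m => m * c m := by
  obtain ⟨C, M, hC, hM, h⟩ := hc
  have hM0 : (0 : ℝ) ≤ M := by linarith
  refine ⟨C, 2 * M, by positivity, by linarith, fun m => ?_⟩
  have h2 : (m : ℝ) ≤ 2 ^ m := by exact_mod_cast (Nat.lt_two_pow_self (n := m)).le
  rw [abs_mul, Nat.abs_cast, mul_pow]
  calc (m : ℝ) * |c m| ≤ 2 ^ m * (C * (M ^ m / m.factorial)) :=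
        mul_le_mul h2 (h m) (abs_nonneg _) (by positivity)
    _ = _ := by ring

theorem affine_mul (a b : ℝ) (hc : ExpBound c) : ExpBound fun m => (a * m + b) * c m := by
  have := (hc.index_mul.const_mul a).add (hc.const_mul b)
  simpa only [add_mul, mul_assoc] using this

theorem exists_summable_bound (hc : ExpBound c) (R : ℝ) :
    ∃ v : ℕ → ℝ, Summable v ∧ ∀ (z : ℂ) (m : ℕ), ‖z‖ ≤ R → ‖(c m : ℂ) * z ^ m‖ ≤ v m := by
  obtain ⟨C, M, hC, hM, h⟩ := hc
  have hM0 : (0 : ℝ) ≤ M := by linarith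
  refine ⟨_, summable_exp_bound C (M * R), fun z m hz => ?_⟩
  rw [norm_mul, norm_pow, Complex.norm_real, Real.norm_eq_abs]
  have hR : 0 ≤ R := (norm_nonneg z).trans hz
  calc |c m| * ‖z‖ ^ m ≤ C * (M ^ m / m.factorial) * R ^ m := by
        gcongr
        exact h m
    _ = _ := by rw [mul_pow]; ring

theorem summable (hc : ExpBound c) (z : ℂ) : Summable fun m => (c m : ℂ) * z ^ m := by
  obtain ⟨v, hv, h⟩ := hc.exists_summable_bound ‖z‖
  exact Summable.of_norm_bounded hv fun m => h z m le_rfl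

theorem powerSum_affine (a b : ℝ) (hc : ExpBound c) (z : ℂ) :
    powerSum (fun m => (a * m + b) * c m) z =
      a * powerSum (fun m => m * c m) z + b * powerSum c z := by
  rw [powerSum, powerSum, powerSum, ← tsum_mul_left, ← tsum_mul_left,
    ← Summable.tsum_add ((hc.index_mul.summable z).mul_left _) ((hc.summable z).mul_left _)]
  refine tsum_congr fun m => ?_
  push_cast
  ring

/-- Only `z * w` is recorded, because the Euler operator `z d/dz` multiplies coefficients by `m`
without shifting the index. -/
theorem exists_hasDerivAt (hc : ExpBound c) (z : ℂ) :
    ∃ w, HasDerivAt (powerSum c) w z ∧ z * w = powerSum (fun m => m * c m) z := by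
  set R : ℝ := ‖z‖ + 1 with hR
  have hR1 : 1 ≤ R := by linarith [norm_nonneg z]
  have hR0 : 0 ≤ R := by linarith
  obtain ⟨v, hv, h⟩ := hc.index_mul.exists_summable_bound R
  have hg' : ∀ (m : ℕ) (y : ℂ), y ∈ Metric.ball (0 : ℂ) R →
      ‖(c m : ℂ) * (m * y ^ (m - 1))‖ ≤ v m := fun m y hy => by
    rw [mem_ball_zero_iff] at hy
    have h1 := h R m (by rw [Complex.norm_real, Real.norm_eq_abs, abs_of_nonneg hR0])
    refine le_trans ?_ h1
    rw [norm_mul, norm_mul, norm_pow, norm_mul, norm_pow, Complex.ofReal_mul, norm_mul,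
      Complex.ofReal_natCast, Complex.norm_real, Complex.norm_real R, Real.norm_eq_abs R,
      abs_of_nonneg hR0, mul_left_comm, mul_assoc]
    gcongr
    calc ‖y‖ ^ (m - 1) ≤ R ^ (m - 1) := by gcongr
      _ ≤ R ^ m := pow_le_pow_right₀ hR1 (Nat.sub_le m 1)
  have hz : z ∈ Metric.ball (0 : ℂ) R := by
    rw [mem_ball_zero_iff]
    linarith
  refine ⟨_, hasDerivAt_tsum_of_isPreconnected hv Metric.isOpen_ball
    (convex_ball (0 : ℂ) R).isPreconnected
    (fun m y _ => (hasDerivAt_pow m y).const_mul _) hg' hz (hc.summable z) hz, ?_⟩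
  rw [← tsum_mul_left, powerSum]
  refine tsum_congr fun m => ?_
  rcases m with - | m
  · simp
  · push_cast
    ring

theorem continuous (hc : ExpBound c) : Continuous (powerSum c) :=
  continuous_iff_continuousAt.2 fun z =>
    let ⟨_, hw, _⟩ := hc.exists_hasDerivAt z
    hw.continuousAt

/-- The derivative of `t ^ a * powerSum c (l * t ^ 4)`. -/
theorem hasDerivAt_rpow_mul (hc : ExpBound c) (a : ℝ) (l : ℂ) {t : ℝ} (ht : 0 < t) :
    HasDerivAt (fun s : ℝ => ((s ^ a : ℝ) : ℂ) * powerSum c (l * (s : ℂ) ^ 4))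
      ((1 / (t : ℂ)) * (((t ^ a : ℝ) : ℂ) *
        powerSum (fun m => (4 * m + a) * c m) (l * (t : ℂ) ^ 4))) t := by
  obtain ⟨w, hw, hzw⟩ := hc.exists_hasDerivAt (l * (t : ℂ) ^ 4)
  have h1 : HasDerivAt (fun s : ℝ => ((s ^ a : ℝ) : ℂ)) ((a * t ^ (a - 1) : ℝ) : ℂ) t :=
    (Real.hasDerivAt_rpow_const (Or.inl ht.ne')).ofReal_comp
  have h2 : HasDerivAt (fun s : ℂ => l * s ^ 4) (l * (((4 : ℕ) : ℂ) * (t : ℂ) ^ (4 - 1))) (t : ℂ) :=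
    (hasDerivAt_pow 4 (t : ℂ)).const_mul l
  have h3 := (HasDerivAt.comp (t : ℂ) hw h2).comp_ofReal
  have ht' : (t : ℂ) ≠ 0 := by exact_mod_cast ht.ne'
  refine (h1.mul h3).congr_deriv ?_
  rw [hc.powerSum_affine 4 a, ← hzw, Real.rpow_sub_one ht.ne']
  simp only [Function.comp]
  push_cast
  field_simp
  ring

end ExpBound

/-! ### The Bessel series and its differential equation -/

variable {α : ℝ}

theorem limCoeff_expBound (hα : -1 < α) : ExpBound (limCoeff α) := by
  have hp : 0 < 2 * α + 2 := by linarith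
  refine ⟨1, 1 / (2 * α + 2) + 1, zero_le_one, by simp [hp.le], fun m => ?_⟩
  rw [one_mul]
  induction m with
  | zero => simp [limCoeff]
  | succ m ih =>
    set M : ℝ := 1 / (2 * α + 2) + 1 with hM
    have hm := m.cast_nonneg (α := ℝ)
    have hM0 : 0 < M := by positivity
    rw [limCoeff, abs_neg, abs_div, abs_of_pos (by positivity : 0 < (4 * (m : ℝ) + 4) *
      (2 * α + 2 + 4 * m)), Nat.factorial_succ, pow_succ]
    have h1 : 1 ≤ M * (2 * α + 2 + 4 * m) := by
      have : M * (2 * α + 2) = 1 + (2 * α + 2) := by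
        rw [hM, add_mul, one_mul, one_div, inv_mul_cancel₀ hp.ne']
      nlinarith [mul_nonneg hM0.le hm]
    push_cast
    rw [div_le_div_iff₀ (by positivity) (by positivity)]
    rw [le_div_iff₀ (by positivity)] at ih
    calc |limCoeff α m| * (((m : ℝ) + 1) * m.factorial)
        = (|limCoeff α m| * m.factorial) * ((m : ℝ) + 1) * 1 := by ring
      _ ≤ M ^ m * (4 * (m : ℝ) + 4) * (M * (2 * α + 2 + 4 * m)) := by
        have h2 : (m : ℝ) + 1 ≤ 4 * m + 4 := by linarith
        exact mul_le_mul (mul_le_mul ih h2 (by positivity) (by positivity)) h1 zero_le_one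
          (by positivity)
      _ = _ := by ring

theorem yLim_expBound (hα : -1 < α) (i : Fin 4) : ExpBound (yLim α i) := by
  have h := limCoeff_expBound hα
  have h0 : ExpBound fun _ : ℕ => (0 : ℝ) := ⟨0, 1, le_rfl, le_rfl, by simp⟩
  fin_cases i
  exacts [h.const_mul 2, h0, h.affine_mul 16 (4 * α), h0]

/-- Since `2α+2+4m = 4(m+ν+1)`, the recursion divides by `16 (m+1)(m+ν+1)` at each step, as in the
Bessel series. -/
theorem limCoeff_eq (hα : -1 < α) (m : ℕ) : limCoeff α m =
    (-1) ^ m * Real.Gamma (nu α + 1) / (16 ^ m * m.factorial * Real.Gamma (m + nu α + 1)) := by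
  have hν : 0 < nu α + 1 := by rw [nu]; linarith
  induction m with
  | zero =>
    have := (Real.Gamma_pos_of_pos hν).ne'
    simp [limCoeff, div_self this]
  | succ m ih =>
    have hm := m.cast_nonneg (α := ℝ)
    have hp : 0 < m + nu α + 1 := by linarith
    have := (Real.Gamma_pos_of_pos hp).ne'
    have e : ((m + 1 : ℕ) : ℝ) + nu α + 1 = m + nu α + 1 + 1 := by push_cast; ring
    have e2 : 2 * α + 2 + 4 * (m : ℝ) = 4 * (m + nu α + 1) := by rw [nu]; ring
    rw [limCoeff, ih, e, Real.Gamma_add_one hp.ne', Nat.factorial_succ, e2]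
    have hp' := hp.ne'
    generalize (m : ℝ) + nu α + 1 = p at *
    push_cast
    have : (m.factorial : ℝ) ≠ 0 := by positivity
    field_simp
    ring

theorem yScalar_eq (hα : -1 < α) (l : ℂ) {t : ℝ} (ht : 0 < t) :
    yScalar α t l = ((t ^ α : ℝ) : ℂ) * powerSum (yLim α 0) (l * (t : ℂ) ^ 4) := by
  have hν : 0 < nu α + 1 := by rw [nu]; linarith
  by_cases hl : l = 0
  · rw [yScalar, if_pos hl, hl, powerSum, tsum_eq_single 0 fun m hm => by simp [hm]]
    simp [yLim, limCoeff]
    ring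
  have hr : (0 : ℝ) < t ^ 2 / 4 := by positivity
  have hw : l ^ (1 / 2 : ℂ) * (t : ℂ) ^ 2 / 2 / 2 = ((t ^ 2 / 4 : ℝ) : ℂ) * l ^ (1 / 2 : ℂ) := by
    push_cast
    ring
  have hl2 : l ^ (1 / 2 : ℂ) ≠ 0 := by simp [hl]
  -- The branches agree: the argument of the principal root is half that of `l`, and the remaining
  -- factor is positive. The factor `l^(ν/2)` then cancels against the normalization.
  have hpow : (((t ^ 2 / 4 : ℝ) : ℂ) * l ^ (1 / 2 : ℂ)) ^ (nu α : ℂ) =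
      (((t ^ 2 / 4) ^ nu α : ℝ) : ℂ) * l ^ ((nu α / 2 : ℝ) : ℂ) := by
    have harg := Complex.neg_pi_lt_arg l
    have harg' := Complex.arg_le_pi l
    have him : (Complex.log l * (1 / 2)).im = l.arg / 2 := by
      simp [Complex.mul_im, Complex.log_im]
      ring
    have h1 : l ^ ((nu α / 2 : ℝ) : ℂ) = (l ^ (1 / 2 : ℂ)) ^ (nu α : ℂ) := by
      rw [← Complex.cpow_mul _ (by rw [him]; linarith [Real.pi_pos])
        (by rw [him]; linarith [Real.pi_pos])]
      congr 1
      push_cast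
      ring
    have hr' : ((t ^ 2 / 4 : ℝ) : ℂ) ≠ 0 := by exact_mod_cast hr.ne'
    rw [h1, Complex.cpow_def_of_ne_zero (mul_ne_zero hr' hl2), Complex.log_ofReal_mul hr hl2,
      add_mul, Complex.exp_add, Complex.ofReal_log hr.le, ← Complex.cpow_def_of_ne_zero hr',
      ← Complex.cpow_def_of_ne_zero hl2, Complex.ofReal_cpow hr.le]
  have hsq : (l ^ (1 / 2 : ℂ)) ^ 2 = l := by
    rw [one_div]
    exact Complex.cpow_ofNat_inv_pow l 2
  have hreal : (2 : ℝ) ^ α * (t * (t ^ 2 / 4) ^ nu α) = 2 * t ^ α := by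
    have h4 : (4 : ℝ) ^ nu α = 2 ^ (2 * nu α) := by
      rw [Real.rpow_mul two_pos.le]
      norm_num
    have h5 : (t ^ 2) ^ nu α = t ^ (2 * nu α) := by
      rw [Real.rpow_mul ht.le]
      norm_num
    have e1 : t ^ α = t * t ^ (2 * nu α) := by
      rw [show α = 1 + 2 * nu α by rw [nu]; ring, Real.rpow_add ht, Real.rpow_one,
        show 1 + 2 * nu α = α by rw [nu]; ring]
    have e2 : (2 : ℝ) ^ α = 2 * 2 ^ (2 * nu α) := by
      rw [show α = 1 + 2 * nu α by rw [nu]; ring, Real.rpow_add two_pos, Real.rpow_one,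
        show 1 + 2 * nu α = α by rw [nu]; ring]
    have := (Real.rpow_pos_of_pos two_pos (2 * nu α)).ne'
    rw [Real.div_rpow (by positivity) (by positivity), h4, h5, e1, e2]
    field_simp
  have hlν : l ^ ((nu α / 2 : ℝ) : ℂ) ≠ 0 := by simp [hl]
  rw [yScalar, if_neg hl, besselJ, hw, hpow]
  have hre : ((t ^ α : ℝ) : ℂ) * powerSum (yLim α 0) (l * (t : ℂ) ^ 4) =
      ((2 * t ^ α : ℝ) : ℂ) * powerSum (limCoeff α) (l * (t : ℂ) ^ 4) := by
    simp only [powerSum, ← tsum_mul_left]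
    refine tsum_congr fun m => ?_
    simp [yLim]
    ring
  rw [hre, ← hreal]
  have hsum : ((Real.Gamma (nu α + 1) : ℝ) : ℂ) * (∑' m : ℕ, (-1 : ℂ) ^ m / ((m.factorial : ℂ) *
      Complex.Gamma ((m : ℂ) + nu α + 1)) * (((t ^ 2 / 4 : ℝ) : ℂ) * l ^ (1 / 2 : ℂ)) ^ (2 * m)) =
      powerSum (limCoeff α) (l * (t : ℂ) ^ 4) := by
    rw [powerSum, ← tsum_mul_left]
    refine tsum_congr fun m => ?_
    have hG : Complex.Gamma ((m : ℂ) + nu α + 1) = ((Real.Gamma (m + nu α + 1) : ℝ) : ℂ) := by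
      rw [← Complex.Gamma_ofReal]
      push_cast
      rfl
    have hz : (((t ^ 2 / 4 : ℝ) : ℂ) * l ^ (1 / 2 : ℂ)) ^ (2 * m) =
        (l * (t : ℂ) ^ 4) ^ m / 16 ^ m := by
      rw [pow_mul, mul_pow, hsq, ← div_pow]
      congr 1
      push_cast
      ring
    rw [hG, hz, limCoeff_eq hα]
    push_cast
    ring
  rw [← hsum]
  generalize l ^ ((nu α / 2 : ℝ) : ℂ) = q at hlν ⊢
  generalize tsum (fun m : ℕ => (-1 : ℂ) ^ m / ((m.factorial : ℂ) *
      Complex.Gamma ((m : ℂ) + nu α + 1)) *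
        (((t ^ 2 / 4 : ℝ) : ℂ) * l ^ (1 / 2 : ℂ)) ^ (2 * m)) = S
  push_cast
  field_simp

theorem zScalar_eq (hα : -1 < α) (l : ℂ) {t : ℝ} (ht : 0 < t) :
    zScalar α t l = ((t ^ α : ℝ) : ℂ) * powerSum (yLim α 2) (l * (t : ℂ) ^ 4) := by
  have h1 := (yLim_expBound hα 0).hasDerivAt_rpow_mul α l ht
  have h2 : HasDerivAt (fun s : ℝ => yScalar α s l) _ t :=
    h1.congr_of_eventuallyEq ((lt_mem_nhds ht).mono fun s hs => yScalar_eq hα l hs)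
  have ht' : (t : ℂ) ≠ 0 := by exact_mod_cast ht.ne'
  have hc : powerSum (yLim α 2) (l * (t : ℂ) ^ 4) =
      2 * powerSum (fun m => (4 * m + α) * yLim α 0 m) (l * (t : ℂ) ^ 4) := by
    simp only [powerSum, ← tsum_mul_left]
    refine tsum_congr fun m => ?_
    simp [yLim]
    ring
  rw [zScalar, h2.deriv, hc]
  field_simp

/-- The function `yScalar` solves the limiting scalar equation. -/
theorem powerSum_limit_equation (hα : -1 < α) (z : ℂ) :
    powerSum (fun m => (4 * m + α) * yLim α 2 m) z =
      (-2 * z + 2 * α * (α - 2)) * powerSum (yLim α 0) z + 2 * powerSum (yLim α 2) z := by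
  have hb := limCoeff_expBound hα
  have h0 := yLim_expBound hα 0
  have h2 := yLim_expBound hα 2
  -- The coefficient `32 m (2m+α-1) limCoeff m` is what remains of the left side after the terms
  -- without the factor `z` are removed. The recursion for `limCoeff` shifts it by one index into
  -- `-2 z y`.
  have hs : Summable fun m => (((32 * m * (2 * m + α - 1) * limCoeff α m : ℝ)) : ℂ) * z ^ m := by
    refine (ExpBound.summable (c := fun m => 32 * m * (2 * m + α - 1) * limCoeff α m) ?_ z)
    have := ((hb.affine_mul 2 (α - 1)).index_mul).const_mul 32
    convert! this using 2 with m
    ring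
  have hshift : ∑' m : ℕ, (((32 * m * (2 * m + α - 1) * limCoeff α m : ℝ)) : ℂ) * z ^ m =
      -2 * z * powerSum (yLim α 0) z := by
    rw [hs.tsum_eq_zero_add, powerSum, ← tsum_mul_left]
    simp only [Nat.cast_zero, mul_zero, zero_mul, Complex.ofReal_zero, zero_add]
    refine tsum_congr fun m => ?_
    have hm := m.cast_nonneg (α := ℝ)
    have e : (32 * ((m + 1 : ℕ) : ℝ) * (2 * ((m + 1 : ℕ) : ℝ) + α - 1) * limCoeff α (m + 1)) =
        -2 * yLim α 0 m := by
      have h1 : 2 * α + 2 + 4 * (m : ℝ) ≠ 0 := by linarith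
      have h2 : 2 * ((m + 1 : ℕ) : ℝ) + α - 1 = (2 * α + 2 + 4 * m) / 2 := by push_cast; ring
      rw [limCoeff, h2]
      generalize 2 * α + 2 + 4 * (m : ℝ) = p at *
      simp only [yLim, Matrix.cons_val_zero]
      push_cast
      field_simp
      ring
    rw [e, pow_succ]
    push_cast
    ring
  rw [add_mul, ← hshift, powerSum, powerSum, powerSum, ← tsum_mul_left, ← tsum_mul_left,
    ← Summable.tsum_add hs ((h0.summable z).mul_left _),
    ← Summable.tsum_add (hs.add ((h0.summable z).mul_left _)) ((h2.summable z).mul_left _)]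
  refine tsum_congr fun m => ?_
  simp [yLim]
  ring

theorem hasDerivAt_yScalar (hα : -1 < α) (l : ℂ) {t : ℝ} (ht : 0 < t) :
    HasDerivAt (fun s : ℝ => yScalar α s l) (1 / (t : ℂ) * (1 / 2 * zScalar α t l)) t := by
  have h1 := (yLim_expBound hα 0).hasDerivAt_rpow_mul α l ht
  have h2 : HasDerivAt (fun s : ℝ => yScalar α s l) _ t :=
    h1.congr_of_eventuallyEq ((lt_mem_nhds ht).mono fun s hs => yScalar_eq hα l hs)
  have ht' : (t : ℂ) ≠ 0 := by exact_mod_cast ht.ne'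
  refine h2.congr_deriv ?_
  rw [zScalar, h2.deriv]
  field_simp

theorem hasDerivAt_zScalar (hα : -1 < α) (l : ℂ) {t : ℝ} (ht : 0 < t) :
    HasDerivAt (fun s : ℝ => zScalar α s l) (1 / (t : ℂ) *
      ((-2 * l * (t : ℂ) ^ 4 + 2 * α * (α - 2)) * yScalar α t l + 2 * zScalar α t l)) t := by
  have h1 := (yLim_expBound hα 2).hasDerivAt_rpow_mul α l ht
  have h2 : HasDerivAt (fun s : ℝ => zScalar α s l) _ t :=
    h1.congr_of_eventuallyEq ((lt_mem_nhds ht).mono fun s hs => zScalar_eq hα l hs)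
  refine h2.congr_deriv ?_
  rw [powerSum_limit_equation hα, zScalar_eq hα l ht, yScalar_eq hα l ht]
  ring

end

section

/-! ### Uniform asymptotics -/

/-- A power series in `lam` with coefficients of the orders `(k + 1) ^ (4 * m + γ)`, after scaling,
converges locally uniformly to the power series of the limits. -/
theorem exists_scaled_bound {u : ℕ → ℕ → ℝ} {γ : ℝ} {c : ℕ → ℝ} (hu : UniformBound u γ)
    (hc : ExpBound c) (huc : ∀ m, PowAsymp (u m) (4 * m + γ) (c m)) (R : ℝ) :
    ∃ e : ℕ → ℝ, Tendsto e atTop (𝓝 0) ∧ ∀ (k : ℕ) (lam : ℂ), ‖lam * ((k : ℂ) + 1) ^ 4‖ ≤ R →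
      ‖(∑' m, lam ^ m * (u m k : ℂ)) -
        ((((k : ℝ) + 1) ^ γ : ℝ) : ℂ) * powerSum c (lam * ((k : ℂ) + 1) ^ 4)‖ ≤
          ((k : ℝ) + 1) ^ γ * e k := by
  have hus := hu
  obtain ⟨C, M, hC, hM, hu⟩ := hu
  have hcs := hc
  obtain ⟨C', M', hC', hM', hc⟩ := hc
  have hM0 : (0 : ℝ) ≤ M := by linarith
  have hM0' : (0 : ℝ) ≤ M' := by linarith
  set η : ℕ → ℕ → ℝ := fun m k => u m k / ((k : ℝ) + 1) ^ (4 * (m : ℝ) + γ) with hη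
  have hηb : ∀ m k, |η m k| ≤ C * (M ^ m / m.factorial) := fun m k => by
    rw [hη, abs_div, abs_of_pos (rpow_cast_succ_pos k _), div_le_iff₀ (rpow_cast_succ_pos k _)]
    exact hu m k
  set w : ℕ → ℝ := fun m => C * ((M * |R|) ^ m / m.factorial) +
    C' * ((M' * |R|) ^ m / m.factorial) with hw
  have hws : Summable w := (summable_exp_bound C (M * |R|)).add (summable_exp_bound C' (M' * |R|))
  have hterm : ∀ m k, ‖|η m k - c m| * |R| ^ m‖ ≤ w m := fun m k => by
    rw [Real.norm_eq_abs, abs_mul, abs_abs, abs_pow, abs_abs]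
    calc |η m k - c m| * |R| ^ m
        ≤ (C * (M ^ m / m.factorial) + C' * (M' ^ m / m.factorial)) * |R| ^ m := by
          gcongr
          exact (abs_sub _ _).trans (add_le_add (hηb m k) (hc m))
      _ = w m := by simp only [hw, mul_pow]; ring
  -- The error is majorized at radius `|R|` independently of `lam`, and it tends to zero by
  -- dominated convergence with the exponential majorant `w`.
  refine ⟨fun k => ∑' m, |η m k - c m| * |R| ^ m, ?_, fun k lam hlam => ?_⟩
  · have h0 : (0 : ℝ) = ∑' m : ℕ, |c m - c m| * |R| ^ m := by simp
    rw [h0]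
    refine tendsto_tsum_of_dominated_convergence hws (fun m => ?_)
      (Eventually.of_forall fun k m => hterm m k)
    exact (((huc m).sub_const (c m)).abs).mul_const _
  · set z : ℂ := lam * ((k : ℂ) + 1) ^ 4 with hz
    have hK : (0 : ℝ) < k + 1 := by positivity
    have hp := Real.rpow_pos_of_pos hK γ
    have heq : ∀ m, lam ^ m * (u m k : ℂ) =
        ((((k : ℝ) + 1) ^ γ : ℝ) : ℂ) * ((η m k : ℂ) * z ^ m) := fun m => by
      have e : ((k : ℝ) + 1) ^ (4 * (m : ℝ)) = (((k : ℝ) + 1) ^ 4) ^ m := by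
        rw [← pow_mul]
        exact_mod_cast Real.rpow_natCast ((k : ℝ) + 1) (4 * m)
      have h1 : u m k = ((k : ℝ) + 1) ^ γ * η m k * (((k : ℝ) + 1) ^ 4) ^ m := by
        simp only [hη]
        rw [Real.rpow_add hK, e]
        field_simp
      rw [h1, hz, mul_pow]
      push_cast
      ring
    have hzR : ‖z‖ ≤ |R| := hlam.trans (le_abs_self R)
    have hsη : Summable fun m => (η m k : ℂ) * z ^ m := by
      refine ((hus.summable lam k).mul_left ((((k : ℝ) + 1) ^ γ : ℝ) : ℂ)⁻¹).congr fun m => ?_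
      rw [heq, inv_mul_cancel_left₀ (by exact_mod_cast hp.ne')]
    rw [tsum_congr heq, tsum_mul_left, ← mul_sub, norm_mul, Complex.norm_real,
      Real.norm_of_nonneg hp.le, powerSum, ← hsη.tsum_sub (hcs.summable z)]
    refine mul_le_mul_of_nonneg_left ?_ hp.le
    refine tsum_of_norm_bounded (Summable.of_norm_bounded hws fun m => hterm m k).hasSum fun m => ?_
    rw [← sub_mul, norm_mul, norm_pow, ← Complex.ofReal_sub, Complex.norm_real, Real.norm_eq_abs]
    gcongr

/-- The quotient contains `k + 2` because `yCoeff` at `k` belongs to `Y_(k+2)`. The natural variable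
of the power asymptotics is `τ = (k+1)/n`, at distance `1/n` from it. -/
theorem exists_uniform_asymptotics {u : ℕ → ℕ → ℝ} {γ : ℝ} {c : ℕ → ℝ} (hu : UniformBound u γ)
    (hc : ExpBound c) (huc : ∀ m, PowAsymp (u m) (4 * m + γ) (c m)) {K : Set ℝ} {t₀ : ℝ}
    (ht₀ : 0 < t₀) (hK : K ⊆ Set.Icc t₀ 1) {L : Set ℂ} (hL : IsCompact L) {ε : ℝ} (hε : 0 < ε) :
    ∃ δ : ℝ, 0 < δ ∧ ∃ N : ℕ, ∀ n : ℕ, N ≤ n → ∀ k : ℕ, ∀ t ∈ K,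
      |((k + 2 : ℕ) : ℝ) / n - t| < δ → ∀ l ∈ L,
        ‖(∑' m, (l / (n : ℂ) ^ 4) ^ m * (u m k : ℂ)) -
          (((n : ℝ) ^ γ : ℝ) : ℂ) * (((t ^ γ : ℝ) : ℂ) * powerSum c (l * (t : ℂ) ^ 4))‖ ≤
            (n : ℝ) ^ γ * (ε * t ^ γ) := by
  rcases K.eq_empty_or_nonempty with rfl | ⟨t₁, ht₁⟩
  · exact ⟨1, one_pos, 0, by simp⟩
  have ht₀1 : t₀ ≤ 1 := (hK ht₁).1.trans (hK ht₁).2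
  -- A lower bound for the tolerance `ε t^γ` on `[t₀, 1]`, valid for either sign of `γ`.
  set μ : ℝ := ε * t₀ ^ |γ| with hμ
  have hμ0 : 0 < μ := mul_pos hε (Real.rpow_pos_of_pos ht₀ _)
  have hμK : ∀ t ∈ K, μ ≤ ε * t ^ γ := fun t ht => by
    obtain ⟨h1, h2⟩ := hK ht
    refine mul_le_mul_of_nonneg_left ?_ hε.le
    exact (Real.rpow_le_rpow ht₀.le h1 (abs_nonneg γ)).trans
      (Real.rpow_le_rpow_of_exponent_ge (ht₀.trans_le h1) h2 (le_abs_self γ))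
  -- bounds and uniform continuity on a compact set
  set I : Set ℝ := Set.Icc (t₀ / 2) 2 with hI
  have hIpos : ∀ τ ∈ I, 0 < τ := fun τ hτ => (half_pos ht₀).trans_le hτ.1
  obtain ⟨R, hR⟩ := hL.isBounded.exists_norm_le
  obtain ⟨e, he, hbound⟩ := exists_scaled_bound hu hc huc (R * 2 ^ 4)
  have hpow : ContinuousOn (fun τ : ℝ => τ ^ γ) I := fun τ hτ =>
    (Real.continuousAt_rpow_const τ γ (Or.inl (hIpos τ hτ).ne')).continuousWithinAt
  obtain ⟨B, hB⟩ := isCompact_Icc.exists_bound_of_continuousOn hpow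
  set F : ℝ × ℂ → ℂ := fun p => ((p.1 ^ γ : ℝ) : ℂ) * powerSum c (p.2 * (p.1 : ℂ) ^ 4) with hF
  have hFc : ContinuousOn F (I ×ˢ L) := by
    refine ContinuousOn.mul ?_ (hc.continuous.comp (by fun_prop)).continuousOn
    exact Complex.continuous_ofReal.comp_continuousOn
      (hpow.comp continuousOn_fst fun p hp => hp.1)
  have hFu := (isCompact_Icc.prod hL).uniformContinuousOn_of_continuous hFc
  rw [Metric.uniformContinuousOn_iff] at hFu
  obtain ⟨δ₁, hδ₁, hFu⟩ := hFu (μ / 2) (half_pos hμ0)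
  have hB1 : 0 < |B| + 1 := by positivity
  obtain ⟨k₀, hk₀⟩ := Metric.tendsto_atTop.1 he (μ / 2 / (|B| + 1)) (by positivity)
  set δ : ℝ := min (δ₁ / 2) (t₀ / 4) with hδ
  have hδ0 : 0 < δ := by positivity
  -- The first summand ensures `1/n < δ`; the second ensures `k ≥ k₀`, since `k + 1 = τ n ≥ t₀ n /
  -- 2`.
  obtain ⟨N, hN⟩ := exists_nat_gt (1 / δ + 2 * (k₀ + 1) / t₀)
  refine ⟨δ, hδ0, N, fun n hn k t ht hkt l hl => ?_⟩
  have hnN : (N : ℝ) ≤ n := by exact_mod_cast hn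
  have hn1 : 1 / δ < n := by
    have : 0 ≤ 2 * ((k₀ : ℝ) + 1) / t₀ := by positivity
    linarith
  have hn2 : 2 * ((k₀ : ℝ) + 1) / t₀ < n := by
    have : 0 ≤ 1 / δ := by positivity
    linarith
  have hn0 : (0 : ℝ) < n := (by positivity : 0 < 1 / δ).trans hn1
  set τ : ℝ := ((k : ℝ) + 1) / n with hτ
  have hτt : |τ - t| < 2 * δ := by
    have h1 : τ - t = (((k + 2 : ℕ) : ℝ) / n - t) - 1 / n := by
      rw [hτ]
      push_cast
      ring
    have h2 : 1 / (n : ℝ) < δ := (one_div_lt hδ0 hn0).1 hn1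
    rw [h1]
    refine (abs_sub _ _).trans_lt ?_
    rw [abs_of_pos (one_div_pos.2 hn0)]
    linarith
  have hδ2 : 2 * δ ≤ δ₁ := by linarith [min_le_left (δ₁ / 2) (t₀ / 4)]
  have hδ3 : 2 * δ ≤ t₀ / 2 := by linarith [min_le_right (δ₁ / 2) (t₀ / 4)]
  obtain ⟨htl, htu⟩ := hK ht
  obtain ⟨ha, hb⟩ := abs_lt.1 hτt
  have hτI : τ ∈ I := ⟨by linarith, by linarith⟩
  have htI : t ∈ I := ⟨by linarith, by linarith⟩
  have hτ0 := hIpos τ hτI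
  have hk : k₀ ≤ k := by
    have h1 : (k : ℝ) + 1 = τ * n := by rw [hτ]; field_simp
    have h2 : (k₀ : ℝ) + 1 < (k : ℝ) + 1 := by
      rw [h1]
      rw [div_lt_iff₀ ht₀] at hn2
      nlinarith [hτI.1]
    exact_mod_cast (by linarith : (k₀ : ℝ) ≤ k)
  have hnc : (n : ℂ) ≠ 0 := by exact_mod_cast hn0.ne'
  have hz : l / (n : ℂ) ^ 4 * ((k : ℂ) + 1) ^ 4 = l * (τ : ℂ) ^ 4 := by
    rw [hτ]
    push_cast
    field_simp
  have h1 := hbound k (l / (n : ℂ) ^ 4) (by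
    rw [hz, norm_mul, norm_pow, Complex.norm_real, Real.norm_of_nonneg hτ0.le]
    have := hR l hl
    have := hτI.2
    gcongr
    exact (norm_nonneg l).trans (hR l hl))
  have hsplit : ((k : ℝ) + 1) ^ γ = (n : ℝ) ^ γ * τ ^ γ := by
    rw [← Real.mul_rpow hn0.le hτ0.le]
    congr 1
    rw [hτ]
    field_simp
  rw [hz, hsplit] at h1
  have hnp := Real.rpow_pos_of_pos hn0 γ
  have hτp := Real.rpow_pos_of_pos hτ0 γ
  have hek : e k < μ / 2 / (|B| + 1) := by
    have := hk₀ k hk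
    rw [Real.dist_eq, sub_zero] at this
    exact (le_abs_self _).trans_lt this
  have hτB : τ ^ γ ≤ |B| + 1 := by
    have := hB τ hτI
    rw [Real.norm_of_nonneg hτp.le] at this
    linarith [le_abs_self B]
  have h2 : τ ^ γ * e k ≤ μ / 2 := by
    calc τ ^ γ * e k ≤ τ ^ γ * (μ / 2 / (|B| + 1)) := by gcongr
      _ ≤ (|B| + 1) * (μ / 2 / (|B| + 1)) := by gcongr
      _ = μ / 2 := by field_simp
  have h3 : ‖F (τ, l) - F (t, l)‖ < μ / 2 := by
    rw [← dist_eq_norm]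
    refine hFu (τ, l) ⟨hτI, hl⟩ (t, l) ⟨htI, hl⟩ ?_
    rw [Prod.dist_eq, dist_self, Real.dist_eq, max_eq_left (abs_nonneg _)]
    linarith
  have h4 : ‖(((n : ℝ) ^ γ : ℝ) : ℂ) * F (τ, l) - (((n : ℝ) ^ γ : ℝ) : ℂ) * F (t, l)‖ ≤
      (n : ℝ) ^ γ * (μ / 2) := by
    rw [← mul_sub, norm_mul, Complex.norm_real, Real.norm_of_nonneg hnp.le]
    exact mul_le_mul_of_nonneg_left h3.le hnp.le
  have h5 : ‖(∑' m, (l / (n : ℂ) ^ 4) ^ m * (u m k : ℂ)) - (((n : ℝ) ^ γ : ℝ) : ℂ) * F (τ, l)‖ ≤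
      (n : ℝ) ^ γ * (μ / 2) := by
    have h6 : ((((n : ℝ) ^ γ * τ ^ γ : ℝ)) : ℂ) * powerSum c (l * (τ : ℂ) ^ 4) =
        (((n : ℝ) ^ γ : ℝ) : ℂ) * F (τ, l) := by
      rw [hF]
      push_cast
      ring
    rw [← h6]
    refine h1.trans ?_
    rw [mul_assoc]
    exact mul_le_mul_of_nonneg_left h2 hnp.le
  calc _ ≤ _ := norm_sub_le_norm_sub_add_norm_sub _ ((((n : ℝ) ^ γ : ℝ) : ℂ) * F (τ, l)) _
    _ ≤ (n : ℝ) ^ γ * (μ / 2) + (n : ℝ) ^ γ * (μ / 2) := add_le_add h5 h4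
    _ = (n : ℝ) ^ γ * μ := by ring
    _ ≤ _ := mul_le_mul_of_nonneg_left (hμK t ht) hnp.le

variable {α β : ℝ}

theorem exists_uniform_asymptotics_U (hα : -1 < α) (hβ : -1 < β) (h4 : β - α < 4) {K : Set ℝ}
    (hK : IsCompact K) (hK1 : K ⊆ Set.Ioc 0 1) {L : Set ℂ} (hL : IsCompact L) {ε : ℝ}
    (hε : 0 < ε) :
    ∃ δ : ℝ, 0 < δ ∧ ∃ N : ℕ, ∀ n : ℕ, N ≤ n → ∀ k : ℕ, Even k → ∀ t ∈ K,
      |(k : ℝ) / n - t| < δ → ∀ l ∈ L, ∀ i : Fin 4,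
        ‖(U k *ᵥ window (xSol α β (l / (n : ℂ) ^ 4)) k) i -
          (((n : ℝ) ^ α : ℝ) : ℂ) * (((t ^ α : ℝ) : ℂ) * powerSum (yLim α i) (l * (t : ℂ) ^ 4))‖ ≤
            (n : ℝ) ^ α * (ε * t ^ α) := by
  rcases K.eq_empty_or_nonempty with rfl | hKne
  · exact ⟨1, one_pos, 0, by simp⟩
  obtain ⟨t₀, ht₀K, ht₀⟩ := hK.exists_isLeast hKne
  have ht₀0 : 0 < t₀ := (hK1 ht₀K).1
  have hK2 : K ⊆ Set.Icc t₀ 1 := fun t ht => ⟨ht₀ ht, (hK1 ht).2⟩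
  choose δ hδ N hN using fun i : Fin 4 =>
    exists_uniform_asymptotics (yCoeff_uniformBound hα hβ h4 i) (yLim_expBound hα i)
      (yCoeff_asymp hα hβ h4 i) ht₀0 hK2 hL hε
  -- Taking `δ ≤ t₀` excludes `k = 0`, so that the even number `k` has the form `j + 2` required by
  -- `tsum_yCoeff`.
  refine ⟨min t₀ (Finset.univ.inf' Finset.univ_nonempty δ), lt_min ht₀0
    ((Finset.lt_inf'_iff _).2 fun i _ => hδ i), ∑ i, N i, fun n hn k hk t ht hkt l hl i => ?_⟩
  have hk0 : k ≠ 0 := by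
    rintro rfl
    have h1 := hkt.trans_le (min_le_left _ _)
    rw [Nat.cast_zero, zero_div, zero_sub, abs_neg, abs_of_pos (hK1 ht).1] at h1
    exact (ht₀ ht).not_gt h1
  obtain ⟨j, rfl⟩ : ∃ j, k = j + 2 := ⟨k - 2, by
    obtain ⟨r, hr⟩ := hk
    omega⟩
  have hj : Even j := by
    rw [Nat.even_add] at hk
    exact hk.2 even_two
  rw [← tsum_yCoeff hα hβ h4 _ hj]
  exact hN i n ((Finset.single_le_sum (fun _ _ => Nat.zero_le _) (Finset.mem_univ i)).trans hn) j t
    ht (hkt.trans_le ((min_le_right _ _).trans (Finset.inf'_le _ (Finset.mem_univ i)))) l hl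

/-- The components of the limit vectors as power series. -/
theorem yVec_eq (hα : -1 < α) (hβ : -1 < β) (j : Fin 2) (l : ℂ) {t : ℝ} (ht : 0 < t) (i : Fin 4) :
    yVec α β j t l i = ((t ^ b α β j : ℝ) : ℂ) *
      powerSum (yLim (b α β j) (![id, swap] j i)) (l * (t : ℂ) ^ 4) := by
  have h0 (a : ℝ) (i : Fin 4) (hi : i = 1 ∨ i = 3) (z : ℂ) : powerSum (yLim a i) z = 0 := by
    rcases hi with rfl | rfl <;> simp [powerSum, yLim]
  have e1 := yScalar_eq hα l ht
  have e2 := zScalar_eq hα l ht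
  have e3 := yScalar_eq hβ l ht
  have e4 := zScalar_eq hβ l ht
  fin_cases j <;> fin_cases i <;> simp [yVec, swap, b, h0, e1, e2, e3, e4]

theorem yVec_hasDerivAt (hα : -1 < α) (hβ : -1 < β) (j : Fin 2) (l : ℂ) {t : ℝ} (ht : 0 < t) :
    HasDerivAt (fun s : ℝ => yVec α β j s l)
      ((1 / (t : ℂ)) • (Mtilde₃ α β t l).mulVec (yVec α β j t l)) t := by
  have y1 := hasDerivAt_yScalar hα l ht
  have y2 := hasDerivAt_yScalar hβ l ht
  have z1 := hasDerivAt_zScalar hα l ht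
  have z2 := hasDerivAt_zScalar hβ l ht
  have h0 := hasDerivAt_const t (0 : ℂ)
  rw [hasDerivAt_pi]
  intro i
  fin_cases j <;> fin_cases i
  · refine y1.congr_deriv ?_
    simp [Mtilde₃, yVec]
    exact Or.inl (by ring)
  · refine h0.congr_deriv ?_
    simp [Mtilde₃, yVec]
  · refine z1.congr_deriv ?_
    simp [Mtilde₃, yVec]
    exact Or.inl (by ring)
  · refine h0.congr_deriv ?_
    simp [Mtilde₃, yVec]
  · refine h0.congr_deriv ?_
    simp [Mtilde₃, yVec]
  · refine y2.congr_deriv ?_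
    simp [Mtilde₃, yVec]
    exact Or.inl (by ring)
  · refine h0.congr_deriv ?_
    simp [Mtilde₃, yVec]
  · refine z2.congr_deriv ?_
    simp [Mtilde₃, yVec]
    exact Or.inl (by ring)

theorem b_gt (hα : -1 < α) (hβ : -1 < β) (j : Fin 2) : -1 < b α β j := by
  fin_cases j
  exacts [hα, hβ]

/-- After removal of the power of `t` a continuous power series in `l t^4` remains, whose value at 0
is its constant term. -/
theorem yVec_tendsto (hα : -1 < α) (hβ : -1 < β) (j : Fin 2) (l : ℂ) :
    Tendsto (fun t : ℝ => ((t ^ (-b α β j) : ℝ) : ℂ) • yVec α β j t l)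
      (𝓝[>] 0) (𝓝 (C₀ α β j)) := by
  rw [tendsto_pi_nhds]
  intro i
  have hc : Continuous fun t : ℝ =>
      powerSum (yLim (b α β j) (![id, swap] j i)) (l * (t : ℂ) ^ 4) :=
    (yLim_expBound (b_gt hα hβ j) _).continuous.comp (by fun_prop)
  have h0 : powerSum (yLim (b α β j) (![id, swap] j i)) (l * ((0 : ℝ) : ℂ) ^ 4) = C₀ α β j i := by
    rw [powerSum, tsum_eq_single 0 fun m hm => by simp [hm]]
    fin_cases j <;> fin_cases i <;> simp [yLim, swap, b, C₀, limCoeff]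
  rw [← h0]
  refine ((hc.tendsto 0).mono_left nhdsWithin_le_nhds).congr' ?_
  filter_upwards [self_mem_nhdsWithin] with t ht
  have ht0 : (0 : ℝ) < t := ht
  have hp := (Real.rpow_pos_of_pos ht0 (b α β j)).ne'
  rw [Pi.smul_apply, yVec_eq hα hβ j l ht0, smul_eq_mul, ← mul_assoc, ← Complex.ofReal_mul,
    Real.rpow_neg ht0.le, inv_mul_cancel₀ hp, Complex.ofReal_one, one_mul]

end

end

end MarkovJacobi

/-! ### The main theorem -/

theorem theorem2 (α β : ℝ) (hα : -1 < α) (hβ : -1 < β) (hαβ : |α - β| < 4)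
    (Y : Fin 2 → ℕ → ℂ → Fin 4 → ℂ)
    (hY₀ : ∀ (j : Fin 2) (lam : ℂ), Y j 0 lam = MarkovJacobi.YZero α β j 0)
    (hY : ∀ (j : Fin 2) (lam : ℂ) (k : ℕ), Even k →
      Y j (k + 2) lam = (MarkovJacobi.Mhat₂ α β k lam).mulVec (Y j k lam)) :
    ∀ j : Fin 2,
      -- for `lam = 0` the particular solutions are the explicit ones
      (∀ k : ℕ, Even k → Y j k 0 = MarkovJacobi.YZero α β j k) ∧
      -- `yVec` solves the limiting system on `(0, ∞)`
      (∀ (l : ℂ) (t : ℝ), 0 < t →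
        HasDerivAt (fun s : ℝ => MarkovJacobi.yVec α β j s l)
          ((1 / (t : ℂ)) •
            (MarkovJacobi.Mtilde₃ α β t l).mulVec (MarkovJacobi.yVec α β j t l)) t) ∧
      -- `yVec` satisfies the matching condition at `t = 0`
      (∀ l : ℂ,
        Filter.Tendsto
          (fun t : ℝ =>
            ((t ^ (-MarkovJacobi.b α β j) : ℝ) : ℂ) • MarkovJacobi.yVec α β j t l)
          (nhdsWithin 0 (Set.Ioi 0)) (nhds (MarkovJacobi.C₀ α β j))) ∧
      -- the uniform asymptotics as `n → ∞`, `k / n → t`, `k` even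
      (∀ K : Set ℝ, IsCompact K → K ⊆ Set.Ioc 0 1 →
        ∀ L : Set ℂ, IsCompact L →
          ∀ ε : ℝ, 0 < ε → ∃ δ : ℝ, 0 < δ ∧ ∃ N : ℕ,
            ∀ n : ℕ, N ≤ n → ∀ k : ℕ, Even k → ∀ t ∈ K, |(k : ℝ) / n - t| < δ →
              ∀ l ∈ L,
                ‖Y j k (l / (n : ℂ) ^ 4) -
                    (((n : ℝ) ^ MarkovJacobi.b α β j : ℝ) : ℂ) •
                      MarkovJacobi.yVec α β j t l‖ ≤
                  (n : ℝ) ^ MarkovJacobi.b α β j * (ε * t ^ MarkovJacobi.b α β j)) := by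
  intro j
  have habs := abs_lt.1 hαβ
  refine ⟨fun k hk => ?_, fun l t ht => MarkovJacobi.yVec_hasDerivAt hα hβ j l ht,
    fun l => MarkovJacobi.yVec_tendsto hα hβ j l, fun K hK hK1 L hL ε hε => ?_⟩
  · rw [MarkovJacobi.Y_eq hα hβ hαβ hY₀ hY j 0 hk, MarkovJacobi.window_xPart_lam_zero,
      MarkovJacobi.YZero]
  · have hnn (n : ℕ) {t : ℝ} (ht : t ∈ K) (a : ℝ) : 0 ≤ (n : ℝ) ^ a * (ε * t ^ a) :=
      mul_nonneg (Real.rpow_nonneg n.cast_nonneg a)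
        (mul_nonneg hε.le (Real.rpow_nonneg (hK1 ht).1.le a))
    fin_cases j
    · obtain ⟨δ, hδ, N, h⟩ := MarkovJacobi.exists_uniform_asymptotics_U (α := α) (β := β) hα hβ
        (by linarith) hK hK1 hL hε
      refine ⟨δ, hδ, N, fun n hn k hk t ht hkt l hl => ?_⟩
      refine (pi_norm_le_iff_of_nonneg (hnn n ht _)).2 fun i => ?_
      rw [MarkovJacobi.Y_eq hα hβ hαβ hY₀ hY _ _ hk, Pi.sub_apply, Pi.smul_apply,
        MarkovJacobi.yVec_eq hα hβ _ l (hK1 ht).1]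
      exact h n hn k hk t ht hkt l hl i
    -- The second solution: the same estimate with the parameters exchanged, transported by the sign
    -- alternation and the swap of components.
    · obtain ⟨δ, hδ, N, h⟩ := MarkovJacobi.exists_uniform_asymptotics_U (α := β) (β := α) hβ hα
        (by linarith) hK hK1 hL hε
      refine ⟨δ, hδ, N, fun n hn k hk t ht hkt l hl => ?_⟩
      refine (pi_norm_le_iff_of_nonneg (hnn n ht _)).2 fun i => ?_
      rw [MarkovJacobi.Y_eq hα hβ hαβ hY₀ hY _ _ hk, Pi.sub_apply, Pi.smul_apply,
        MarkovJacobi.yVec_eq hα hβ _ l (hK1 ht).1]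
      have := h n hn k hk t ht hkt l hl (MarkovJacobi.swap i)
      rw [← MarkovJacobi.U_mulVec_window_alternate _ hk] at this
      exact this
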